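/- Fix an integer $k\ge 2$. For $n\ge 1$ let $\tau_k(n)$ be the number of $k$-tuples $(m_1,\dots,m_k)$ of positive integers with $m_1\cdots m_k=n$, and for real $u_1,\dots,u_{k-1}\ge 0$ with $u_1+\cdots+u_{k-1}\le 1$ let $$F(u_1,\dots,u_{k-1})=\frac{1}{\Gamma(1/k)^{k}}\int_0^{u_1}\!\!\cdots\int_0^{u_{k-1}} \bigl(t_1\cdots t_{k-1}\,(1-t_1-\cdots-t_{k-1})\bigr)^{\frac1k-1}\,dt_{k-1}\cdots dt_1$$ be the distribution function of the Dirichlet distribution $\mathrm{Dir}(1/k,\dots,1/k)$. Then there is a constant $C$, depending only on $k$, such that for all real $x\ge 2$ and all real $u_1,\dots,u_{k-1}\ge 0$ with $u_1+\cdots+u_{k-1}\le 1$, $$\left|\frac1x\sum_{1\le n\le x}\frac{1}{\tau_k(n)}\,\#\bigl\{(d_1,\dots,d_{k-1})\in\mathbb{Z}_{\ge1}^{k-1}: d_1\cdots d_{k-1}\mid n,\ d_i\le n^{u_i}\text{ for } 1\le i\le k-1\bigr\}-F(u_1,\dots,u_{k-1})\right|\le \frac{C}{(\log x)^{1/k}}.$$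 Here the summand for $n$ is the probability that $d_i\le n^{u_i}$ for all $i<k$ when $(d_1,\dots,d_k)$ is chosen uniformly among the ordered factorizations $n=d_1\cdots d_k$ into positive integers. -/

import Mathlib

noncomputable section

/-- `τ_k(n)`: the number of ordered factorizations `n = m_1 ⋯ m_k` into positive integers. -/
def tauK (k n : ℕ) : ℕ := (Nat.finMulAntidiag k n).card

/-- The tuples `(d_1, …, d_{k-1})` of positive integers with `d_1 ⋯ d_{k-1} ∣ n` and
`d_i ≤ n ^ u_i` for all `i < k` (for `n ≥ 1`; each `d_i` then necessarily divides `n`). -/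
def smallTuples (k n : ℕ) (u : Fin (k - 1) → ℝ) : Finset (Fin (k - 1) → ℕ) :=
  open scoped Classical in
  (Fintype.piFinset fun _ : Fin (k - 1) => n.divisors).filter fun d =>
    (∏ i, d i) ∣ n ∧ ∀ i, (d i : ℝ) ≤ (n : ℝ) ^ u i

/-- `P(D_n^{(1)} ≤ u_1, …, D_n^{(k-1)} ≤ u_{k-1})` for a uniformly random ordered factorization of
`n` into `k` parts. -/
def factorizationCDF (k n : ℕ) (u : Fin (k - 1) → ℝ) : ℝ :=
  1 / (tauK k n : ℝ) * ((smallTuples k n u).card : ℝ)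

/-- The density of `Dir(α_1, …, α_k)` on the probability simplex. -/
def dirichletDensity {k : ℕ} (α t : Fin k → ℝ) : ℝ :=
  Real.Gamma (∑ i, α i) / (∏ i, Real.Gamma (α i)) * ∏ i, t i ^ (α i - 1)

/-- The point `(t_1, …, t_{k-1}, 1 - t_1 - ⋯ - t_{k-1})`. -/
def simplexPoint {k : ℕ} (t : Fin (k - 1) → ℝ) : Fin k → ℝ := fun i =>
  if h : (i : ℕ) < k - 1 then t ⟨i, h⟩ else 1 - ∑ j, t j

/-- The distribution function `F_α(u_1, …, u_{k-1})` of `Dir(α_1, …, α_k)`, for `u_i ≥ 0` with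
`u_1 + ⋯ + u_{k-1} ≤ 1`: the integral of the density over the box `∏ [0, u_i]`. -/
def dirichletCDF {k : ℕ} (α : Fin k → ℝ) (u : Fin (k - 1) → ℝ) : ℝ :=
  ∫ t in Set.Icc (0 : Fin (k - 1) → ℝ) u, dirichletDensity α (simplexPoint t)

end

section

open scoped ArithmeticFunction.zeta

/-! ### The convolution root of `ζ` -/

/-! Write κ = 1/k, L = log x, and let f = `rootZeta k`, so that the k-fold Dirichlet convolution f *
... * f is the constant 1 (`rootZeta_pow_self`). The products f(d_1)...f(d_k) are then nonnegative
weights of total mass 1 on the ordered factorizations of n, and on a squarefree n they are exactly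
the uniform weights (`prod_rootZeta_of_squarefree`). The proof replaces the uniform law by this
weighted law, whose mean over n is a convolution integral, and evaluates that integral by a
Tauberian argument.

Uniform to weighted. Write n = qs with s squarefree, q squarefull and (q, s) = 1. Both laws induce
the same law on the factorization c of s. The events d_i ≤ n^{u_i} and d_i ≤ x^{u_i} are both
decided by c, in the same way, unless some c_i lies between x^{u_i} s/x and x^{u_i}
(`abs_factorizationCDF_sub_le`). There are O(√(x/s)) squarefull q ≤ x/s
(`exists_sum_squarefree_part_le`), and with this weight the borderline c contribute O(L^{-κ})
(`exists_borderline_le`).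

Weighted sum as an integral. Let θ = Σ (f(n)/n) δ_{log n}. The mean of the weighted proportions is
the integral of e^{t_1+...+t_k-L} over t_1+...+t_k ≤ L, t_i ≤ u_i L, against the k-fold product of θ
(`ofReal_sum_weightedCDF`). It is the exponential mean at L of a convolution of truncations of θ.

Tauberian step. The Laplace transform of θ is G(1+z) with G = ζ^{1/k}, to be compared with z^{-κ},
the transform of the density v^{κ-1}/Γ(κ). Passing to exponential means divides both by s = 1+z. The
second derivative of (G(s) - (s-1)^{-κ})/s is O(|s-1|^{-1-κ} + |s-1|^{-1/2}) just to the right of Re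
s = 1 (`exists_hasDerivAt_rootZetaError`). No zero-free region is needed: the inputs are an upper
bound for (s-1)ζ(s) slightly left of the line and a lower bound of 3-4-1 type. Testing against a
bump of width 1/Y at height Y, and using that e^v times an exponential mean is nondecreasing, gives
agreement of the two exponential means up to O(Y^{-3/2}) (`exists_tame_and_expMean_sub_le`,
`exists_tame_rootMeasure`).

Replacement. The error Y^{-3/2} is integrable, so integrating it against a law with mass O(Y^{-κ})
on unit windows costs only O(L^{-κ}). The sum of the k-1 remaining coordinates has such a law,
because (k-1)κ = 1-κ. The k factors θ are therefore exchanged one at a time for the continuous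
measure (`expMeanENN_sumPi_restrict_le`). In the continuous model the exponential mean in the last
coordinate is replaced by the density itself, which after scaling by L is the Dirichlet integral
(`exists_sumPi_rpowMeasure_le`). -/

/-- The multiplicative function with Dirichlet series `ζ(s) ^ (1 / k)`. -/
noncomputable def rootZeta (k : ℕ) : ArithmeticFunction ℝ :=
  ⟨fun n => if n = 0 then 0 else n.factorization.prod fun _ a => Ring.multichoose (1 / (k : ℝ)) a,
    by simp⟩

lemma multichoose_eq_neg_one_pow_mul_choose (r : ℝ) (n : ℕ) :
    Ring.multichoose r n = (-1) ^ n * Ring.choose (-r) n := by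
  rw [Ring.choose_neg, Ring.multichoose_eq]
  rcases Nat.even_or_odd n with h | h
  · simp [h.neg_one_pow, Int.negOnePow_even _ (by exact_mod_cast h : Even (n : ℤ))]
  · simp [h.neg_one_pow, Int.negOnePow_odd _ (by exact_mod_cast h : Odd (n : ℤ)),
      Units.smul_def]

lemma multichoose_nonneg {r : ℝ} (hr : 0 ≤ r) (n : ℕ) : 0 ≤ Ring.multichoose r n := by
  have h := Ring.factorial_nsmul_multichoose_eq_ascPochhammer r n
  rw [Polynomial.ascPochhammer_smeval_eq_eval] at h
  have h2 : 0 ≤ (ascPochhammer ℝ n).eval r := by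
    rcases hr.eq_or_lt with rfl | hr
    · rw [ascPochhammer_eval_zero]; split_ifs <;> norm_num
    · exact (ascPochhammer_pos n r hr).le
  rw [← h, nsmul_eq_mul] at h2
  exact nonneg_of_mul_nonneg_right h2 (by positivity)

/-- The power series `(1 - X) ^ (-r)`. -/
noncomputable def multichooseSeries (r : ℝ) : PowerSeries ℝ :=
  PowerSeries.mk fun n => Ring.multichoose r n

lemma multichooseSeries_eq (r : ℝ) :
    multichooseSeries r = PowerSeries.rescale (-1) (PowerSeries.binomialSeries ℝ (-r)) := by
  ext n
  simp [multichooseSeries, PowerSeries.coeff_rescale, multichoose_eq_neg_one_pow_mul_choose]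

/-- Exponents of binomial series add, and X ↦ -X turns the binomial series of exponent -r into (1 -
X)^{-r}. At jr = 1 this is the geometric series, the local factor of ζ. -/
lemma multichooseSeries_pow (r : ℝ) (j : ℕ) :
    multichooseSeries r ^ j = multichooseSeries (j * r) := by
  induction j with
  | zero => simp [multichooseSeries_eq]
  | succ j ih =>
    rw [pow_succ, ih, multichooseSeries_eq, multichooseSeries_eq, multichooseSeries_eq, ← map_mul,
      ← PowerSeries.binomialSeries_add]
    congr 2
    push_cast; ring

lemma rootZeta_apply {k n : ℕ} (hn : n ≠ 0) :
    rootZeta k n = n.factorization.prod fun _ a => Ring.multichoose (1 / (k : ℝ)) a := by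
  simp [rootZeta, hn]

lemma rootZeta_isMultiplicative (k : ℕ) : (rootZeta k).IsMultiplicative := by
  rw [ArithmeticFunction.IsMultiplicative.iff_ne_zero]
  refine ⟨by simp [rootZeta_apply], fun {m n} hm hn hmn => ?_⟩
  rw [rootZeta_apply hm, rootZeta_apply hn, rootZeta_apply (mul_ne_zero hm hn),
    Nat.factorization_mul hm hn, Finsupp.prod_add_index_of_disjoint]
  exact hmn.disjoint_primeFactors

lemma rootZeta_nonneg (k n : ℕ) : 0 ≤ rootZeta k n := by
  rcases eq_or_ne n 0 with rfl | hn
  · simp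
  · rw [rootZeta_apply hn]
    exact Finset.prod_nonneg fun _ _ => multichoose_nonneg (by positivity) _

lemma rootZeta_prime_pow (k : ℕ) {p : ℕ} (hp : p.Prime) (a : ℕ) :
    rootZeta k (p ^ a) = Ring.multichoose (1 / (k : ℝ)) a := by
  rw [rootZeta_apply (pow_ne_zero _ hp.ne_zero), hp.factorization_pow, Finsupp.prod_single_index]
  simp

/-- On the powers of one prime, Dirichlet convolution is the Cauchy product of power series. -/
lemma rootZeta_pow_prime_pow (k j : ℕ) {p : ℕ} (hp : p.Prime) (a : ℕ) :
    (rootZeta k ^ j) (p ^ a) = PowerSeries.coeff a (multichooseSeries (1 / (k : ℝ)) ^ j) := by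
  induction j generalizing a with
  | zero =>
    simp only [pow_zero, ArithmeticFunction.one_apply, PowerSeries.coeff_one]
    simp [hp.ne_one]
  | succ j ih =>
    rw [pow_succ, pow_succ, ArithmeticFunction.mul_apply, PowerSeries.coeff_mul,
      Nat.sum_divisorsAntidiagonal (fun x y => (rootZeta k ^ j) x * rootZeta k y),
      Nat.sum_divisors_prime_pow hp, Finset.Nat.sum_antidiagonal_eq_sum_range_succ_mk]
    refine Finset.sum_congr rfl fun i hi => ?_
    rw [Finset.mem_range] at hi
    rw [Nat.pow_div (by lia) hp.pos, ih, rootZeta_prime_pow k hp]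
    simp [multichooseSeries]

lemma rootZeta_pow_self {k : ℕ} (hk : k ≠ 0) :
    rootZeta k ^ k = ((ζ : ArithmeticFunction ℕ) : ArithmeticFunction ℝ) := by
  refine (ArithmeticFunction.IsMultiplicative.eq_iff_eq_on_prime_powers _
    (rootZeta_isMultiplicative k).pow _
    ArithmeticFunction.isMultiplicative_zeta.natCast).2 fun p a hp => ?_
  rw [rootZeta_pow_prime_pow k k hp, multichooseSeries_pow, mul_one_div_cancel (by positivity)]
  simp [multichooseSeries, ArithmeticFunction.zeta_apply, hp.ne_zero]

lemma ArithmeticFunction.pow_apply_eq_sum_finMulAntidiag {R : Type*} [CommSemiring R]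
    (f : ArithmeticFunction R) (j n : ℕ) :
    (f ^ j) n = ∑ d ∈ Nat.finMulAntidiag j n, ∏ i, f (d i) := by
  induction j generalizing n with
  | zero =>
    rw [pow_zero, ArithmeticFunction.one_apply]
    split_ifs with h
    · subst h; simp [Nat.finMulAntidiag_one]
    · simp [Nat.finMulAntidiag_zero_left h]
  | succ j ih =>
    rw [pow_succ', ArithmeticFunction.mul_apply]
    simp_rw [ih, Finset.mul_sum]
    rw [Finset.sum_sigma']
    refine Finset.sum_bij' (fun x _ => (Fin.cons x.1.1 x.2 : Fin (j + 1) → ℕ))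
      (fun d _ => ⟨(d 0, ∏ i : Fin j, d i.succ), fun i => d i.succ⟩) ?_ ?_ ?_ ?_ ?_
    · rintro ⟨⟨a, b⟩, d⟩ h
      simp only [Finset.mem_sigma, Nat.mem_divisorsAntidiagonal, Nat.mem_finMulAntidiag] at h
      simp [Fin.prod_univ_succ, h.2.1, h.1.1, h.1.2]
    · intro d h
      rw [Nat.mem_finMulAntidiag, Fin.prod_univ_succ] at h
      simp only [Finset.mem_sigma, Nat.mem_divisorsAntidiagonal, Nat.mem_finMulAntidiag]
      refine ⟨h, trivial, fun h0 => h.2 ?_⟩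
      rw [← h.1, h0, mul_zero]
    · rintro ⟨⟨a, b⟩, d⟩ h
      simp only [Finset.mem_sigma, Nat.mem_divisorsAntidiagonal, Nat.mem_finMulAntidiag] at h
      simp [h.2.1]
    · intro d h
      ext i
      refine Fin.cases ?_ (fun i => ?_) i <;> simp
    · rintro ⟨⟨a, b⟩, d⟩ h
      simp [Fin.prod_univ_succ]

/-- This is the k-fold convolution identity evaluated at n. It makes the products of values of
`rootZeta k` a probability weight on factorizations. -/
lemma sum_prod_rootZeta {k n : ℕ} (hk : k ≠ 0) (hn : n ≠ 0) :
    ∑ d ∈ Nat.finMulAntidiag k n, ∏ i, rootZeta k (d i) = 1 := by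
  rw [← ArithmeticFunction.pow_apply_eq_sum_finMulAntidiag, rootZeta_pow_self hk]
  simp [hn]

/-- The factorization (n, 1, ..., 1) contributes this value to a sum of nonnegative terms equal to
1. -/
lemma rootZeta_le_one {k : ℕ} (hk : k ≠ 0) (n : ℕ) : rootZeta k n ≤ 1 := by
  rcases eq_or_ne n 0 with rfl | hn
  · simp
  obtain ⟨m, rfl⟩ := Nat.exists_eq_succ_of_ne_zero hk
  rw [← sum_prod_rootZeta hk hn]
  refine le_trans (le_of_eq ?_) (Finset.single_le_sum
    (f := fun d : Fin (m + 1) → ℕ => ∏ i, rootZeta (m + 1) (d i))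
    (fun d _ => Finset.prod_nonneg fun i _ => rootZeta_nonneg _ _)
    (a := Fin.cons n fun _ => 1) ?_)
  · simp [Fin.prod_univ_succ, (rootZeta_isMultiplicative (m + 1)).map_one]
  · simp [Fin.prod_univ_succ, hn]

end

section

open Complex Filter Topology

/-! ### Bounds for `(s - 1) ζ(s)` near the line `Re s = 1` -/

/-- The `M`-th partial sum of the Euler–Maclaurin expansion of `(s - 1) ζ(s)`. -/
noncomputable def zetaPartial (M : ℕ) (s : ℂ) : ℂ :=
  (s - 1) * ∑ n ∈ Finset.range M, ((n + 1 : ℕ) : ℂ) ^ (-s) + (M : ℂ) ^ (1 - s)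

/-- The increment is ψ(m+1) - ψ(m) for ψ(x) = (s-1)(x-m)x^{-s} + x^{1-s}. In ψ' the two terms of
order x^{-s} cancel, leaving -s(s-1)(x-m)x^{-s-1}, and the mean value inequality applies. The gain
of one power of m makes the increments summable to the left of Re s = 1. -/
lemma norm_zetaPartial_succ_sub_le {m : ℕ} (hm : 1 ≤ m) {s : ℂ} (hs : 0 ≤ s.re) :
    ‖zetaPartial (m + 1) s - zetaPartial m s‖ ≤ ‖s‖ * ‖s - 1‖ * (m : ℝ) ^ (-s.re - 1) := by
  have hm0 : (0 : ℝ) < m := by exact_mod_cast hm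
  set ψ : ℝ → ℂ := fun x => (s - 1) * ((x - m : ℝ) : ℂ) * (x : ℂ) ^ (-s) + (x : ℂ) ^ (1 - s)
  set ψ' : ℝ → ℂ := fun x => -s * (s - 1) * ((x - m : ℝ) : ℂ) * (x : ℂ) ^ (-s - 1)
  have hd : ∀ x ∈ Set.Icc (m : ℝ) (m + 1), HasDerivWithinAt ψ (ψ' x) (Set.Icc (m : ℝ) (m + 1)) x := by
    intro x hx
    have hx0 : 0 < x := hm0.trans_le hx.1
    have hx0' : (x : ℂ) ≠ 0 := by exact_mod_cast hx0.ne'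
    have hsl : (x : ℂ) ∈ Complex.slitPlane := Complex.ofReal_mem_slitPlane.2 hx0
    have h1 : HasDerivAt (fun x : ℝ => (x : ℂ) ^ (-s)) (-s * (x : ℂ) ^ (-s - 1)) x := by
      simpa using ((hasDerivAt_id (x : ℂ)).cpow_const (c := -s) hsl).comp_ofReal
    have h2 : HasDerivAt (fun x : ℝ => (x : ℂ) ^ (1 - s)) ((1 - s) * (x : ℂ) ^ (1 - s - 1)) x := by
      simpa using ((hasDerivAt_id (x : ℂ)).cpow_const (c := 1 - s) hsl).comp_ofReal
    have h3 : HasDerivAt (fun x : ℝ => ((x - m : ℝ) : ℂ)) 1 x := by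
      simpa using ((hasDerivAt_id x).sub_const (m : ℝ)).ofReal_comp
    have h4 := ((h3.const_mul (s - 1)).mul h1).add h2
    refine (h4.congr_deriv ?_).hasDerivWithinAt
    simp only [ψ']
    rw [show 1 - s - 1 = -s by ring]
    ring
  have hb : ∀ x ∈ Set.Ico (m : ℝ) (m + 1), ‖ψ' x‖ ≤ ‖s‖ * ‖s - 1‖ * (m : ℝ) ^ (-s.re - 1) := by
    intro x hx
    have hx0 : 0 < x := hm0.trans_le hx.1
    simp only [ψ', norm_mul, norm_neg]
    have e1 : ‖((x - m : ℝ) : ℂ)‖ ≤ 1 := by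
      rw [Complex.norm_real, Real.norm_of_nonneg (by linarith [hx.1])]
      linarith [hx.2]
    have e2 : ‖(x : ℂ) ^ (-s - 1)‖ ≤ (m : ℝ) ^ (-s.re - 1) := by
      rw [Complex.norm_cpow_eq_rpow_re_of_pos hx0]
      simp only [sub_re, neg_re, one_re]
      exact Real.rpow_le_rpow_of_nonpos hm0 hx.1 (by linarith)
    calc ‖s‖ * ‖s - 1‖ * ‖((x - m : ℝ) : ℂ)‖ * ‖(x : ℂ) ^ (-s - 1)‖
        ≤ ‖s‖ * ‖s - 1‖ * 1 * (m : ℝ) ^ (-s.re - 1) := by gcongr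
      _ = _ := by ring
  have := norm_image_sub_le_of_norm_deriv_le_segment' hd hb (m + 1) (by simp)
  have e : ψ (m + 1) - ψ m = zetaPartial (m + 1) s - zetaPartial m s := by
    simp only [ψ, zetaPartial, Finset.sum_range_succ]
    push_cast
    simp
    ring
  rw [e] at this
  simpa using this

lemma tendsto_zetaPartial {s : ℂ} (hs : 1 < s.re) :
    Tendsto (fun M => zetaPartial M s) atTop (𝓝 (riemannZeta₁ s)) := by
  have hs1 : s ≠ 1 := by rintro rfl; simp at hs
  have h1 : riemannZeta₁ s = (s - 1) * riemannZeta s + 0 := by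
    rw [riemannZeta_eq_inv_sub_mul hs1]; field_simp [sub_ne_zero.2 hs1]; simp
  rw [h1]
  refine Tendsto.add (Tendsto.const_mul _ ?_) ?_
  · have hsum : Summable fun n : ℕ => ((n + 1 : ℕ) : ℂ) ^ (-s) := by
      have := (summable_nat_add_iff 1).2 (Complex.summable_one_div_nat_cpow.2 hs)
      refine this.congr fun n => ?_
      rw [Complex.cpow_neg, one_div]
    have := hsum.hasSum.tendsto_sum_nat
    convert this using 2
    rw [zeta_eq_tsum_one_div_nat_add_one_cpow hs]
    refine tsum_congr fun n => ?_
    rw [Complex.cpow_neg, one_div]; push_cast; rfl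
  · rw [tendsto_zero_iff_norm_tendsto_zero]
    have : Tendsto (fun M : ℕ => (M : ℝ) ^ (-(s.re - 1))) atTop (𝓝 0) :=
      (tendsto_rpow_neg_atTop (by linarith)).comp tendsto_natCast_atTop_atTop
    refine this.congr' ?_
    filter_upwards [eventually_gt_atTop 0] with M hM
    rw [Complex.norm_natCast_cpow_of_pos hM]
    simp

lemma differentiable_zetaPartial {M : ℕ} (hM : 1 ≤ M) : Differentiable ℂ (zetaPartial M) := by
  unfold zetaPartial
  refine ((differentiable_id.sub_const 1).mul ?_).add ?_
  · refine Differentiable.fun_sum fun n _ => ?_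
    refine Differentiable.const_cpow (differentiable_id.neg) (Or.inl ?_)
    exact_mod_cast Nat.succ_ne_zero n
  · refine Differentiable.const_cpow (by fun_prop) (Or.inl ?_)
    exact_mod_cast (by lia : M ≠ 0)

lemma summable_nat_add_rpow {p : ℝ} (hp : p < -1) (N : ℕ) :
    Summable fun j : ℕ => ((N + j : ℕ) : ℝ) ^ p := by
  have := (summable_nat_add_iff N).2 (Real.summable_nat_rpow.2 hp)
  simpa [add_comm] using this

/-- For Re s > 1 the series telescopes to the limit of the partial sums. Both sides are analytic
further left, where the identity theorem carries the equality. -/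
lemma riemannZeta₁_eq_zetaPartial_add_tsum {N : ℕ} (hN : 1 ≤ N) {s : ℂ} (hs : 1 / 2 < s.re) :
    riemannZeta₁ s = zetaPartial N s +
      ∑' j : ℕ, (zetaPartial (N + j + 1) s - zetaPartial (N + j) s) := by
  -- The region is bounded so that the factor ‖z‖‖z - 1‖ is uniformly controlled; the radius is
  -- large enough to contain both s and the base point 2.
  set R : ℝ := ‖s‖ + 3
  set U : Set ℂ := {z | 1 / 2 < z.re} ∩ Metric.ball 0 R
  have hUo : IsOpen U := (isOpen_lt continuous_const Complex.continuous_re).inter Metric.isOpen_ball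
  have hUc : IsPreconnected U :=
    ((convex_halfSpace_re_gt _).inter (convex_ball 0 R)).isPreconnected
  have hbound : ∀ j : ℕ, ∀ z ∈ U, ‖zetaPartial (N + j + 1) z - zetaPartial (N + j) z‖ ≤
      R * (R + 1) * ((N + j : ℕ) : ℝ) ^ (-(3 / 2) : ℝ) := by
    intro j z hz
    have hz2 : ‖z‖ < R := by simpa using hz.2
    have hz1 : 1 / 2 < z.re := hz.1
    refine (norm_zetaPartial_succ_sub_le (by lia) (by linarith)).trans ?_
    have : ‖z - 1‖ ≤ R + 1 := (norm_sub_le _ _).trans (by simp; linarith)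
    gcongr
    · exact_mod_cast (by lia : 1 ≤ N + j)
    · linarith
  have hsum : Summable fun j : ℕ => R * (R + 1) * ((N + j : ℕ) : ℝ) ^ (-(3 / 2) : ℝ) :=
    (summable_nat_add_rpow (by norm_num) N).mul_left _
  have hd : DifferentiableOn ℂ (fun z => zetaPartial N z +
      ∑' j : ℕ, (zetaPartial (N + j + 1) z - zetaPartial (N + j) z)) U := by
    refine (differentiable_zetaPartial hN).differentiableOn.add ?_
    refine differentiableOn_tsum_of_summable_norm hsum (fun j => ?_) hUo hbound
    exact ((differentiable_zetaPartial (by lia)).sub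
      (differentiable_zetaPartial (by lia))).differentiableOn
  have h2 : (2 : ℂ) ∈ U := by
    refine ⟨by norm_num, ?_⟩
    simp [R]; linarith [norm_nonneg s]
  have key := (differentiable_riemannZeta₁.differentiableOn.analyticOnNhd
    hUo).eqOn_of_preconnected_of_eventuallyEq (hd.analyticOnNhd hUo) hUc h2 ?_
  · exact key ⟨hs, by simp [R]⟩
  · have : ∀ᶠ z : ℂ in 𝓝 2, 1 < z.re :=
      (isOpen_lt continuous_const Complex.continuous_re).mem_nhds (by norm_num)
    filter_upwards [this, hUo.mem_nhds h2] with z hz hzU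
    have hs2 : Summable fun j : ℕ => (zetaPartial (N + j + 1) z - zetaPartial (N + j) z) :=
      Summable.of_norm_bounded hsum fun j => hbound j z hzU
    have ht := hs2.hasSum.tendsto_sum_nat
    have he : ∀ n, ∑ j ∈ Finset.range n, (zetaPartial (N + j + 1) z - zetaPartial (N + j) z) =
        zetaPartial (N + n) z - zetaPartial N z := fun n =>
      Finset.sum_range_sub (fun j => zetaPartial (N + j) z) n
    simp_rw [he] at ht
    have ht2 : Tendsto (fun n => zetaPartial (N + n) z - zetaPartial N z) atTop
        (𝓝 (riemannZeta₁ z - zetaPartial N z)) := by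
      have := ((tendsto_add_atTop_iff_nat N).2 (tendsto_zetaPartial hz)).sub_const
        (zetaPartial N z)
      simpa [add_comm] using this
    rw [tendsto_nhds_unique ht ht2]
    ring

/-- Convexity-type bound for `(s - 1) ζ(s)` slightly to the left of the line `Re s = 1`. -/
lemma exists_norm_riemannZeta₁_le : ∃ C : ℝ, 0 < C ∧ ∀ s : ℂ, 1 - 1 / 100 ≤ s.re →
    ‖riemannZeta₁ s‖ ≤ C * (1 + ‖s‖) ^ (1 + 1 / 50 : ℝ) := by
  set D : ℝ := ∑' n : ℕ, ((n : ℕ) : ℝ) ^ (-(101 / 100) : ℝ) with hD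
  have hDs : Summable fun n : ℕ => (n : ℝ) ^ (-(101 / 100) : ℝ) :=
    Real.summable_nat_rpow.2 (by norm_num)
  have hD0 : 0 ≤ D := tsum_nonneg fun n => by positivity
  refine ⟨4 * D + 2, by positivity, fun s hs => ?_⟩
  set X : ℝ := 1 + ‖s‖ with hX
  have hX1 : 1 ≤ X := by simp [hX]
  -- Truncation at N of size |s| balances the main sum, of order |s| N^{1/50}, against the tail, of
  -- order |s|² N^{-1+1/50}.
  set N : ℕ := ⌈X⌉₊ with hN
  have hXN : X ≤ N := Nat.le_ceil _
  have hNX : (N : ℝ) ≤ 2 * X := by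
    have := (Nat.ceil_lt_add_one (by linarith : 0 ≤ X)).le
    linarith
  have hN1 : 1 ≤ N := by exact_mod_cast hX1.trans hXN
  have hN0 : (1 : ℝ) ≤ N := by exact_mod_cast hN1
  have hs1 : ‖s - 1‖ ≤ X := (norm_sub_le _ _).trans (by simp [hX, add_comm])
  have hsX : ‖s‖ ≤ X := by simp [hX]
  have hNp : (N : ℝ) ^ (1 / 50 : ℝ) ≤ 2 * X ^ (1 / 50 : ℝ) := by
    calc (N : ℝ) ^ (1 / 50 : ℝ) ≤ (2 * X) ^ (1 / 50 : ℝ) := by gcongr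
      _ = 2 ^ (1 / 50 : ℝ) * X ^ (1 / 50 : ℝ) := Real.mul_rpow (by norm_num) (by linarith)
      _ ≤ 2 ^ (1 : ℝ) * X ^ (1 / 50 : ℝ) := by
        gcongr <;> norm_num
      _ = _ := by norm_num
  -- the main partial sum
  have hA : ‖∑ n ∈ Finset.range N, ((n + 1 : ℕ) : ℂ) ^ (-s)‖ ≤ (N : ℝ) ^ (1 / 50 : ℝ) * D := by
    refine (norm_sum_le _ _).trans ?_
    have : ∀ n ∈ Finset.range N, ‖((n + 1 : ℕ) : ℂ) ^ (-s)‖ ≤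
        (N : ℝ) ^ (1 / 50 : ℝ) * ((n + 1 : ℕ) : ℝ) ^ (-(101 / 100) : ℝ) := by
      intro n hn
      rw [Complex.norm_natCast_cpow_of_pos (Nat.succ_pos n)]
      have hn1 : (1 : ℝ) ≤ ((n + 1 : ℕ) : ℝ) := by simp
      have hnN : ((n + 1 : ℕ) : ℝ) ≤ N := by
        exact_mod_cast Finset.mem_range.1 hn
      calc ((n + 1 : ℕ) : ℝ) ^ (-s).re ≤ ((n + 1 : ℕ) : ℝ) ^ ((1 / 50 : ℝ) + (-(101 / 100))) := by
            apply Real.rpow_le_rpow_of_exponent_le hn1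
            simp; linarith
        _ = ((n + 1 : ℕ) : ℝ) ^ (1 / 50 : ℝ) * ((n + 1 : ℕ) : ℝ) ^ (-(101 / 100) : ℝ) :=
            Real.rpow_add (by linarith) _ _
        _ ≤ _ := by gcongr
    refine (Finset.sum_le_sum this).trans ?_
    rw [← Finset.mul_sum]
    gcongr
    have h3 := (summable_nat_add_iff 1).2 hDs
    refine (h3.sum_le_tsum _ (fun _ _ => by positivity)).trans ?_
    rw [hD, hDs.tsum_eq_zero_add]
    simp
  have hB : ‖(N : ℂ) ^ (1 - s)‖ ≤ (N : ℝ) ^ (1 / 50 : ℝ) := by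
    rw [Complex.norm_natCast_cpow_of_pos hN1]
    apply Real.rpow_le_rpow_of_exponent_le hN0
    simp; linarith
  have hT : ‖∑' j : ℕ, (zetaPartial (N + j + 1) s - zetaPartial (N + j) s)‖ ≤
      ‖s‖ * ‖s - 1‖ * ((N : ℝ) ^ (-1 + 1 / 50 : ℝ) * D) := by
    have hsN : Summable fun j : ℕ => ((N + j : ℕ) : ℝ) ^ (-(101 / 100) : ℝ) :=
      summable_nat_add_rpow (by norm_num) N
    have hb : ∀ j : ℕ, ‖zetaPartial (N + j + 1) s - zetaPartial (N + j) s‖ ≤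
        ‖s‖ * ‖s - 1‖ * (N : ℝ) ^ (-1 + 1 / 50 : ℝ) * ((N + j : ℕ) : ℝ) ^ (-(101 / 100) : ℝ) := by
      intro j
      refine (norm_zetaPartial_succ_sub_le (by lia) (by linarith)).trans ?_
      rw [mul_assoc (‖s‖ * ‖s - 1‖)]
      gcongr
      have hnN : (N : ℝ) ≤ ((N + j : ℕ) : ℝ) := by simp
      calc ((N + j : ℕ) : ℝ) ^ (-s.re - 1)
          ≤ ((N + j : ℕ) : ℝ) ^ ((-1 + 1 / 50 : ℝ) + (-(101 / 100))) := by
            apply Real.rpow_le_rpow_of_exponent_le (hN0.trans hnN)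
            linarith
        _ = ((N + j : ℕ) : ℝ) ^ (-1 + 1 / 50 : ℝ) * ((N + j : ℕ) : ℝ) ^ (-(101 / 100) : ℝ) :=
            Real.rpow_add (by linarith) _ _
        _ ≤ _ := by
          gcongr ?_ * _
          exact Real.rpow_le_rpow_of_nonpos (by linarith) hnN (by norm_num)
    refine (tsum_of_norm_bounded ((hsN.mul_left _).hasSum) hb).trans ?_
    rw [tsum_mul_left, ← mul_assoc]
    gcongr
    have := hDs.sum_add_tsum_nat_add N
    have h0 : 0 ≤ ∑ i ∈ Finset.range N, (i : ℝ) ^ (-(101 / 100) : ℝ) :=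
      Finset.sum_nonneg fun i _ => by positivity
    simp_rw [add_comm _ N] at this
    rw [← hD] at this
    linarith
  rw [riemannZeta₁_eq_zetaPartial_add_tsum hN1 (by linarith)]
  have hNm : (N : ℝ) ^ (-1 + 1 / 50 : ℝ) ≤ X⁻¹ * (N : ℝ) ^ (1 / 50 : ℝ) := by
    rw [Real.rpow_add (by linarith), Real.rpow_neg_one]
    gcongr
  have hXp : X ^ (1 + 1 / 50 : ℝ) = X * X ^ (1 / 50 : ℝ) := by
    rw [Real.rpow_add (by linarith), Real.rpow_one]
  have hXp0 : 1 ≤ X ^ (1 / 50 : ℝ) := Real.one_le_rpow hX1 (by norm_num)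
  calc ‖zetaPartial N s + ∑' j : ℕ, (zetaPartial (N + j + 1) s - zetaPartial (N + j) s)‖
      ≤ ‖s - 1‖ * ‖∑ n ∈ Finset.range N, ((n + 1 : ℕ) : ℂ) ^ (-s)‖ + ‖(N : ℂ) ^ (1 - s)‖ +
        ‖∑' j : ℕ, (zetaPartial (N + j + 1) s - zetaPartial (N + j) s)‖ := by
        refine (norm_add_le _ _).trans ?_
        gcongr
        unfold zetaPartial
        exact (norm_add_le _ _).trans (by rw [norm_mul])
    _ ≤ X * ((N : ℝ) ^ (1 / 50 : ℝ) * D) + (N : ℝ) ^ (1 / 50 : ℝ) +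
        X * X * ((X⁻¹ * (N : ℝ) ^ (1 / 50 : ℝ)) * D) := by
        gcongr
        refine hT.trans ?_
        gcongr
    _ = (2 * X * D + 1) * (N : ℝ) ^ (1 / 50 : ℝ) := by field_simp; ring
    _ ≤ (2 * X * D + X) * (2 * X ^ (1 / 50 : ℝ)) := by gcongr
    _ = _ := by rw [hXp]; ring

end

/-! ### Derivatives of (s - 1) ζ(s) and its lower bound near Re s = 1 -/

section

open Complex Filter Topology

/-- Cauchy's estimate on the circle of radius r about s. The factor 2^p absorbs the passage from 1 +
‖z‖ to 1 + ‖s‖. -/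
lemma norm_deriv_le_of_norm_le_one_add_rpow {f : ℂ → ℂ} (hf : Differentiable ℂ f) {a C p r : ℝ}
    (hC : 0 ≤ C) (hp : 0 ≤ p) (hr : 0 < r) (hr1 : r ≤ 1)
    (h : ∀ s : ℂ, a ≤ s.re → ‖f s‖ ≤ C * (1 + ‖s‖) ^ p) {s : ℂ} (hs : a + r ≤ s.re) :
    ‖deriv f s‖ ≤ C * 2 ^ p / r * (1 + ‖s‖) ^ p := by
  have h1 : ∀ z ∈ Metric.sphere s r, ‖f z‖ ≤ C * 2 ^ p * (1 + ‖s‖) ^ p := by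
    intro z hz
    have hzs : ‖z - s‖ = r := by simpa using hz
    have hre : a ≤ z.re := by
      have := (abs_re_le_norm (z - s)).trans hzs.le
      rw [sub_re, abs_le] at this
      linarith [this.1]
    refine (h z hre).trans ?_
    rw [mul_assoc, ← Real.mul_rpow (by norm_num) (by positivity)]
    have : ‖z‖ ≤ ‖s‖ + r := by
      calc ‖z‖ = ‖s + (z - s)‖ := by ring_nf
        _ ≤ _ := (norm_add_le _ _).trans (by rw [hzs])
    gcongr
    linarith [norm_nonneg s]
  have := Complex.norm_deriv_le_of_forall_mem_sphere_norm_le hr hf.diffContOnCl h1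
  refine this.trans (le_of_eq ?_)
  ring

lemma differentiable_deriv_riemannZeta₁ : Differentiable ℂ (deriv riemannZeta₁) :=
  fun s => (differentiable_riemannZeta₁.analyticAt s).deriv.differentiableAt

/-- Two Cauchy estimates of radius 1/200 spend the margin 1/100 available to the left of the line.
-/
lemma exists_norm_deriv_riemannZeta₁_le : ∃ C : ℝ, 0 < C ∧ ∀ s : ℂ, 1 ≤ s.re →
    ‖riemannZeta₁ s‖ ≤ C * (1 + ‖s‖) ^ (51 / 50 : ℝ) ∧
    ‖deriv riemannZeta₁ s‖ ≤ C * (1 + ‖s‖) ^ (51 / 50 : ℝ) ∧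
    ‖deriv (deriv riemannZeta₁) s‖ ≤ C * (1 + ‖s‖) ^ (51 / 50 : ℝ) := by
  obtain ⟨C, hC, h⟩ := exists_norm_riemannZeta₁_le
  have e : (1 + 1 / 50 : ℝ) = 51 / 50 := by norm_num
  rw [e] at h
  have h1 : ∀ s : ℂ, 1 - 1 / 200 ≤ s.re →
      ‖deriv riemannZeta₁ s‖ ≤ C * 2 ^ (51 / 50 : ℝ) / (1 / 200) * (1 + ‖s‖) ^ (51 / 50 : ℝ) :=
    fun s hs => norm_deriv_le_of_norm_le_one_add_rpow differentiable_riemannZeta₁ hC.le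
      (by norm_num) (by norm_num) (by norm_num) h (by linarith)
  have h2 : ∀ s : ℂ, 1 ≤ s.re → ‖deriv (deriv riemannZeta₁) s‖ ≤
      C * 2 ^ (51 / 50 : ℝ) / (1 / 200) * 2 ^ (51 / 50 : ℝ) / (1 / 200) *
        (1 + ‖s‖) ^ (51 / 50 : ℝ) :=
    fun s hs => norm_deriv_le_of_norm_le_one_add_rpow differentiable_deriv_riemannZeta₁
      (by positivity) (by norm_num) (by norm_num) (by norm_num) h1 (by linarith)
  refine ⟨C + C * 2 ^ (51 / 50 : ℝ) / (1 / 200) +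
    C * 2 ^ (51 / 50 : ℝ) / (1 / 200) * 2 ^ (51 / 50 : ℝ) / (1 / 200), by positivity,
    fun s hs => ⟨(h s (by linarith)).trans ?_, (h1 s (by linarith)).trans ?_,
      (h2 s hs).trans ?_⟩⟩ <;> gcongr
  · rw [add_assoc]; exact le_add_of_nonneg_right (by positivity)
  · rw [add_assoc, add_left_comm]; exact le_add_of_nonneg_right (by positivity)
  · exact le_add_of_nonneg_left (by positivity)

lemma riemannZeta₁_eq {s : ℂ} (hs : s ≠ 1) : riemannZeta₁ s = (s - 1) * riemannZeta s := by
  rw [riemannZeta_eq_inv_sub_mul hs, mul_inv_cancel_left₀ (sub_ne_zero.2 hs)]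

lemma riemannZeta₁_ne_zero {s : ℂ} (hs : 1 ≤ s.re) : riemannZeta₁ s ≠ 0 := by
  rcases eq_or_ne s 1 with rfl | h
  · simp
  · rw [riemannZeta₁_eq h]
    exact mul_ne_zero (sub_ne_zero.2 h) (riemannZeta_ne_zero_of_one_le_re hs)

/-- The classical inequality |ζ(1+x)³ ζ(1+x+iy)⁴ ζ(1+x+2iy)| ≥ 1, with each ζ multiplied by its
factor s - 1 and that factor bounded below by x or |y|. -/
lemma three_four_one_riemannZeta₁ {x : ℝ} (hx : 0 < x) (y : ℝ) :
    x ^ 3 * |y| ^ 4 * |y| ≤ ‖riemannZeta₁ (1 + x)‖ ^ 3 * ‖riemannZeta₁ (1 + x + I * y)‖ ^ 4 *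
      ‖riemannZeta₁ (1 + x + 2 * I * y)‖ := by
  have h := DirichletCharacter.norm_LFunction_product_ge_one (N := 1) 1 hx y
  simp only [DirichletCharacter.LFunctionTrivChar, one_pow,
    DirichletCharacter.LFunction_modOne_eq] at h
  have hre : ∀ z : ℂ, z.re = 1 + x → z ≠ 1 := by
    rintro z hz rfl
    simp at hz; linarith
  have n1 : (1 + x : ℂ) ≠ 1 := hre _ (by simp)
  have n2 : (1 + x + I * y : ℂ) ≠ 1 := hre _ (by simp)
  have n3 : (1 + x + 2 * I * y : ℂ) ≠ 1 := hre _ (by simp)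
  rw [riemannZeta₁_eq n1, riemannZeta₁_eq n2, riemannZeta₁_eq n3]
  simp only [norm_mul, norm_pow] at h ⊢
  have e1 : x ≤ ‖(1 + x - 1 : ℂ)‖ := by
    rw [add_sub_cancel_left, norm_real, Real.norm_of_nonneg hx.le]
  have e2 : |y| ≤ ‖(1 + x + I * y - 1 : ℂ)‖ := by
    have := abs_im_le_norm (1 + x + I * y - 1 : ℂ)
    simpa using this
  have e3 : |y| ≤ ‖(1 + x + 2 * I * y - 1 : ℂ)‖ := by
    have := abs_im_le_norm (1 + x + 2 * I * y - 1 : ℂ)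
    simp [abs_mul] at this
    linarith [abs_nonneg y]
  calc x ^ 3 * |y| ^ 4 * |y| ≤ ‖(1 + x - 1 : ℂ)‖ ^ 3 * ‖(1 + x + I * y - 1 : ℂ)‖ ^ 4 *
        ‖(1 + x + 2 * I * y - 1 : ℂ)‖ * 1 := by
        rw [mul_one]; gcongr
    _ ≤ ‖(1 + x - 1 : ℂ)‖ ^ 3 * ‖(1 + x + I * y - 1 : ℂ)‖ ^ 4 *
        ‖(1 + x + 2 * I * y - 1 : ℂ)‖ * _ := mul_le_mul_of_nonneg_left h (by positivity)
    _ = _ := by ring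

/-- The 3-4-1 inequality is solved for its middle factor. With |y| comparable to X, the fourth power
is at least a constant times x³ X⁵ / X^{51/50}, whence the exponents 3/4 and 199/200. -/
lemma exists_le_norm_riemannZeta₁_of_one_le_im : ∃ c : ℝ, 0 < c ∧ ∀ s : ℂ, 1 < s.re → s.re ≤ 2 →
    1 ≤ |s.im| → c * ((s.re - 1) ^ (3 / 4 : ℝ) * (1 + ‖s‖) ^ (199 / 200 : ℝ)) ≤
      ‖riemannZeta₁ s‖ := by
  obtain ⟨C, hC, h⟩ := exists_norm_deriv_riemannZeta₁_le
  set K : ℝ := 4 ^ 5 * ((C * 3 ^ (51 / 50 : ℝ)) ^ 3 * (C * 2 ^ (51 / 50 : ℝ))) with hK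
  have hK0 : 0 < K := by positivity
  refine ⟨K⁻¹ ^ (1 / 4 : ℝ), by positivity, fun s hs1 hs2 him => ?_⟩
  set x : ℝ := s.re - 1
  set y : ℝ := s.im
  set X : ℝ := 1 + ‖s‖ with hX
  have hx : 0 < x := by simp only [x]; linarith
  have hs : s = 1 + x + I * y := by
    apply Complex.ext <;> simp [x, y]
  have key := three_four_one_riemannZeta₁ hx y
  rw [← hs] at key
  have hns : ‖s‖ ≤ 2 + |y| := by
    refine (norm_le_abs_re_add_abs_im s).trans ?_
    rw [abs_of_pos (by linarith)]
    gcongr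
  have hXy : X / 4 ≤ |y| := by rw [hX]; linarith
  have b1 : ‖riemannZeta₁ (1 + x)‖ ≤ C * 3 ^ (51 / 50 : ℝ) := by
    refine (h (1 + x) (by simp [hx.le])).1.trans ?_
    gcongr
    have : ‖(1 + x : ℂ)‖ = 1 + x := by
      rw [← ofReal_one, ← ofReal_add, norm_real, Real.norm_of_nonneg (by linarith)]
    rw [this]; simp only [x]; linarith
  have b2 : ‖riemannZeta₁ (1 + x + 2 * I * y)‖ ≤ C * 2 ^ (51 / 50 : ℝ) * X ^ (51 / 50 : ℝ) := by
    refine (h _ (by simp [hx.le])).1.trans ?_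
    rw [mul_assoc C, ← Real.mul_rpow (by norm_num) (by positivity)]
    gcongr
    have : ‖(1 + x + 2 * I * y : ℂ)‖ ≤ 2 * ‖s‖ := by
      have e : (1 + x + 2 * I * y : ℂ) = s + I * y := by rw [hs]; ring
      rw [e]
      refine (norm_add_le _ _).trans ?_
      have := abs_im_le_norm s
      simp [y]; linarith
    linarith
  have hB4 : K⁻¹ * (x ^ 3 * X ^ (199 / 50 : ℝ)) ≤ ‖riemannZeta₁ s‖ ^ 4 := by
    have hX0 : 0 < X := by positivity
    have hXe : X ^ 5 = X ^ (199 / 50 : ℝ) * X ^ (51 / 50 : ℝ) := by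
      rw [← Real.rpow_add hX0, ← Real.rpow_natCast]; norm_num
    have : x ^ 3 * (X / 4) ^ 5 ≤ (C * 3 ^ (51 / 50 : ℝ)) ^ 3 * ‖riemannZeta₁ s‖ ^ 4 *
        (C * 2 ^ (51 / 50 : ℝ) * X ^ (51 / 50 : ℝ)) := by
      calc x ^ 3 * (X / 4) ^ 5 ≤ x ^ 3 * |y| ^ 5 := by gcongr
        _ = x ^ 3 * |y| ^ 4 * |y| := by ring
        _ ≤ _ := key
        _ ≤ _ := by gcongr
    rw [inv_mul_le_iff₀ hK0, ← mul_le_mul_iff_left₀ (by positivity : 0 < X ^ (51 / 50 : ℝ))]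
    calc x ^ 3 * X ^ (199 / 50 : ℝ) * X ^ (51 / 50 : ℝ) = 4 ^ 5 * (x ^ 3 * (X / 4) ^ 5) := by
          rw [div_pow, hXe]; ring
      _ ≤ 4 ^ 5 * _ := mul_le_mul_of_nonneg_left this (by norm_num)
      _ = _ := by rw [hK]; ring
  refine le_of_pow_le_pow_left₀ (n := 4) (by norm_num) (norm_nonneg _) (le_trans (le_of_eq ?_) hB4)
  have hp : ∀ t : ℝ, 0 ≤ t → ∀ q : ℝ, (t ^ q) ^ 4 = t ^ (q * 4) := fun t ht q => by
    rw [← Real.rpow_natCast, ← Real.rpow_mul ht]; norm_num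
  rw [mul_pow, mul_pow, hp _ (by positivity), hp _ hx.le, hp _ (by positivity)]
  norm_num

/-- The previous bound degenerates as Re s tends to 1. At distance σ₀ of order X^{-1/10} from the
line it still gives 199/200 - 3/40 = 23/25. Moving from there towards the line costs σ₀ X^{51/50},
again of order X^{23/25}, and a small constant in σ₀ makes this loss at most half of the main term.
Near the real axis, compactness and nonvanishing suffice. -/
lemma exists_le_norm_riemannZeta₁ : ∃ c : ℝ, 0 < c ∧ ∀ s : ℂ, 1 < s.re → s.re ≤ 2 →
    c * (1 + ‖s‖) ^ (23 / 25 : ℝ) ≤ ‖riemannZeta₁ s‖ := by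
  obtain ⟨C, hC, h⟩ := exists_norm_deriv_riemannZeta₁_le
  obtain ⟨c₂, hc₂, hlow⟩ := exists_le_norm_riemannZeta₁_of_one_le_im
  -- the compact region near the real axis
  obtain ⟨c₁, hc₁, hcomp⟩ : ∃ c : ℝ, 0 < c ∧ ∀ s : ℂ, 1 ≤ s.re → s.re ≤ 2 → |s.im| ≤ 1 →
      c ≤ ‖riemannZeta₁ s‖ := by
    have hK : IsCompact (Set.Icc (1 : ℝ) 2 ×ℂ Set.Icc (-1 : ℝ) 1) :=
      isCompact_Icc.reProdIm isCompact_Icc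
    obtain ⟨z, hz, hmin⟩ := hK.exists_isMinOn
      ⟨1, by simp [Complex.mem_reProdIm]⟩
      (f := fun s => ‖riemannZeta₁ s‖)
      (differentiable_riemannZeta₁.continuous.norm.continuousOn)
    rw [Complex.mem_reProdIm] at hz
    refine ⟨‖riemannZeta₁ z‖, norm_pos_iff.2 (riemannZeta₁_ne_zero hz.1.1), fun s h1 h2 h3 => ?_⟩
    exact hmin (Complex.mem_reProdIm.2 ⟨⟨h1, h2⟩, abs_le.1 h3⟩)
  -- With σ₀ = b⁴ X^{-1/10} the main term carries b³ and the mean value loss carries b⁴, so 8Cb ≤ c₂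
  -- lets the main term win.
  set b : ℝ := min 1 (c₂ / (8 * C)) with hb
  have hb0 : 0 < b := lt_min one_pos (by positivity)
  have hb1 : b ≤ 1 := min_le_left _ _
  have hb2 : 8 * C * b ≤ c₂ := by
    have : b ≤ c₂ / (8 * C) := min_le_right _ _
    rwa [le_div_iff₀ (by positivity), mul_comm] at this
  refine ⟨min (c₁ / 4) (b ^ 3 * c₂ / 2), lt_min (by positivity) (by positivity),
    fun s hs1 hs2 => ?_⟩
  set X : ℝ := 1 + ‖s‖ with hX
  have hX1 : 1 ≤ X := by simp [hX]
  have hX0 : 0 < X := by linarith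
  rcases le_total |s.im| 1 with him | him
  · refine le_trans ?_ (hcomp s hs1.le hs2 him)
    have hX4 : X ≤ 4 := by
      have := norm_le_abs_re_add_abs_im s
      rw [abs_of_pos (by linarith : 0 < s.re)] at this
      linarith
    have : X ^ (23 / 25 : ℝ) ≤ 4 := by
      calc X ^ (23 / 25 : ℝ) ≤ X ^ (1 : ℝ) := Real.rpow_le_rpow_of_exponent_le hX1 (by norm_num)
        _ ≤ 4 := by simpa using hX4
    calc _ ≤ c₁ / 4 * 4 := by gcongr; exact min_le_left _ _
      _ = c₁ := by ring
  have hmain : ∀ z : ℂ, 1 < z.re → z.re ≤ 2 → 1 ≤ |z.im| → ‖s‖ ≤ ‖z‖ →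
      b ^ 4 * X ^ (-(1 / 10) : ℝ) ≤ z.re - 1 →
      b ^ 3 * c₂ * X ^ (23 / 25 : ℝ) ≤ ‖riemannZeta₁ z‖ := by
    intro z h1 h2 h3 h4 h5
    refine le_trans ?_ (hlow z h1 h2 h3)
    have e : b ^ 3 * X ^ (-(3 / 40) : ℝ) = (b ^ 4 * X ^ (-(1 / 10) : ℝ)) ^ (3 / 4 : ℝ) := by
      rw [Real.mul_rpow (by positivity) (by positivity), ← Real.rpow_mul hX0.le,
        ← Real.rpow_natCast b 4, ← Real.rpow_mul hb0.le, ← Real.rpow_natCast b 3]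
      norm_num
    calc b ^ 3 * c₂ * X ^ (23 / 25 : ℝ)
        = c₂ * (b ^ 3 * X ^ (-(3 / 40) : ℝ) * X ^ (199 / 200 : ℝ)) := by
          rw [mul_assoc (b ^ 3) (X ^ _), ← Real.rpow_add hX0]; norm_num; ring
      _ ≤ _ := by
          rw [e]
          gcongr
          rw [hX]; gcongr
  have hfin : min (c₁ / 4) (b ^ 3 * c₂ / 2) * X ^ (23 / 25 : ℝ) ≤
      b ^ 3 * c₂ / 2 * X ^ (23 / 25 : ℝ) := by gcongr; exact min_le_right _ _
  refine hfin.trans ?_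
  set σ₀ : ℝ := b ^ 4 * X ^ (-(1 / 10) : ℝ) with hσ
  have hσ0 : 0 < σ₀ := by positivity
  have hσ1 : σ₀ ≤ 1 := by
    have : X ^ (-(1 / 10) : ℝ) ≤ 1 := Real.rpow_le_one_of_one_le_of_nonpos hX1 (by norm_num)
    calc σ₀ ≤ 1 ^ 4 * 1 := by rw [hσ]; gcongr
      _ = 1 := by norm_num
  rcases le_total σ₀ (s.re - 1) with hle | hle
  · have := hmain s hs1 hs2 him le_rfl hle
    refine le_trans ?_ this
    gcongr
    linarith [show 0 < b ^ 3 * c₂ by positivity]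
  · set z : ℂ := s + ((1 + σ₀ - s.re : ℝ) : ℂ) with hz
    have hzre : z.re = 1 + σ₀ := by simp [hz]
    have hzim : z.im = s.im := by simp [hz]
    have hnz : ‖s‖ ≤ ‖z‖ := by
      rw [← abs_norm s, ← abs_norm z, ← sq_le_sq, Complex.sq_norm, Complex.sq_norm,
        normSq_apply, normSq_apply, hzre, hzim]
      nlinarith
    have hzs : ‖z - s‖ ≤ σ₀ := by
      rw [hz, add_sub_cancel_left, norm_real, Real.norm_of_nonneg (by linarith)]
      linarith
    have h1 := hmain z (by linarith) (by linarith) (by rwa [hzim]) hnz (by linarith)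
    have h2 : ‖riemannZeta₁ s - riemannZeta₁ z‖ ≤ C * 4 * X ^ (51 / 50 : ℝ) * ‖s - z‖ := by
      refine Convex.norm_image_sub_le_of_norm_deriv_le
        (s := {w : ℂ | 1 ≤ w.re} ∩ Metric.closedBall 0 (‖s‖ + 1))
        (fun w _ => differentiable_riemannZeta₁ w) ?_
        ((convex_halfSpace_re_ge 1).inter (convex_closedBall _ _)) ?_ ?_
      · intro w hw
        refine (h w hw.1).2.1.trans ?_
        have hw2 : ‖w‖ ≤ ‖s‖ + 1 := by simpa using hw.2
        rw [mul_assoc]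
        gcongr
        calc (1 + ‖w‖) ^ (51 / 50 : ℝ) ≤ (2 * X) ^ (51 / 50 : ℝ) := by
              gcongr
              linarith [norm_nonneg s]
          _ = 2 ^ (51 / 50 : ℝ) * X ^ (51 / 50 : ℝ) := Real.mul_rpow (by norm_num) hX0.le
          _ ≤ 2 ^ (2 : ℝ) * X ^ (51 / 50 : ℝ) := by gcongr <;> norm_num
          _ = 4 * X ^ (51 / 50 : ℝ) := by norm_num
      · refine ⟨?_, ?_⟩
        · change 1 ≤ z.re; linarith
        · have : ‖z‖ ≤ ‖s‖ + 1 := by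
            calc ‖z‖ = ‖s + (z - s)‖ := by ring_nf
              _ ≤ _ := (norm_add_le _ _).trans (by linarith)
          simpa using this
      · exact ⟨hs1.le, by simp⟩
    have h3 : C * 4 * X ^ (51 / 50 : ℝ) * ‖s - z‖ ≤ b ^ 3 * c₂ / 2 * X ^ (23 / 25 : ℝ) := by
      have e : X ^ (51 / 50 : ℝ) * X ^ (-(1 / 10) : ℝ) = X ^ (23 / 25 : ℝ) := by
        rw [← Real.rpow_add hX0]; norm_num
      calc C * 4 * X ^ (51 / 50 : ℝ) * ‖s - z‖ ≤ C * 4 * X ^ (51 / 50 : ℝ) * σ₀ := by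
            rw [norm_sub_rev]; gcongr
        _ = b ^ 3 * (8 * C * b) / 2 * (X ^ (51 / 50 : ℝ) * X ^ (-(1 / 10) : ℝ)) := by
            rw [hσ]; ring
        _ ≤ _ := by rw [e]; gcongr
    have h4 : ‖riemannZeta₁ z‖ ≤ ‖riemannZeta₁ s‖ + ‖riemannZeta₁ s - riemannZeta₁ z‖ := by
      rw [norm_sub_rev]
      calc ‖riemannZeta₁ z‖ = ‖riemannZeta₁ s + (riemannZeta₁ z - riemannZeta₁ s)‖ := by ring_nf
        _ ≤ _ := norm_add_le _ _
    linarith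

/-- Bounds for `(s - 1) ζ(s)` and its logarithmic derivatives just to the right of
`Re s = 1`. -/
lemma exists_norm_logDeriv_riemannZeta₁_le : ∃ C : ℝ, 0 < C ∧ ∀ s : ℂ, 1 < s.re → s.re ≤ 2 →
    ‖riemannZeta₁ s‖ ≤ C * (1 + ‖s‖) ^ (51 / 50 : ℝ) ∧
    ‖deriv riemannZeta₁ s / riemannZeta₁ s‖ ≤ C * (1 + ‖s‖) ^ (1 / 10 : ℝ) ∧
    ‖deriv (deriv riemannZeta₁) s / riemannZeta₁ s‖ ≤ C * (1 + ‖s‖) ^ (1 / 10 : ℝ) := by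
  obtain ⟨C, hC, h⟩ := exists_norm_deriv_riemannZeta₁_le
  obtain ⟨c, hc, hlow⟩ := exists_le_norm_riemannZeta₁
  refine ⟨C + C / c, by positivity, fun s hs1 hs2 => ?_⟩
  obtain ⟨h0, h1, h2⟩ := h s hs1.le
  have hl := hlow s hs1 hs2
  set X : ℝ := 1 + ‖s‖ with hX
  have hX0 : 0 < X := by positivity
  have e : X ^ (51 / 50 : ℝ) = X ^ (1 / 10 : ℝ) * X ^ (23 / 25 : ℝ) := by
    rw [← Real.rpow_add hX0]; norm_num
  have aux : ∀ D : ℂ, ‖D‖ ≤ C * X ^ (51 / 50 : ℝ) →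
      ‖D / riemannZeta₁ s‖ ≤ (C + C / c) * X ^ (1 / 10 : ℝ) := by
    intro D hD
    rw [norm_div]
    calc ‖D‖ / ‖riemannZeta₁ s‖ ≤ C * X ^ (51 / 50 : ℝ) / (c * X ^ (23 / 25 : ℝ)) := by gcongr
      _ = C / c * X ^ (1 / 10 : ℝ) := by
        rw [e]
        have : X ^ (23 / 25 : ℝ) ≠ 0 := by positivity
        field_simp
      _ ≤ _ := by gcongr; linarith
  exact ⟨h0.trans (by gcongr; linarith [show 0 < C / c by positivity]), aux _ h1, aux _ h2⟩

end

section

open Complex Filter Topology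

/-! ### The Dirichlet series of `rootZeta k` -/

/-- The Dirichlet series of `rootZeta k`. -/
noncomputable def rootZetaSeries (k : ℕ) (s : ℂ) : ℂ := LSeries (fun n => (rootZeta k n : ℂ)) s

lemma lseriesSummable_rootZeta {k : ℕ} (hk : k ≠ 0) {s : ℂ} (hs : 1 < s.re) :
    LSeriesSummable (fun n => (rootZeta k n : ℂ)) s := by
  refine LSeriesSummable_of_bounded_of_one_lt_re (m := 1) (fun n _ => ?_) hs
  rw [norm_real, Real.norm_of_nonneg (rootZeta_nonneg k n)]
  exact rootZeta_le_one hk n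

lemma lseries_rootZeta_pow {k : ℕ} (hk : k ≠ 0) {s : ℂ} (hs : 1 < s.re) (j : ℕ) :
    LSeriesSummable (fun n => ((rootZeta k ^ j) n : ℂ)) s ∧
    LSeries (fun n => ((rootZeta k ^ j) n : ℂ)) s = rootZetaSeries k s ^ j := by
  induction j with
  | zero =>
    have e : (fun n => (((rootZeta k ^ 0) n : ℝ) : ℂ)) = LSeries.delta := by
      ext n
      simp only [pow_zero, ArithmeticFunction.one_apply, LSeries.delta]
      split_ifs <;> simp
    rw [e, pow_zero, LSeries_delta]
    exact ⟨LSeriesSummable_of_bounded_of_one_lt_re (m := 1)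
      (fun n _ => by simp only [LSeries.delta]; split_ifs <;> simp) hs, rfl⟩
  | succ j ih =>
    have e : (fun n => (((rootZeta k ^ (j + 1)) n : ℝ) : ℂ)) =
        LSeries.convolution (fun n => ((rootZeta k ^ j) n : ℂ)) (fun n => (rootZeta k n : ℂ)) := by
      ext n
      rw [LSeries.convolution_def, pow_succ, ArithmeticFunction.mul_apply]
      push_cast
      rfl
    rw [e]
    exact ⟨ih.1.convolution (lseriesSummable_rootZeta hk hs), by
      rw [LSeries_convolution' ih.1 (lseriesSummable_rootZeta hk hs), ih.2, pow_succ]; rfl⟩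

lemma rootZetaSeries_pow {k : ℕ} (hk : k ≠ 0) {s : ℂ} (hs : 1 < s.re) :
    rootZetaSeries k s ^ k = riemannZeta s := by
  rw [← (lseries_rootZeta_pow hk hs k).2, ← LSeries_one_eq_riemannZeta hs, rootZeta_pow_self hk]
  refine LSeries_congr (fun {n} hn => ?_) s
  simp [hn]

lemma differentiableAt_rootZetaSeries {k : ℕ} (hk : k ≠ 0) {s : ℂ} (hs : 1 < s.re) :
    DifferentiableAt ℂ (rootZetaSeries k) s := by
  refine (LSeries_hasDerivAt ?_).differentiableAt
  have : LSeries.abscissaOfAbsConv (fun n => (rootZeta k n : ℂ)) ≤ 1 :=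
    LSeries.abscissaOfAbsConv_le_of_forall_lt_LSeriesSummable' fun y hy =>
      lseriesSummable_rootZeta hk (by simpa using EReal.coe_lt_coe_iff.1 hy)
  exact this.trans_lt (by exact_mod_cast hs)

/-- Nonnegative coefficients make the series nonnegative on the real axis. This is what identifies
the branch of the k-th root. -/
lemma rootZetaSeries_ofReal_nonneg {k : ℕ} {x : ℝ} :
    ∃ y : ℝ, 0 ≤ y ∧ rootZetaSeries k x = y := by
  refine ⟨∑' n : ℕ, if n = 0 then 0 else rootZeta k n / (n : ℝ) ^ x,
    tsum_nonneg fun n => ?_, ?_⟩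
  · split_ifs
    · exact le_rfl
    · exact div_nonneg (rootZeta_nonneg k n) (by positivity)
  · rw [rootZetaSeries, LSeries, Complex.ofReal_tsum]
    refine tsum_congr fun n => ?_
    rw [LSeries.term_def]
    split_ifs
    · simp
    · rw [ofReal_div, ofReal_cpow (by positivity)]; simp

/-- `((s - 1) ζ(s)) ^ (1 / k)`. -/
noncomputable def regRootZeta (k : ℕ) (s : ℂ) : ℂ :=
  rootZetaSeries k s * (s - 1) ^ ((1 / (k : ℝ) : ℝ) : ℂ)

lemma ne_one_of_one_lt_re {s : ℂ} (hs : 1 < s.re) : s ≠ 1 := by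
  rintro rfl; simp at hs

lemma sub_one_mem_slitPlane {s : ℂ} (hs : 1 < s.re) : s - 1 ∈ slitPlane :=
  Or.inl (by simpa using hs)

lemma regRootZeta_pow {k : ℕ} (hk : k ≠ 0) {s : ℂ} (hs : 1 < s.re) :
    regRootZeta k s ^ k = riemannZeta₁ s := by
  rw [regRootZeta, mul_pow, rootZetaSeries_pow hk hs, riemannZeta₁_eq (ne_one_of_one_lt_re hs)]
  have : ((1 / (k : ℝ) : ℝ) : ℂ) = (k : ℂ)⁻¹ := by push_cast; simp
  rw [this, Complex.cpow_nat_inv_pow _ hk, mul_comm]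

lemma norm_regRootZeta {k : ℕ} (hk : k ≠ 0) {s : ℂ} (hs : 1 < s.re) :
    ‖regRootZeta k s‖ = ‖riemannZeta₁ s‖ ^ (1 / (k : ℝ)) := by
  rw [← regRootZeta_pow hk hs, norm_pow, one_div, Real.pow_rpow_inv_natCast (norm_nonneg _) hk]

lemma differentiableAt_regRootZeta {k : ℕ} (hk : k ≠ 0) {s : ℂ} (hs : 1 < s.re) :
    DifferentiableAt ℂ (regRootZeta k) s :=
  (differentiableAt_rootZetaSeries hk hs).mul
    ((differentiableAt_id.sub_const 1).cpow_const (sub_one_mem_slitPlane hs))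

/-- The derivative of `regRootZeta k`. -/
noncomputable def regRootZeta' (k : ℕ) (s : ℂ) : ℂ :=
  1 / (k : ℂ) * regRootZeta k s * (deriv riemannZeta₁ s / riemannZeta₁ s)

/-- The second derivative of `regRootZeta k`. -/
noncomputable def regRootZeta'' (k : ℕ) (s : ℂ) : ℂ :=
  1 / (k : ℂ) * regRootZeta k s * (deriv (deriv riemannZeta₁) s / riemannZeta₁ s +
    (1 / (k : ℂ) - 1) * (deriv riemannZeta₁ s / riemannZeta₁ s) ^ 2)

lemma isOpen_one_lt_re : IsOpen {s : ℂ | 1 < s.re} :=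
  isOpen_lt continuous_const Complex.continuous_re

/-- Differentiating the identity A^k = (s-1)ζ(s) gives the logarithmic derivative of A as 1/k times
that of (s-1)ζ(s), with no choice of branch. -/
lemma hasDerivAt_regRootZeta {k : ℕ} (hk : k ≠ 0) {s : ℂ} (hs : 1 < s.re) :
    HasDerivAt (regRootZeta k) (regRootZeta' k s) s := by
  have hA := (differentiableAt_regRootZeta hk hs).hasDerivAt
  have hB := (differentiable_riemannZeta₁ s).hasDerivAt
  have h1 := hA.pow k
  have h2 : HasDerivAt (regRootZeta k ^ k) (deriv riemannZeta₁ s) s := by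
    refine hB.congr_of_eventuallyEq ?_
    filter_upwards [isOpen_one_lt_re.mem_nhds hs] with z hz
    exact regRootZeta_pow hk hz
  have e := h1.unique h2
  have hB0 : riemannZeta₁ s ≠ 0 := riemannZeta₁_ne_zero hs.le
  have hA0 : regRootZeta k s ≠ 0 := by
    intro h
    apply hB0
    rw [← regRootZeta_pow hk hs, h, zero_pow hk]
  have hk0 : (k : ℂ) ≠ 0 := by exact_mod_cast hk
  refine hA.congr_deriv ?_
  rw [regRootZeta', ← e, ← regRootZeta_pow hk hs]
  obtain ⟨m, rfl⟩ := Nat.exists_eq_succ_of_ne_zero hk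
  simp only [Nat.succ_eq_add_one, Nat.add_sub_cancel]
  field_simp
  ring

lemma hasDerivAt_regRootZeta' {k : ℕ} (hk : k ≠ 0) {s : ℂ} (hs : 1 < s.re) :
    HasDerivAt (regRootZeta' k) (regRootZeta'' k s) s := by
  have hB0 : riemannZeta₁ s ≠ 0 := riemannZeta₁_ne_zero hs.le
  have h := ((hasDerivAt_regRootZeta hk hs).const_mul (1 / (k : ℂ))).mul
    ((differentiable_deriv_riemannZeta₁ s).hasDerivAt.div
      (differentiable_riemannZeta₁ s).hasDerivAt hB0)
  refine h.congr_deriv ?_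
  rw [regRootZeta'', regRootZeta']
  have hk0 : (k : ℂ) ≠ 0 := by exact_mod_cast hk
  simp only [Pi.div_apply]
  field_simp
  ring

/-- The term 51/50 · (1/k) is the growth of the k-th root itself; 1/5 pays for the square of a
logarithmic derivative of growth 1/10. -/
lemma exists_norm_regRootZeta_le {k : ℕ} (hk : k ≠ 0) : ∃ C : ℝ, 0 < C ∧
    ∀ s : ℂ, 1 < s.re → s.re ≤ 2 →
    ‖regRootZeta k s‖ ≤ C * (1 + ‖s‖) ^ (51 / 50 * (1 / (k : ℝ)) + 1 / 5) ∧
    ‖regRootZeta' k s‖ ≤ C * (1 + ‖s‖) ^ (51 / 50 * (1 / (k : ℝ)) + 1 / 5) ∧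
    ‖regRootZeta'' k s‖ ≤ C * (1 + ‖s‖) ^ (51 / 50 * (1 / (k : ℝ)) + 1 / 5) := by
  obtain ⟨C, hC, h⟩ := exists_norm_logDeriv_riemannZeta₁_le
  set D : ℝ := 1 + C with hD
  have hk1 : (1 : ℝ) ≤ k := by exact_mod_cast Nat.one_le_iff_ne_zero.2 hk
  have hκ1 : 1 / (k : ℝ) ≤ 1 := by rw [div_le_one (by linarith)]; exact hk1
  have hκ0 : 0 ≤ 1 / (k : ℝ) := by positivity
  refine ⟨D * (2 * D ^ 2), by positivity, fun s hs1 hs2 => ?_⟩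
  obtain ⟨h0, h1, h2⟩ := h s hs1 hs2
  set X : ℝ := 1 + ‖s‖ with hX
  have hX1 : 1 ≤ X := by simp [hX]
  have hX0 : 0 < X := by linarith
  have hD1 : 1 ≤ D := by linarith
  have hD2 : 1 ≤ D ^ 2 := one_le_pow₀ hD1
  have hA : ‖regRootZeta k s‖ ≤ D * X ^ (51 / 50 * (1 / (k : ℝ))) := by
    rw [norm_regRootZeta hk hs1]
    calc ‖riemannZeta₁ s‖ ^ (1 / (k : ℝ)) ≤ (D * X ^ (51 / 50 : ℝ)) ^ (1 / (k : ℝ)) := by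
          gcongr
          exact h0.trans (by gcongr; linarith)
      _ = D ^ (1 / (k : ℝ)) * X ^ (51 / 50 * (1 / (k : ℝ))) := by
          rw [Real.mul_rpow (by positivity) (by positivity), Real.rpow_mul hX0.le]
      _ ≤ D ^ (1 : ℝ) * X ^ (51 / 50 * (1 / (k : ℝ))) := by gcongr
      _ = _ := by rw [Real.rpow_one]
  have hY : 1 ≤ X ^ (1 / 10 : ℝ) := Real.one_le_rpow hX1 (by norm_num)
  have hY2 : X ^ (1 / 5 : ℝ) = (X ^ (1 / 10 : ℝ)) ^ 2 := by
    rw [← Real.rpow_natCast, ← Real.rpow_mul hX0.le]; norm_num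
  set Y : ℝ := X ^ (1 / 10 : ℝ)
  have hYY : Y ≤ Y ^ 2 := by nlinarith
  have hkn : ‖1 / (k : ℂ)‖ ≤ 1 := by
    rw [norm_div, norm_one, norm_natCast]; exact hκ1
  have hkn1 : ‖1 / (k : ℂ) - 1‖ ≤ 1 := by
    have : 1 / (k : ℂ) - 1 = ((1 / (k : ℝ) - 1 : ℝ) : ℂ) := by push_cast; rfl
    rw [this, norm_real, Real.norm_eq_abs, abs_le]
    constructor <;> linarith
  have hb1 : ‖deriv riemannZeta₁ s / riemannZeta₁ s‖ ≤ D * Y := h1.trans (by gcongr; linarith)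
  have hb2 : ‖deriv (deriv riemannZeta₁) s / riemannZeta₁ s‖ ≤ D * Y :=
    h2.trans (by gcongr; linarith)
  rw [Real.rpow_add hX0, hY2]
  have hexp : ∀ t : ℝ, t ≤ 2 * D ^ 2 * Y ^ 2 →
      D * X ^ (51 / 50 * (1 / (k : ℝ))) * t ≤
        D * (2 * D ^ 2) * (X ^ (51 / 50 * (1 / (k : ℝ))) * Y ^ 2) := fun t ht => by
    calc _ ≤ D * X ^ (51 / 50 * (1 / (k : ℝ))) * (2 * D ^ 2 * Y ^ 2) := by gcongr
      _ = _ := by ring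
  refine ⟨?_, ?_, ?_⟩
  · refine le_trans ?_ (hexp 1 ?_)
    · rw [mul_one]; exact hA
    · nlinarith
  · refine le_trans ?_ (hexp (D * Y) ?_)
    · rw [regRootZeta', norm_mul, norm_mul]
      calc _ ≤ 1 * (D * X ^ (51 / 50 * (1 / (k : ℝ)))) * (D * Y) := by gcongr
        _ = _ := by ring
    · calc D * Y ≤ D ^ 2 * Y ^ 2 := by gcongr; nlinarith
        _ ≤ _ := by nlinarith [sq_nonneg (D * Y)]
  · refine le_trans ?_ (hexp (D * Y + (D * Y) ^ 2) ?_)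
    · rw [regRootZeta'', norm_mul, norm_mul]
      calc _ ≤ 1 * (D * X ^ (51 / 50 * (1 / (k : ℝ)))) * (D * Y + 1 * (D * Y) ^ 2) := by
            gcongr
            refine (norm_add_le _ _).trans ?_
            rw [norm_mul, norm_pow]
            gcongr
        _ = _ := by ring
    · have : D * Y ≤ D ^ 2 * Y ^ 2 := by gcongr; nlinarith
      nlinarith

/-- The k-th power tends to 1, which leaves the limit open up to a root of unity. For real x > 1 the
function is nonnegative, hence equal to its norm, and the limit is 1. -/
lemma tendsto_regRootZeta {k : ℕ} (hk : k ≠ 0) :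
    Tendsto (fun x : ℝ => regRootZeta k x) (𝓝[>] 1) (𝓝 1) := by
  have h1 : Tendsto (fun x : ℝ => ((‖riemannZeta₁ x‖ ^ (1 / (k : ℝ)) : ℝ) : ℂ)) (𝓝[>] 1) (𝓝 1) := by
    have hc : ContinuousAt (fun x : ℝ => ((‖riemannZeta₁ x‖ ^ (1 / (k : ℝ)) : ℝ) : ℂ)) 1 := by
      refine Complex.continuous_ofReal.continuousAt.comp ?_
      refine ContinuousAt.rpow_const ?_ (Or.inl (by simp))
      exact (differentiable_riemannZeta₁.continuous.comp Complex.continuous_ofReal).norm.continuousAt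
    have := hc.tendsto
    simp only [ofReal_one, riemannZeta₁_one, norm_one, Real.one_rpow] at this
    exact this.mono_left nhdsWithin_le_nhds
  refine h1.congr' ?_
  filter_upwards [self_mem_nhdsWithin] with x hx
  have hx' : 1 < (x : ℂ).re := by simpa using hx
  rw [← norm_regRootZeta hk hx']
  obtain ⟨y, hy, hyx⟩ := rootZetaSeries_ofReal_nonneg (k := k) (x := x)
  have hx1 : 0 ≤ x - 1 := by linarith [Set.mem_Ioi.1 hx]
  have : regRootZeta k x = ((y * (x - 1) ^ (1 / (k : ℝ)) : ℝ) : ℂ) := by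
    rw [regRootZeta, hyx, ofReal_mul, ofReal_cpow hx1]; push_cast; rfl
  rw [this, norm_real, Real.norm_of_nonneg (by positivity)]

/-- The point 1 lies on the boundary of the half-plane where the derivative is controlled, so the
mean value inequality is applied from real x > 1 and x tends to 1. -/
lemma exists_norm_regRootZeta_sub_one_le {k : ℕ} (hk : k ≠ 0) : ∃ C : ℝ, 0 < C ∧
    ∀ s : ℂ, 1 < s.re → s.re ≤ 2 → ‖s - 1‖ ≤ 1 → ‖regRootZeta k s - 1‖ ≤ C * ‖s - 1‖ := by
  obtain ⟨C, hC, h⟩ := exists_norm_regRootZeta_le hk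
  set p : ℝ := 51 / 50 * (1 / (k : ℝ)) + 1 / 5 with hp
  have hp0 : 0 ≤ p := by positivity
  refine ⟨C * 3 ^ p, by positivity, fun s hs1 hs2 hs => ?_⟩
  have hmv : ∀ x : ℝ, x ∈ Set.Ioc (1 : ℝ) 2 → ‖regRootZeta k s - regRootZeta k x‖ ≤
      C * 3 ^ p * ‖s - x‖ := by
    intro x hx
    refine Convex.norm_image_sub_le_of_norm_hasDerivWithin_le (𝕜 := ℂ) (f' := regRootZeta' k)
      (s := ({w : ℂ | 1 < w.re} ∩ {w : ℂ | w.re ≤ 2}) ∩ Metric.closedBall 1 1)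
      (fun w hw => (hasDerivAt_regRootZeta hk hw.1.1).hasDerivWithinAt) ?_
      (((convex_halfSpace_re_gt 1).inter (convex_halfSpace_re_le 2)).inter
        (convex_closedBall _ _)) ?_ ?_
    · intro w hw
      refine (h w hw.1.1 hw.1.2).2.1.trans ?_
      gcongr
      have h2 : ‖w - 1‖ ≤ 1 := by simpa [dist_eq] using hw.2
      have : ‖w‖ ≤ ‖w - 1‖ + 1 := by
        calc ‖w‖ = ‖(w - 1) + 1‖ := by ring_nf
          _ ≤ _ := (norm_add_le _ _).trans (by simp)
      linarith
    · refine ⟨⟨by simpa using hx.1, by simpa using hx.2⟩, ?_⟩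
      rw [Metric.mem_closedBall, dist_eq, ← ofReal_one, ← ofReal_sub, norm_real,
        Real.norm_of_nonneg (by linarith [hx.1])]
      linarith [hx.2]
    · exact ⟨⟨hs1, hs2⟩, by simpa [dist_eq] using hs⟩
  have t1 : Tendsto (fun x : ℝ => ‖regRootZeta k s - regRootZeta k x‖) (𝓝[>] 1)
      (𝓝 ‖regRootZeta k s - 1‖) := ((tendsto_regRootZeta hk).const_sub _).norm
  have t2 : Tendsto (fun x : ℝ => C * 3 ^ p * ‖s - x‖) (𝓝[>] 1) (𝓝 (C * 3 ^ p * ‖s - 1‖)) := by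
    have : Continuous fun x : ℝ => C * 3 ^ p * ‖s - x‖ := by fun_prop
    have := this.tendsto 1
    rw [ofReal_one] at this
    exact this.mono_left nhdsWithin_le_nhds
  refine le_of_tendsto_of_tendsto t1 t2 ?_
  filter_upwards [Ioc_mem_nhdsGT (show (1 : ℝ) < 2 by norm_num)] with x hx using hmv x hx

end

/-! ### The comparison of ζ(s)^{1/k} with (s - 1)^{-1/k} -/

section

open Complex Filter Topology

/-- `(G(s) - (s - 1) ^ (-1/k)) / s` for the Dirichlet series `G` of `rootZeta k`. -/
noncomputable def rootZetaError (k : ℕ) (s : ℂ) : ℂ :=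
  (rootZetaSeries k s - (s - 1) ^ ((-(1 / (k : ℝ)) : ℝ) : ℂ)) * s⁻¹

lemma hasDerivAt_sub_one_cpow (c : ℂ) {s : ℂ} (hs : 1 < s.re) :
    HasDerivAt (fun s : ℂ => (s - 1) ^ c) (c * (s - 1) ^ (c - 1)) s := by
  simpa using ((hasDerivAt_id s).sub_const 1).cpow_const (c := c) (sub_one_mem_slitPlane hs)

/-- The second derivative of `rootZetaError k` and its size near `Re s = 1`. -/
lemma exists_hasDerivAt_rootZetaError {k : ℕ} (hk : 2 ≤ k) :
    ∃ R₁ R₂ : ℂ → ℂ, (∀ s : ℂ, 1 < s.re → HasDerivAt (rootZetaError k) (R₁ s) s) ∧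
      (∀ s : ℂ, 1 < s.re → HasDerivAt R₁ (R₂ s) s) ∧
      ∃ C : ℝ, 0 < C ∧ ∀ s : ℂ, 1 < s.re → s.re ≤ 2 →
        ‖R₂ s‖ ≤ C * (‖s - 1‖ ^ (-(1 + 1 / (k : ℝ))) + ‖s - 1‖ ^ (-(1 / 2) : ℝ)) := by
  have hk0 : k ≠ 0 := by lia
  set κ : ℝ := 1 / (k : ℝ) with hκ
  have hκ0 : 0 < κ := by positivity
  have hκ1 : κ ≤ 1 / 2 := by
    rw [hκ]; gcongr; exact_mod_cast hk
  set P : ℂ → ℂ := fun s => (s - 1) ^ ((-κ : ℝ) : ℂ) with hP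
  set P₁ : ℂ → ℂ := fun s => ((-κ : ℝ) : ℂ) * (s - 1) ^ ((-κ - 1 : ℝ) : ℂ) with hP₁
  set P₂ : ℂ → ℂ := fun s => ((-κ : ℝ) : ℂ) * (((-κ - 1 : ℝ) : ℂ) * (s - 1) ^ ((-κ - 2 : ℝ) : ℂ))
    with hP₂
  set V : ℂ → ℂ := fun s => (regRootZeta k s - 1) * s⁻¹ with hV
  set V₁ : ℂ → ℂ := fun s => regRootZeta' k s * s⁻¹ - (regRootZeta k s - 1) * s⁻¹ ^ 2 with hV₁
  set V₂ : ℂ → ℂ := fun s => regRootZeta'' k s * s⁻¹ - 2 * regRootZeta' k s * s⁻¹ ^ 2 +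
    2 * (regRootZeta k s - 1) * s⁻¹ ^ 3 with hV₂
  have hs0 : ∀ s : ℂ, 1 < s.re → s ≠ 0 := by
    rintro s hs rfl; simp at hs; linarith
  have dP : ∀ s : ℂ, 1 < s.re → HasDerivAt P (P₁ s) s := fun s hs => by
    have := hasDerivAt_sub_one_cpow ((-κ : ℝ) : ℂ) hs
    refine this.congr_deriv ?_
    simp only [hP₁]
    push_cast; rfl
  have dP₁ : ∀ s : ℂ, 1 < s.re → HasDerivAt P₁ (P₂ s) s := fun s hs => by
    have := (hasDerivAt_sub_one_cpow ((-κ - 1 : ℝ) : ℂ) hs).const_mul ((-κ : ℝ) : ℂ)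
    refine this.congr_deriv ?_
    simp only [hP₂]
    congr 4
    push_cast; ring
  have dI : ∀ s : ℂ, 1 < s.re → HasDerivAt (fun s : ℂ => s⁻¹) (-(s⁻¹ ^ 2)) s := fun s hs => by
    refine (hasDerivAt_inv (hs0 s hs)).congr_deriv ?_
    rw [inv_pow]
  have dV : ∀ s : ℂ, 1 < s.re → HasDerivAt V (V₁ s) s := fun s hs => by
    refine (((hasDerivAt_regRootZeta hk0 hs).sub_const 1).mul (dI s hs)).congr_deriv ?_
    simp only [hV₁]; ring
  have dV₁ : ∀ s : ℂ, 1 < s.re → HasDerivAt V₁ (V₂ s) s := fun s hs => by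
    refine (((hasDerivAt_regRootZeta' hk0 hs).mul (dI s hs)).sub
      (((hasDerivAt_regRootZeta hk0 hs).sub_const 1).mul ((dI s hs).pow 2))).congr_deriv ?_
    simp only [hV₂, Pi.pow_apply]; push_cast; ring
  -- The singular factor (s-1)^{-κ} is split off. What remains, V = (A(s) - 1)/s with A =
  -- `regRootZeta k`, vanishes to first order at 1.
  have hR : ∀ s : ℂ, 1 < s.re → rootZetaError k s = P s * V s := fun s hs => by
    have hne : s - 1 ≠ 0 := sub_ne_zero.2 (ne_one_of_one_lt_re hs)
    have : (s - 1) ^ ((κ : ℝ) : ℂ) * (s - 1) ^ ((-κ : ℝ) : ℂ) = 1 := by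
      rw [← cpow_add _ _ hne, ← ofReal_add]; simp
    simp only [hP, hV, rootZetaError, regRootZeta]
    rw [← hκ]
    linear_combination (-(rootZetaSeries k s * s⁻¹)) * this
  refine ⟨fun s => P₁ s * V s + P s * V₁ s,
    fun s => (P₂ s * V s + P₁ s * V₁ s) + (P₁ s * V₁ s + P s * V₂ s), fun s hs => ?_,
    fun s hs => ((dP₁ s hs).mul (dV s hs)).add ((dP s hs).mul (dV₁ s hs)), ?_⟩
  · refine ((dP s hs).mul (dV s hs)).congr_of_eventuallyEq ?_
    filter_upwards [isOpen_one_lt_re.mem_nhds hs] with z hz using hR z hz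
  obtain ⟨C₁, hC₁, hA⟩ := exists_norm_regRootZeta_le hk0
  obtain ⟨C₂, hC₂, hA1⟩ := exists_norm_regRootZeta_sub_one_le hk0
  rw [← hκ] at hA
  set p : ℝ := 51 / 50 * κ + 1 / 5 with hp
  have hp0 : 0 ≤ p := by positivity
  set C : ℝ := (1 + C₁ + C₂) * 3 ^ p with hC
  have h3p : (1 : ℝ) ≤ 3 ^ p := Real.one_le_rpow (by norm_num) hp0
  have hCp : 0 < C := by positivity
  have hCC₂ : C₂ ≤ C := by
    rw [hC]; nlinarith
  have hCC₁ : (1 + C₁) * 3 ^ p ≤ C := by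
    rw [hC]; exact mul_le_mul_of_nonneg_right (by linarith) (by positivity)
  refine ⟨22 * C, by positivity, fun s hs1 hs2 => ?_⟩
  set X : ℝ := ‖s - 1‖ with hX
  have hX0 : 0 < X := norm_pos_iff.2 (sub_ne_zero.2 (ne_one_of_one_lt_re hs1))
  have hns1 : 1 ≤ ‖s‖ := hs1.le.trans ((le_abs_self _).trans (abs_re_le_norm s))
  have hsX : ‖s‖ ≤ X + 1 := by
    calc ‖s‖ = ‖(s - 1) + 1‖ := by ring_nf
      _ ≤ _ := (norm_add_le _ _).trans (by simp [hX])
  have hXs : X ≤ 2 * ‖s‖ := (norm_sub_le _ _).trans (by simp; linarith)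
  have nP : ‖P s‖ = X ^ (-κ) := norm_cpow_real _ _
  have nP₁ : ‖P₁ s‖ ≤ X ^ (-κ - 1) := by
    simp only [hP₁]
    rw [norm_mul, norm_cpow_real, norm_real, Real.norm_eq_abs, abs_neg, abs_of_pos hκ0]
    refine mul_le_of_le_one_left (by positivity) (by linarith)
  have nP₂ : ‖P₂ s‖ ≤ 2 * X ^ (-κ - 2) := by
    simp only [hP₂]
    rw [norm_mul, norm_mul, norm_cpow_real, norm_real, norm_real, Real.norm_eq_abs, abs_neg,
      abs_of_pos hκ0, Real.norm_eq_abs, abs_of_neg (by linarith), ← mul_assoc]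
    gcongr
    nlinarith
  have hI : ‖s⁻¹‖ ≤ 1 := by rw [norm_inv]; exact inv_le_one_of_one_le₀ hns1
  -- bounds of `V` and its derivatives from bounds of `regRootZeta k` and its derivatives
  have nV : ∀ M : ℝ, 0 ≤ M → ‖regRootZeta k s - 1‖ ≤ M → ‖V s‖ ≤ M * ‖s⁻¹‖ := fun M hM h => by
    simp only [hV, norm_mul]; gcongr
  have nV₁ : ∀ M : ℝ, 0 ≤ M → ‖regRootZeta k s - 1‖ ≤ M → ‖regRootZeta' k s‖ ≤ M →
      ‖V₁ s‖ ≤ 2 * M * ‖s⁻¹‖ := fun M hM h h' => by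
    simp only [hV₁]
    refine (norm_sub_le _ _).trans ?_
    simp only [norm_mul, norm_pow]
    calc _ ≤ M * ‖s⁻¹‖ + M * (‖s⁻¹‖ * 1) := by
          rw [pow_two]; gcongr
      _ = _ := by ring
  have nV₂ : ∀ M : ℝ, 0 ≤ M → ‖regRootZeta k s - 1‖ ≤ M → ‖regRootZeta' k s‖ ≤ M →
      ‖regRootZeta'' k s‖ ≤ M → ‖V₂ s‖ ≤ 5 * M * ‖s⁻¹‖ := fun M hM h h' h'' => by
    simp only [hV₂]
    refine (norm_add_le _ _).trans ((add_le_add_left (norm_sub_le _ _) _).trans ?_)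
    simp only [norm_mul, norm_pow, Complex.norm_ofNat]
    calc _ ≤ M * ‖s⁻¹‖ + 2 * M * (‖s⁻¹‖ * 1) + 2 * M * (‖s⁻¹‖ * 1 * 1) := by
          rw [pow_two, pow_succ, pow_two]; gcongr
      _ = _ := by ring
  have tri : ‖(P₂ s * V s + P₁ s * V₁ s) + (P₁ s * V₁ s + P s * V₂ s)‖ ≤
      ‖P₂ s‖ * ‖V s‖ + 2 * (‖P₁ s‖ * ‖V₁ s‖) + ‖P s‖ * ‖V₂ s‖ := by
    refine (norm_add_le _ _).trans ((add_le_add (norm_add_le _ _) (norm_add_le _ _)).trans ?_)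
    simp only [norm_mul]
    linarith
  refine tri.trans ?_
  rw [nP]
  obtain ⟨a0, a1, a2⟩ := hA s hs1 hs2
  -- Near 1, the bound V = O(|s-1|) cancels one power of the singularity of P'', leaving
  -- |s-1|^{-1-κ}. Far from 1, all terms have size at most X^{-κ} X^p X^{-1}, and -κ + p - 1 = κ/50
  -- - 4/5 ≤ -1/2.
  rcases le_total X 1 with hX1 | hX1
  · have hXp : (1 + ‖s‖) ^ p ≤ 3 ^ p := by gcongr; linarith
    have b1 : ‖regRootZeta' k s‖ ≤ C := a1.trans (le_trans (by gcongr; linarith) hCC₁)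
    have b2 : ‖regRootZeta'' k s‖ ≤ C := a2.trans (le_trans (by gcongr; linarith) hCC₁)
    have b0 : ‖regRootZeta k s - 1‖ ≤ C * X := (hA1 s hs1 hs2 hX1).trans (by gcongr)
    have b0' : ‖regRootZeta k s - 1‖ ≤ C := b0.trans (mul_le_of_le_one_right hCp.le hX1)
    have c0 : ‖V s‖ ≤ C * X :=
      (nV _ (by positivity) b0).trans (mul_le_of_le_one_right (by positivity) hI)
    have c1 : ‖V₁ s‖ ≤ 2 * C :=
      (nV₁ _ hCp.le b0' b1).trans (mul_le_of_le_one_right (by positivity) hI)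
    have c2 : ‖V₂ s‖ ≤ 5 * C :=
      (nV₂ _ hCp.le b0' b1 b2).trans (mul_le_of_le_one_right (by positivity) hI)
    have e1 : X ^ (-κ - 2) * X = X ^ (-(1 + κ)) := by
      nth_rewrite 2 [← Real.rpow_one X]
      rw [← Real.rpow_add hX0]; congr 1; ring
    have e2 : X ^ (-κ - 1) = X ^ (-(1 + κ)) := by congr 1; ring
    have e3 : X ^ (-κ) ≤ X ^ (-(1 + κ)) :=
      Real.rpow_le_rpow_of_exponent_ge hX0 hX1 (by linarith)
    calc ‖P₂ s‖ * ‖V s‖ + 2 * (‖P₁ s‖ * ‖V₁ s‖) + X ^ (-κ) * ‖V₂ s‖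
        ≤ 2 * X ^ (-κ - 2) * (C * X) + 2 * (X ^ (-κ - 1) * (2 * C)) +
          X ^ (-(1 + κ)) * (5 * C) := by gcongr
      _ = 2 * C * (X ^ (-κ - 2) * X) + 4 * C * X ^ (-κ - 1) + 5 * C * X ^ (-(1 + κ)) := by ring
      _ = 11 * C * X ^ (-(1 + κ)) := by rw [e1, e2]; ring
      _ ≤ 22 * C * X ^ (-(1 + κ)) := by gcongr; norm_num
      _ ≤ _ := by gcongr; exact le_add_of_nonneg_right (by positivity)
  · have hYp : (1 + ‖s‖) ^ p ≤ 3 ^ p * X ^ p := by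
      rw [← Real.mul_rpow (by norm_num) hX0.le]; gcongr; linarith
    have hXp1 : 1 ≤ X ^ p := Real.one_le_rpow hX1 hp0
    have hup : C₁ * (1 + ‖s‖) ^ p ≤ C * X ^ p := by
      calc C₁ * (1 + ‖s‖) ^ p ≤ (1 + C₁) * (3 ^ p * X ^ p) := by gcongr; linarith
        _ = (1 + C₁) * 3 ^ p * X ^ p := by ring
        _ ≤ _ := by gcongr
    have b1 := a1.trans hup
    have b2 := a2.trans hup
    have b0 : ‖regRootZeta k s - 1‖ ≤ C * X ^ p := by
      refine (norm_sub_le _ _).trans ?_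
      rw [norm_one]
      calc ‖regRootZeta k s‖ + 1 ≤ C₁ * (3 ^ p * X ^ p) + 1 * (1 * 1) := by
            rw [one_mul, one_mul]
            exact add_le_add_left (a0.trans (by gcongr)) 1
        _ ≤ C₁ * (3 ^ p * X ^ p) + 1 * (3 ^ p * X ^ p) := by gcongr
        _ = (1 + C₁) * 3 ^ p * X ^ p := by ring
        _ ≤ _ := by gcongr
    have hI2 : ‖s⁻¹‖ ≤ 2 * X ^ (-1 : ℝ) := by
      rw [norm_inv, Real.rpow_neg_one, inv_le_comm₀ (by linarith) (by positivity), mul_inv,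
        inv_inv]
      linarith
    have hM : 0 ≤ C * X ^ p := by positivity
    have c0 : ‖V s‖ ≤ C * X ^ p * (2 * X ^ (-1 : ℝ)) := (nV _ hM b0).trans (by gcongr)
    have c1 : ‖V₁ s‖ ≤ 2 * (C * X ^ p) * (2 * X ^ (-1 : ℝ)) :=
      (nV₁ _ hM b0 b1).trans (by gcongr)
    have c2 : ‖V₂ s‖ ≤ 5 * (C * X ^ p) * (2 * X ^ (-1 : ℝ)) :=
      (nV₂ _ hM b0 b1 b2).trans (by gcongr)
    have e1 : X ^ (-κ - 2) ≤ X ^ (-κ) := Real.rpow_le_rpow_of_exponent_le hX1 (by linarith)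
    have e2 : X ^ (-κ - 1) ≤ X ^ (-κ) := Real.rpow_le_rpow_of_exponent_le hX1 (by linarith)
    have e3 : X ^ (-κ) * (X ^ p * X ^ (-1 : ℝ)) ≤ X ^ (-(1 / 2) : ℝ) := by
      rw [← Real.rpow_add hX0, ← Real.rpow_add hX0]
      refine Real.rpow_le_rpow_of_exponent_le hX1 ?_
      rw [hp]; linarith
    calc ‖P₂ s‖ * ‖V s‖ + 2 * (‖P₁ s‖ * ‖V₁ s‖) + X ^ (-κ) * ‖V₂ s‖
        ≤ 2 * X ^ (-κ) * (C * X ^ p * (2 * X ^ (-1 : ℝ))) +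
          2 * (X ^ (-κ) * (2 * (C * X ^ p) * (2 * X ^ (-1 : ℝ)))) +
          X ^ (-κ) * (5 * (C * X ^ p) * (2 * X ^ (-1 : ℝ))) := by
          gcongr
          · exact nP₂.trans (by gcongr)
          · exact nP₁.trans e2
      _ = 22 * C * (X ^ (-κ) * (X ^ p * X ^ (-1 : ℝ))) := by ring
      _ ≤ 22 * C * X ^ (-(1 / 2) : ℝ) := by gcongr
      _ ≤ _ := by gcongr; exact le_add_of_nonneg_left (by positivity)

end

section

open MeasureTheory Set
open scoped ENNReal

/-! ### Measures on the half-line with polynomially bounded local mass -/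

/-- A measure on `[0, ∞)` whose mass on unit intervals `[a, a + 1]` is at most
`C * (1 + a) ^ (α - 1)`. -/
structure TameMeasure (α C : ℝ) (θ : Measure ℝ) : Prop where
  null : θ (Iio 0) = 0
  window : ∀ a : ℝ, 0 ≤ a → θ (Icc a (a + 1)) ≤ ENNReal.ofReal (C * (1 + a) ^ (α - 1))

lemma TameMeasure.mono {α C : ℝ} {θ η : Measure ℝ} (h : TameMeasure α C θ) (hle : η ≤ θ) :
    TameMeasure α C η :=
  ⟨le_antisymm ((hle _).trans h.null.le) bot_le, fun a ha => (hle _).trans (h.window a ha)⟩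

lemma TameMeasure.mono_const {α C D : ℝ} {θ : Measure ℝ} (h : TameMeasure α C θ) (hle : C ≤ D) :
    TameMeasure α D θ :=
  ⟨h.null, fun a ha => (h.window a ha).trans (ENNReal.ofReal_le_ofReal (by gcongr))⟩

/-- A form for windows that may start below 0: only the part on the half-line counts, and the bound
is nonincreasing in the starting point since α ≤ 1. -/
lemma TameMeasure.window' {α C : ℝ} {θ : Measure ℝ} (h : TameMeasure α C θ) (hα : α ≤ 1)
    (hC : 0 ≤ C) (a b : ℝ) (hab : b ≤ 1 + max a 0) (hb0 : 0 < b) :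
    θ (Icc a (a + 1)) ≤ ENNReal.ofReal (C * b ^ (α - 1)) := by
  have h1 : θ (Icc a (a + 1)) ≤ θ (Icc (max a 0) (max a 0 + 1)) := by
    calc θ (Icc a (a + 1)) ≤ θ (Iio 0 ∪ Icc (max a 0) (max a 0 + 1)) := by
          refine measure_mono fun x hx => ?_
          rcases lt_or_ge x 0 with hx0 | hx0
          · exact Or.inl hx0
          · exact Or.inr ⟨max_le hx.1 hx0, hx.2.trans (by gcongr; exact le_max_left _ _)⟩
      _ ≤ _ := (measure_union_le _ _).trans (by rw [h.null, zero_add])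
  refine h1.trans ((h.window _ (le_max_right _ _)).trans (ENNReal.ofReal_le_ofReal ?_))
  gcongr ?_ * ?_
  exact Real.rpow_le_rpow_of_nonpos hb0 hab (by linarith)

/-- Bernoulli's inequality for exponent α ≤ 1 gives (n+1)^α - n^α ≥ α (n+1)^{α-1}, and the sum
telescopes. -/
lemma sum_range_one_add_rpow_le {α : ℝ} (hα : 0 < α) (hα1 : α ≤ 1) (N : ℕ) :
    ∑ j ∈ Finset.range N, (1 + (j : ℝ)) ^ (α - 1) ≤ (N : ℝ) ^ α / α := by
  induction N with
  | zero => simp [Real.zero_rpow hα.ne']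
  | succ n ih =>
    rw [Finset.sum_range_succ]
    have hn : (0 : ℝ) < 1 + n := by positivity
    have h1 := rpow_one_add_le_one_add_mul_self (s := -(1 / (1 + (n : ℝ)))) (p := α)
      (by rw [neg_le_neg_iff, div_le_one hn]; linarith [n.cast_nonneg (α := ℝ)]) hα.le hα1
    have e : 1 + -(1 / (1 + (n : ℝ))) = n / (1 + n) := by field_simp; ring
    rw [e, Real.div_rpow (by positivity) hn.le, div_le_iff₀ (by positivity)] at h1
    have e2 : (1 + (n : ℝ)) ^ (α - 1) = (1 + (n : ℝ)) ^ α / (1 + n) := by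
      rw [Real.rpow_sub hn, Real.rpow_one]
    rw [e2]
    push_cast
    rw [add_comm (n : ℝ) 1]
    have : (n : ℝ) ^ α / α + (1 + (n : ℝ)) ^ α / (1 + n) ≤ (1 + (n : ℝ)) ^ α / α := by
      rw [← sub_nonneg]
      have : (1 + (n : ℝ)) ^ α / α - ((n : ℝ) ^ α / α + (1 + (n : ℝ)) ^ α / (1 + n)) =
        ((1 + α * -(1 / (1 + (n : ℝ)))) * (1 + (n : ℝ)) ^ α - (n : ℝ) ^ α) / α := by
        field_simp; ring
      rw [this]
      exact div_nonneg (by linarith) hα.le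
    linarith

lemma TameMeasure.measure_Iic_le {α C : ℝ} {θ : Measure ℝ} (h : TameMeasure α C θ) (hα : 0 < α)
    (hα1 : α ≤ 1) (hC : 0 ≤ C) {b : ℝ} (hb : 0 ≤ b) :
    θ (Iic b) ≤ ENNReal.ofReal (C / α * (1 + b) ^ α) := by
  set N : ℕ := ⌊b⌋₊ + 1 with hN
  have hNb : (N : ℝ) ≤ 1 + b := by
    rw [hN]; push_cast; linarith [Nat.floor_le hb]
  calc θ (Iic b) ≤ θ (Iio 0 ∪ ⋃ j ∈ Finset.range N, Icc (j : ℝ) (j + 1)) := by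
        refine measure_mono fun x hx => ?_
        rcases lt_or_ge x 0 with hx0 | hx0
        · exact Or.inl hx0
        · refine Or.inr (mem_iUnion₂.2 ⟨⌊x⌋₊, ?_, Nat.floor_le hx0, (Nat.lt_floor_add_one x).le⟩)
          rw [Finset.mem_range, hN]
          exact Nat.lt_succ_of_le (Nat.floor_le_floor hx)
    _ ≤ ∑ j ∈ Finset.range N, ENNReal.ofReal (C * (1 + (j : ℝ)) ^ (α - 1)) := by
        refine (measure_union_le _ _).trans ?_
        rw [h.null, zero_add]
        refine (measure_biUnion_finset_le _ _).trans (Finset.sum_le_sum fun j _ => ?_)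
        exact h.window j (by positivity)
    _ = ENNReal.ofReal (C * ∑ j ∈ Finset.range N, (1 + (j : ℝ)) ^ (α - 1)) := by
        rw [Finset.mul_sum, ENNReal.ofReal_sum_of_nonneg fun j _ => by positivity]
    _ ≤ _ := by
        refine ENNReal.ofReal_le_ofReal ?_
        rw [div_mul_eq_mul_div, mul_div_assoc]
        gcongr
        exact (sum_range_one_add_rpow_le hα hα1 N).trans (by gcongr)

/-- The constant in `TameMeasure.lintegral_le`. -/
noncomputable def tameIntegralConst (α : ℝ) : ℝ :=
  4 / α + 3 * ∑' j : ℕ, (1 + (j : ℝ)) ^ (-(3 / 2) : ℝ)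

lemma summable_one_add_rpow : Summable fun j : ℕ => (1 + (j : ℝ)) ^ (-(3 / 2) : ℝ) := by
  have := (summable_nat_add_iff 1).2 (Real.summable_nat_rpow.2 (by norm_num : (-(3 / 2) : ℝ) < -1))
  refine this.congr fun j => ?_
  push_cast; rw [add_comm]

lemma tameIntegralConst_pos {α : ℝ} (hα : 0 < α) : 0 < tameIntegralConst α :=
  add_pos_of_pos_of_nonneg (by positivity)
    (mul_nonneg (by norm_num) (tsum_nonneg fun j => by positivity))

/-- On w ≤ b/2 the kernel is O(b^{-3/2}) against mass O(b^α). On the remaining unit windows the mass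
is O(b^{α-1}) throughout and the kernel is summable. So an integrable error integrated against a
tame measure is no larger than the mass of one window at b. -/
lemma TameMeasure.lintegral_le {α C : ℝ} {θ : Measure ℝ} (h : TameMeasure α C θ) (hα : 0 < α)
    (hα1 : α ≤ 1) (hC : 0 ≤ C) {b : ℝ} (hb : 0 ≤ b) :
    ∫⁻ w in Iic b, ENNReal.ofReal ((1 + (b - w)) ^ (-(3 / 2) : ℝ)) ∂θ ≤
      ENNReal.ofReal (tameIntegralConst α * C * (1 + b) ^ (α - 1)) := by
  have hb1 : 0 < 1 + b := by linarith
  set f : ℝ → ℝ≥0∞ := fun w => ENNReal.ofReal ((1 + (b - w)) ^ (-(3 / 2) : ℝ)) with hf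
  set N : ℕ := ⌊b / 2⌋₊ + 1 with hN
  set W : ℕ → Set ℝ := fun j => Icc (b - j - 1) (b - j - 1 + 1) with hW
  have hcover : Iic b ⊆ Iic (b / 2) ∪ ⋃ j ∈ Finset.range N, W j := by
    intro w hw
    rcases le_or_gt w (b / 2) with h1 | h1
    · exact Or.inl h1
    · have hbw : 0 ≤ b - w := by linarith [mem_Iic.1 hw]
      refine Or.inr (mem_iUnion₂.2 ⟨⌊b - w⌋₊, ?_, ?_, ?_⟩)
      · rw [Finset.mem_range, hN]
        exact Nat.lt_succ_of_le (Nat.floor_le_floor (by linarith))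
      · linarith [Nat.lt_floor_add_one (b - w)]
      · linarith [Nat.floor_le hbw]
  have hleft : ∫⁻ w in Iic (b / 2), f w ∂θ ≤
      ENNReal.ofReal (4 / α * C * (1 + b) ^ (α - 1)) := by
    have h2 : 0 < (1 + b) / 2 := by positivity
    calc ∫⁻ w in Iic (b / 2), f w ∂θ
        ≤ ∫⁻ w in Iic (b / 2), ENNReal.ofReal (((1 + b) / 2) ^ (-(3 / 2) : ℝ)) ∂θ := by
          refine setLIntegral_mono' measurableSet_Iic fun w hw => ENNReal.ofReal_le_ofReal ?_
          exact Real.rpow_le_rpow_of_nonpos h2 (by linarith [mem_Iic.1 hw]) (by norm_num)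
      _ ≤ ENNReal.ofReal (((1 + b) / 2) ^ (-(3 / 2) : ℝ)) *
          ENNReal.ofReal (C / α * (1 + b / 2) ^ α) := by
          rw [setLIntegral_const]
          gcongr
          exact h.measure_Iic_le hα hα1 hC (by linarith)
      _ ≤ _ := by
          rw [← ENNReal.ofReal_mul (by positivity)]
          refine ENNReal.ofReal_le_ofReal ?_
          have e1 : ((1 + b) / 2) ^ (-(3 / 2) : ℝ) ≤ 4 * (1 + b) ^ (-1 : ℝ) := by
            rw [div_eq_mul_inv, Real.mul_rpow hb1.le (by norm_num), mul_comm]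
            gcongr
            · rw [Real.inv_rpow (by norm_num), Real.rpow_neg (by norm_num), inv_inv]
              calc (2 : ℝ) ^ (3 / 2 : ℝ) ≤ 2 ^ (2 : ℝ) := by gcongr <;> norm_num
                _ = 4 := by norm_num
            · linarith
            · norm_num
          have e2 : (1 + b / 2) ^ α ≤ (1 + b) ^ α := by gcongr; linarith
          have e3 : (1 + b) ^ (α - 1) = (1 + b) ^ (-1 : ℝ) * (1 + b) ^ α := by
            rw [← Real.rpow_add hb1]; congr 1; ring
          calc _ ≤ 4 * (1 + b) ^ (-1 : ℝ) * (C / α * (1 + b) ^ α) := by gcongr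
            _ = _ := by rw [e3]; ring
  have hright : ∀ j ∈ Finset.range N, ∫⁻ w in W j, f w ∂θ ≤
      ENNReal.ofReal ((1 + (j : ℝ)) ^ (-(3 / 2) : ℝ) * (3 * C * (1 + b) ^ (α - 1))) := by
    intro j hj
    have hjb : (j : ℝ) ≤ b / 2 := by
      rw [Finset.mem_range, hN] at hj
      exact (Nat.le_floor_iff (by linarith)).1 (Nat.le_of_lt_succ hj)
    calc ∫⁻ w in W j, f w ∂θ ≤ ∫⁻ w in W j, ENNReal.ofReal ((1 + (j : ℝ)) ^ (-(3 / 2) : ℝ)) ∂θ := by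
          refine setLIntegral_mono' measurableSet_Icc fun w hw => ENNReal.ofReal_le_ofReal ?_
          exact Real.rpow_le_rpow_of_nonpos (by positivity) (by linarith [hw.2]) (by norm_num)
      _ ≤ ENNReal.ofReal ((1 + (j : ℝ)) ^ (-(3 / 2) : ℝ)) *
          ENNReal.ofReal (C * ((1 + b) / 3) ^ (α - 1)) := by
          rw [setLIntegral_const]
          gcongr
          refine h.window' hα1 hC _ _ ?_ (by positivity)
          rcases le_total (b - j - 1) 0 with h0 | h0
          · rw [max_eq_right h0]; linarith
          · rw [max_eq_left h0]; linarith
      _ ≤ _ := by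
          rw [← ENNReal.ofReal_mul (by positivity)]
          refine ENNReal.ofReal_le_ofReal ?_
          have e1 : ((1 + b) / 3) ^ (α - 1) ≤ 3 * (1 + b) ^ (α - 1) := by
            rw [div_eq_mul_inv, Real.mul_rpow hb1.le (by norm_num), mul_comm]
            gcongr
            rw [Real.inv_rpow (by norm_num), ← Real.rpow_neg (by norm_num)]
            calc (3 : ℝ) ^ (-(α - 1)) ≤ 3 ^ (1 : ℝ) := by
                  apply Real.rpow_le_rpow_of_exponent_le (by norm_num); linarith
              _ = 3 := by norm_num
          calc _ ≤ (1 + (j : ℝ)) ^ (-(3 / 2) : ℝ) * (C * (3 * (1 + b) ^ (α - 1))) := by gcongr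
            _ = _ := by ring
  calc ∫⁻ w in Iic b, f w ∂θ
      ≤ ∫⁻ w in Iic (b / 2) ∪ ⋃ j ∈ Finset.range N, W j, f w ∂θ := lintegral_mono_set hcover
    _ ≤ ∫⁻ w in Iic (b / 2), f w ∂θ + ∑ j ∈ Finset.range N, ∫⁻ w in W j, f w ∂θ := by
        refine (lintegral_union_le _ _ _).trans ?_
        gcongr
        have := lintegral_iUnion_le (μ := θ) (fun j : Finset.range N => W j) f
        rw [tsum_fintype, Finset.sum_coe_sort (Finset.range N) fun j => ∫⁻ w in W j, f w ∂θ] at this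
        have e : ⋃ j ∈ Finset.range N, W j = ⋃ j : Finset.range N, W j := by
          ext x; simp
        rw [e]
        exact this
    _ ≤ ENNReal.ofReal (4 / α * C * (1 + b) ^ (α - 1)) + ∑ j ∈ Finset.range N,
        ENNReal.ofReal ((1 + (j : ℝ)) ^ (-(3 / 2) : ℝ) * (3 * C * (1 + b) ^ (α - 1))) :=
        add_le_add hleft (Finset.sum_le_sum hright)
    _ = ENNReal.ofReal (4 / α * C * (1 + b) ^ (α - 1) +
        (∑ j ∈ Finset.range N, (1 + (j : ℝ)) ^ (-(3 / 2) : ℝ)) * (3 * C * (1 + b) ^ (α - 1))) := by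
        rw [← ENNReal.ofReal_sum_of_nonneg fun j _ => by positivity,
          ← ENNReal.ofReal_add (by positivity)
            (Finset.sum_nonneg fun j _ => by positivity), Finset.sum_mul]
    _ ≤ _ := by
        refine ENNReal.ofReal_le_ofReal ?_
        have : ∑ j ∈ Finset.range N, (1 + (j : ℝ)) ^ (-(3 / 2) : ℝ) ≤
            ∑' j : ℕ, (1 + (j : ℝ)) ^ (-(3 / 2) : ℝ) :=
          summable_one_add_rpow.sum_le_tsum _ fun j _ => by positivity
        calc _ ≤ 4 / α * C * (1 + b) ^ (α - 1) + (∑' j : ℕ, (1 + (j : ℝ)) ^ (-(3 / 2) : ℝ)) *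
              (3 * C * (1 + b) ^ (α - 1)) := by gcongr
          _ = _ := by rw [tameIntegralConst]; ring

/-- If the second coordinate is at most half of a + 1, the first lies in a unit window at height
comparable with a, of mass O(a^{α-1}). The second coordinate then contributes at most its total mass
O(a^β). -/
lemma TameMeasure.prod_window_le {α β C D : ℝ} {θ η : Measure ℝ} [SFinite θ] [SFinite η]
    (hθ : TameMeasure α C θ)
    (hη : TameMeasure β D η) (hα : 0 < α) (hα1 : α ≤ 1) (hβ : 0 < β) (hβ1 : β ≤ 1)
    (hC : 0 ≤ C) (hD : 0 ≤ D) {a : ℝ} (ha : 0 ≤ a) :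
    (θ.prod η) {x | x.1 + x.2 ∈ Icc a (a + 1) ∧ x.2 ≤ (a + 1) / 2} ≤
      ENNReal.ofReal (4 / β * C * D * (1 + a) ^ (α + β - 1)) := by
  have ha1 : 0 < 1 + a := by linarith
  have hm : MeasurableSet {x : ℝ × ℝ | x.1 + x.2 ∈ Icc a (a + 1) ∧ x.2 ≤ (a + 1) / 2} :=
    ((measurable_fst.add measurable_snd) measurableSet_Icc).inter
      (measurableSet_le measurable_snd measurable_const)
  rw [Measure.prod_apply_symm hm]
  calc ∫⁻ y, θ ((fun x => (x, y)) ⁻¹' {x | x.1 + x.2 ∈ Icc a (a + 1) ∧ x.2 ≤ (a + 1) / 2}) ∂η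
      ≤ ∫⁻ y, (Iic ((a + 1) / 2)).indicator
          (fun _ => ENNReal.ofReal (C * ((1 + a) / 2) ^ (α - 1))) y ∂η := by
        refine lintegral_mono fun y => ?_
        by_cases hy : y ∈ Iic ((a + 1) / 2)
        · rw [indicator_of_mem hy]
          refine le_trans (measure_mono ?_)
            (hθ.window' hα1 hC (a - y) ((1 + a) / 2) ?_ (by positivity))
          · rintro x ⟨hx, -⟩
            simp only [mem_Icc] at hx ⊢
            constructor <;> linarith
          · have := mem_Iic.1 hy
            linarith [le_max_left (a - y) 0, le_max_right (a - y) 0]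
        · rw [indicator_of_notMem hy]
          refine le_of_eq (measure_mono_null ?_ measure_empty)
          rintro x ⟨-, hx⟩
          exact hy hx
    _ = ENNReal.ofReal (C * ((1 + a) / 2) ^ (α - 1)) * η (Iic ((a + 1) / 2)) := by
        rw [lintegral_indicator_const measurableSet_Iic]
    _ ≤ ENNReal.ofReal (C * ((1 + a) / 2) ^ (α - 1)) *
        ENNReal.ofReal (D / β * (1 + (a + 1) / 2) ^ β) := by
        gcongr
        exact hη.measure_Iic_le hβ hβ1 hD (by linarith)
    _ ≤ _ := by
        rw [← ENNReal.ofReal_mul (by positivity)]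
        refine ENNReal.ofReal_le_ofReal ?_
        have e1 : ((1 + a) / 2) ^ (α - 1) ≤ 2 * (1 + a) ^ (α - 1) := by
          rw [div_eq_mul_inv, Real.mul_rpow ha1.le (by norm_num), mul_comm]
          gcongr
          rw [Real.inv_rpow (by norm_num), ← Real.rpow_neg (by norm_num)]
          calc (2 : ℝ) ^ (-(α - 1)) ≤ 2 ^ (1 : ℝ) := by
                apply Real.rpow_le_rpow_of_exponent_le (by norm_num); linarith
            _ = 2 := by norm_num
        have e2 : (1 + (a + 1) / 2) ^ β ≤ 2 * (1 + a) ^ β := by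
          calc (1 + (a + 1) / 2) ^ β ≤ (2 * (1 + a)) ^ β := by gcongr; linarith
            _ = 2 ^ β * (1 + a) ^ β := Real.mul_rpow (by norm_num) ha1.le
            _ ≤ 2 ^ (1 : ℝ) * (1 + a) ^ β := by gcongr; norm_num
            _ = _ := by norm_num
        have e3 : (1 + a) ^ (α + β - 1) = (1 + a) ^ (α - 1) * (1 + a) ^ β := by
          rw [← Real.rpow_add ha1]; congr 1; ring
        calc _ ≤ C * (2 * (1 + a) ^ (α - 1)) * (D / β * (2 * (1 + a) ^ β)) := by gcongr
          _ = _ := by rw [e3]; ring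

/-- One of the two summands is at most half of their sum; each case is the preceding bound, the
second after a swap. -/
lemma TameMeasure.conv {α β C D : ℝ} {θ η : Measure ℝ} [SFinite θ] [SFinite η]
    (hθ : TameMeasure α C θ) (hη : TameMeasure β D η) (hα : 0 < α) (hα1 : α ≤ 1) (hβ : 0 < β)
    (hβ1 : β ≤ 1) (hC : 0 ≤ C) (hD : 0 ≤ D) :
    TameMeasure (α + β) ((4 / α + 4 / β) * C * D) (θ.conv η) := by
  refine ⟨?_, fun a ha => ?_⟩
  · rw [Measure.conv, Measure.map_apply (by fun_prop) measurableSet_Iio]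
    refine measure_mono_null (t := Iio 0 ×ˢ univ ∪ univ ×ˢ Iio 0) ?_ ?_
    · rintro ⟨x, y⟩ hxy
      have h : x + y < 0 := hxy
      rcases lt_or_ge x 0 with hx | hx
      · exact Or.inl ⟨hx, mem_univ _⟩
      · exact Or.inr ⟨mem_univ _, by simp only [mem_Iio]; linarith⟩
    · refine le_antisymm ((measure_union_le _ _).trans ?_) bot_le
      rw [Measure.prod_prod, Measure.prod_prod, hθ.null, hη.null]; simp
  · rw [Measure.conv, Measure.map_apply (by fun_prop) measurableSet_Icc]
    have hswap : (θ.prod η) {x | x.1 + x.2 ∈ Icc a (a + 1) ∧ x.1 ≤ (a + 1) / 2} =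
        (η.prod θ) {x | x.1 + x.2 ∈ Icc a (a + 1) ∧ x.2 ≤ (a + 1) / 2} := by
      have hm : MeasurableSet {x : ℝ × ℝ | x.1 + x.2 ∈ Icc a (a + 1) ∧ x.1 ≤ (a + 1) / 2} :=
        ((measurable_fst.add measurable_snd) measurableSet_Icc).inter
          (measurableSet_le measurable_fst measurable_const)
      rw [← Measure.prod_swap (μ := η) (ν := θ), Measure.map_apply measurable_swap hm]
      congr 1
      ext x
      simp [add_comm]
    calc _ ≤ (θ.prod η) ({x | x.1 + x.2 ∈ Icc a (a + 1) ∧ x.2 ≤ (a + 1) / 2} ∪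
          {x | x.1 + x.2 ∈ Icc a (a + 1) ∧ x.1 ≤ (a + 1) / 2}) := by
          refine measure_mono ?_
          rintro ⟨x, y⟩ hxy
          have h : x + y ∈ Icc a (a + 1) := hxy
          rcases le_total y ((a + 1) / 2) with hy | hy
          · exact Or.inl ⟨h, hy⟩
          · refine Or.inr ⟨h, ?_⟩
            have := h.2
            simp only; linarith
      _ ≤ ENNReal.ofReal (4 / β * C * D * (1 + a) ^ (α + β - 1)) +
          ENNReal.ofReal (4 / α * D * C * (1 + a) ^ (β + α - 1)) := by
          refine (measure_union_le _ _).trans (add_le_add ?_ ?_)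
          · exact hθ.prod_window_le hη hα hα1 hβ hβ1 hC hD ha
          · rw [hswap]
            exact hη.prod_window_le hθ hβ hβ1 hα hα1 hD hC ha
      _ = _ := by
          have ha1 : 0 < 1 + a := by linarith
          rw [← ENNReal.ofReal_add (by positivity) (by positivity), add_comm β α]
          congr 1; ring

end

section

open MeasureTheory Set Filter Topology ProbabilityTheory
open scoped ENNReal

/-! ### The measures attached to `rootZeta k` and to the density `v ^ (κ - 1) / Γ(κ)` -/

/-- The measure `∑ n, (rootZeta k n / n) δ_{log n}`. -/
noncomputable def rootMeasure (k : ℕ) : Measure ℝ :=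
  -- The index n = 0 carries no mass, because `rootZeta k 0 = 0`; otherwise log 0 = 0 would add a
  -- spurious atom.
  Measure.sum fun n : ℕ => ENNReal.ofReal (rootZeta k n / n) • Measure.dirac (Real.log n)

/-- The density `v ^ (κ - 1) / Γ(κ)`. -/
noncomputable def rpowDensity (κ v : ℝ) : ℝ := v ^ (κ - 1) / Real.Gamma κ

/-- The measure with density `v ^ (κ - 1) / Γ(κ)` on `(0, ∞)`. -/
noncomputable def rpowMeasure (κ : ℝ) : Measure ℝ :=
  (volume.restrict (Ioi 0)).withDensity fun v => ENNReal.ofReal (rpowDensity κ v)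

/-- The standard exponential distribution. -/
noncomputable def expMeasureOne : Measure ℝ :=
  (volume.restrict (Ici 0)).withDensity fun v => ENNReal.ofReal (Real.exp (-v))

instance (k : ℕ) : SFinite (rootMeasure k) := by unfold rootMeasure; infer_instance
instance (κ : ℝ) : SFinite (rpowMeasure κ) := by unfold rpowMeasure; infer_instance
instance : SFinite expMeasureOne := by unfold expMeasureOne; infer_instance

/-- The extended real exponential mean `∫_{x ≤ v} e ^ (x - v) dθ(x)`. -/
noncomputable def expMeanENN (θ : Measure ℝ) (v : ℝ) : ℝ≥0∞ :=
  ∫⁻ x in Iic v, ENNReal.ofReal (Real.exp (x - v)) ∂θ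

/-- The exponential mean `∫_{x ≤ v} e ^ (x - v) dθ(x)`. -/
noncomputable def expMean (θ : Measure ℝ) (v : ℝ) : ℝ := (expMeanENN θ v).toReal

lemma rpowDensity_nonneg {κ v : ℝ} (hκ : 0 < κ) (hv : 0 ≤ v) : 0 ≤ rpowDensity κ v :=
  div_nonneg (by positivity) (Real.Gamma_pos_of_pos hκ).le

lemma measurable_rpowDensity (κ : ℝ) : Measurable (rpowDensity κ) := by
  unfold rpowDensity; fun_prop

lemma expMeanENN_eq (θ : Measure ℝ) (v : ℝ) :
    expMeanENN θ v = ∫⁻ x, (if x ≤ v then ENNReal.ofReal (Real.exp (x - v)) else 0) ∂θ := by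
  rw [expMeanENN, ← lintegral_indicator measurableSet_Iic]
  rfl

lemma measurable_expMeanENN_aux : Measurable fun p : ℝ × ℝ =>
    (if p.2 ≤ p.1 then ENNReal.ofReal (Real.exp (p.2 - p.1)) else 0) :=
  Measurable.ite (measurableSet_le measurable_snd measurable_fst) (by fun_prop) measurable_const

lemma measurable_expMeanENN (θ : Measure ℝ) [SFinite θ] : Measurable (expMeanENN θ) := by
  simp_rw [funext (expMeanENN_eq θ)]
  exact measurable_expMeanENN_aux.lintegral_prod_right'

/-- Convolution with the exponential distribution has density `expMeanENN θ`. -/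
lemma conv_expMeasureOne (θ : Measure ℝ) [SFinite θ] :
    θ.conv expMeasureOne = volume.withDensity (expMeanENN θ) := by
  refine Measure.ext_of_lintegral _ fun f hf => ?_
  rw [Measure.lintegral_conv hf, lintegral_withDensity_eq_lintegral_mul _
    (measurable_expMeanENN θ) hf]
  have h1 : ∀ x : ℝ, ∫⁻ y, f (x + y) ∂expMeasureOne =
      ∫⁻ v, (if x ≤ v then ENNReal.ofReal (Real.exp (x - v)) else 0) * f v := by
    intro x
    rw [expMeasureOne, lintegral_withDensity_eq_lintegral_mul _ (by fun_prop) (by fun_prop),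
      ← lintegral_indicator measurableSet_Ici, ← lintegral_add_left_eq_self
        (fun v => (if x ≤ v then ENNReal.ofReal (Real.exp (x - v)) else 0) * f v) x]
    refine lintegral_congr fun y => ?_
    by_cases hy : 0 ≤ y
    · simp [hy]
    · simp [hy]
  simp_rw [h1]
  rw [lintegral_lintegral_swap]
  · refine lintegral_congr fun v => ?_
    rw [Pi.mul_apply, expMeanENN_eq, lintegral_mul_const]
    exact (measurable_expMeanENN_aux.comp (measurable_const.prodMk measurable_id))
  · exact ((measurable_expMeanENN_aux.comp measurable_swap).mul
      (hf.comp measurable_snd)).aemeasurable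

/-- With s = 1 + z this is the factor 1/s in `rootZetaError`. -/
lemma integral_cexp_expMeasureOne {z : ℂ} (hz : 0 < z.re) :
    ∫ y, Complex.exp (z * ((-y : ℝ) : ℂ)) ∂expMeasureOne = (1 + z)⁻¹ := by
  rw [expMeasureOne, integral_withDensity_eq_integral_toReal_smul (by fun_prop) (by simp),
    integral_Ici_eq_integral_Ioi]
  have : ∀ y : ℝ, (ENNReal.ofReal (Real.exp (-y))).toReal • Complex.exp (z * ((-y : ℝ) : ℂ)) =
      Complex.exp (-(1 + z) * y) := by
    intro y
    rw [ENNReal.toReal_ofReal (Real.exp_pos _).le, Complex.real_smul, Complex.ofReal_exp,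
      ← Complex.exp_add]
    congr 1; push_cast; ring
  simp_rw [this]
  rw [integral_exp_mul_complex_Ioi (by simp; linarith)]
  rw [Complex.ofReal_zero, mul_zero, Complex.exp_zero, neg_div_neg_eq, one_div]

lemma integrable_exp_expMeasureOne {σ : ℝ} (hσ : 0 < σ) :
    Integrable (fun y => Real.exp (σ * -y)) expMeasureOne := by
  rw [expMeasureOne, integrable_withDensity_iff_integrable_smul' (by fun_prop) (by simp)]
  have : ∀ y : ℝ, (ENNReal.ofReal (Real.exp (-y))).toReal • Real.exp (σ * -y) =
      Real.exp (-(1 + σ) * y) := by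
    intro y
    rw [ENNReal.toReal_ofReal (Real.exp_pos _).le, smul_eq_mul, ← Real.exp_add]
    congr 1; ring
  simp_rw [this]
  change IntegrableOn _ (Ici 0) volume
  rw [integrableOn_Ici_iff_integrableOn_Ioi]
  exact integrableOn_exp_mul_Ioi (by linarith) 0

lemma integrable_exp_conv {θ : Measure ℝ} [SFinite θ] {σ : ℝ} (hσ : 0 < σ)
    (h : Integrable (fun x => Real.exp (σ * -x)) θ) :
    Integrable (fun x => Real.exp (σ * -x)) (θ.conv expMeasureOne) := by
  rw [Measure.conv, integrable_map_measure (by fun_prop) (by fun_prop)]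
  refine (h.mul_prod (integrable_exp_expMeasureOne hσ)).congr (Eventually.of_forall fun p => ?_)
  simp only [Function.comp]
  rw [← Real.exp_add]; congr 1; ring

lemma integral_cexp_conv {θ : Measure ℝ} [SFinite θ] {z : ℂ} (hz : 0 < z.re) :
    ∫ x, Complex.exp (z * ((-x : ℝ) : ℂ)) ∂(θ.conv expMeasureOne) =
      (∫ x, Complex.exp (z * ((-x : ℝ) : ℂ)) ∂θ) * (1 + z)⁻¹ := by
  rw [Measure.conv, integral_map (by fun_prop) (by fun_prop), ← integral_cexp_expMeasureOne hz,
    ← integral_prod_mul]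
  refine integral_congr_ae (Eventually.of_forall fun p => ?_)
  simp only
  rw [← Complex.exp_add]; congr 1; push_cast; ring

lemma rootMeasure_null (k : ℕ) : rootMeasure k (Iio 0) = 0 := by
  rw [rootMeasure, Measure.sum_apply _ measurableSet_Iio, ENNReal.tsum_eq_zero]
  intro n
  rw [Measure.smul_apply, Measure.dirac_apply' _ measurableSet_Iio, indicator_of_notMem]
  · simp
  · simp [Real.log_natCast_nonneg]

lemma integrable_exp_rootMeasure {k : ℕ} (hk : k ≠ 0) {σ : ℝ} (hσ : 0 < σ) :
    Integrable (fun x => Real.exp (σ * -x)) (rootMeasure k) := by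
  refine (integrable_sum_dirac_iff fun n => ENNReal.ofReal_ne_top).2 ?_
  refine Summable.of_nonneg_of_le (fun n => by positivity) (fun n => ?_)
    (Real.summable_nat_rpow.2 (by linarith : -(1 + σ) < -1))
  rcases Nat.eq_zero_or_pos n with rfl | hn
  · simp; positivity
  have hn' : (0 : ℝ) < n := by exact_mod_cast hn
  rw [ENNReal.toReal_ofReal (div_nonneg (rootZeta_nonneg k n) hn'.le),
    Real.norm_of_nonneg (Real.exp_pos _).le, neg_add, Real.rpow_add hn', Real.rpow_neg_one,
    Real.rpow_def_of_pos hn']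
  have : Real.exp (σ * -Real.log n) = Real.exp (Real.log n * -σ) := by congr 1; ring
  rw [this]
  gcongr
  rw [div_eq_mul_inv]
  exact mul_le_of_le_one_left (by positivity) (rootZeta_le_one hk n)

/-- Both sides are the same `tsum` term by term, so no half-plane of convergence is needed. -/
lemma integral_cexp_rootMeasure {k : ℕ} {z : ℂ} :
    ∫ x, Complex.exp (z * ((-x : ℝ) : ℂ)) ∂(rootMeasure k) = rootZetaSeries k (1 + z) := by
  rw [rootMeasure, integral_sum_dirac fun n => ENNReal.ofReal_ne_top, rootZetaSeries, LSeries]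
  refine tsum_congr fun n => ?_
  rw [LSeries.term_def]
  split_ifs with hn
  · simp [hn]
  · have hn' : (n : ℂ) ≠ 0 := by exact_mod_cast hn
    rw [ENNReal.toReal_ofReal (div_nonneg (rootZeta_nonneg k n) (by positivity)),
      Complex.real_smul, Complex.cpow_add _ _ hn', Complex.cpow_one, Complex.cpow_def_of_ne_zero hn']
    push_cast
    rw [← Complex.natCast_log, mul_neg, Complex.exp_neg, mul_comm z]
    field_simp

lemma integrable_exp_rpowMeasure {κ : ℝ} (hκ : 0 < κ) {σ : ℝ} (hσ : 0 < σ) :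
    Integrable (fun x => Real.exp (σ * -x)) (rpowMeasure κ) := by
  rw [rpowMeasure, integrable_withDensity_iff_integrable_smul'
    (measurable_rpowDensity κ).ennreal_ofReal (by simp)]
  have h := (Real.integral_rpow_mul_exp_neg_mul_Ioi hκ hσ)
  have h2 : IntegrableOn (fun t : ℝ => t ^ (κ - 1) * Real.exp (-(σ * t))) (Ioi 0) := by
    by_contra hcon
    rw [integral_undef hcon] at h
    have : 0 < (1 / σ) ^ κ * Real.Gamma κ := mul_pos (by positivity) (Real.Gamma_pos_of_pos hκ)
    linarith
  refine (h2.div_const (Real.Gamma κ)).congr ?_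
  filter_upwards [ae_restrict_mem measurableSet_Ioi] with t ht
  rw [ENNReal.toReal_ofReal (rpowDensity_nonneg hκ (le_of_lt ht)), rpowDensity, smul_eq_mul,
    mul_neg]
  ring

lemma integral_exp_rpowMeasure {κ : ℝ} (hκ : 0 < κ) {σ : ℝ} (hσ : 0 < σ) :
    ∫ x, Real.exp (σ * -x) ∂(rpowMeasure κ) = σ ^ (-κ) := by
  rw [rpowMeasure, integral_withDensity_eq_integral_toReal_smul
    (measurable_rpowDensity κ).ennreal_ofReal (by simp)]
  have hG := (Real.Gamma_pos_of_pos hκ).ne'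
  calc _ = ∫ t in Ioi 0, (t ^ (κ - 1) * Real.exp (-(σ * t))) / Real.Gamma κ := by
        refine setIntegral_congr_fun measurableSet_Ioi fun t ht => ?_
        rw [ENNReal.toReal_ofReal (rpowDensity_nonneg hκ (le_of_lt ht)), rpowDensity, smul_eq_mul,
          mul_neg]
        ring
    _ = _ := by
        rw [integral_div, Real.integral_rpow_mul_exp_neg_mul_Ioi hκ hσ, mul_div_cancel_right₀ _ hG,
          one_div, Real.inv_rpow hσ.le, Real.rpow_neg hσ.le]

lemma mem_interior_integrableExpSet {θ : Measure ℝ}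
    (h : ∀ σ : ℝ, 0 < σ → Integrable (fun x => Real.exp (σ * -x)) θ) {σ : ℝ} (hσ : 0 < σ) :
    σ ∈ interior (integrableExpSet (fun x : ℝ => -x) θ) :=
  interior_maximal (fun t ht => h t ht) isOpen_Ioi hσ

/-- Euler's Gamma integral gives the formula for positive real z; both sides are analytic on the
right half-plane. -/
lemma integral_cexp_rpowMeasure {κ : ℝ} (hκ : 0 < κ) {z : ℂ} (hz : 0 < z.re) :
    ∫ x, Complex.exp (z * ((-x : ℝ) : ℂ)) ∂(rpowMeasure κ) = z ^ ((-κ : ℝ) : ℂ) := by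
  set U : Set ℂ := {z | 0 < z.re}
  have hUo : IsOpen U := isOpen_lt continuous_const Complex.continuous_re
  have hU : IsPreconnected U := (convex_halfSpace_re_gt 0).isPreconnected
  have h1 : AnalyticOnNhd ℂ (complexMGF (fun x : ℝ => -x) (rpowMeasure κ)) U := fun w hw =>
    analyticAt_complexMGF
      (mem_interior_integrableExpSet (fun σ hσ => integrable_exp_rpowMeasure hκ hσ) hw)
  have h2 : AnalyticOnNhd ℂ (fun z : ℂ => z ^ ((-κ : ℝ) : ℂ)) U := by
    refine DifferentiableOn.analyticOnNhd (fun w hw => ?_) hUo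
    exact (differentiableAt_id.cpow_const (Or.inl hw)).differentiableWithinAt
  refine h1.eqOn_of_preconnected_of_frequently_eq h2 hU (z₀ := 1) (by simp [U]) ?_ hz
  have hreal : ∀ σ : ℝ, 0 < σ →
      complexMGF (fun x : ℝ => -x) (rpowMeasure κ) σ = (σ : ℂ) ^ ((-κ : ℝ) : ℂ) := by
    intro σ hσ
    rw [complexMGF_ofReal, mgf, integral_exp_rpowMeasure hκ hσ, Complex.ofReal_cpow hσ.le]
  have ht : Tendsto (fun n : ℕ => ((1 + 1 / ((n : ℝ) + 1) : ℝ) : ℂ)) atTop (𝓝[≠] 1) := by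
    rw [tendsto_nhdsWithin_iff]
    refine ⟨?_, Eventually.of_forall fun n => ?_⟩
    · have := (tendsto_one_div_add_atTop_nhds_zero_nat (𝕜 := ℝ)).const_add 1
      rw [add_zero] at this
      have h3 := (Complex.continuous_ofReal.tendsto 1).comp this
      rw [Complex.ofReal_one] at h3
      exact h3
    · rw [mem_compl_iff, mem_singleton_iff, ← Complex.ofReal_one, Complex.ofReal_inj]
      have : 0 < 1 / ((n : ℝ) + 1) := by positivity
      linarith
  exact ht.frequently (Frequently.of_forall fun n => hreal _ (by positivity))

/-- The second moments of the Laplace transforms: the difference of the exponential smoothings of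
`rootMeasure k` and `rpowMeasure (1 / k)` has second derivative that of `rootZetaError k`. -/
lemma exists_laplace_bound {k : ℕ} (hk : 2 ≤ k) :
    ∃ C : ℝ, 0 < C ∧ ∀ z : ℂ, 0 < z.re → z.re ≤ 1 →
      ‖(∫ v, ((-v : ℝ) : ℂ) ^ 2 * Complex.exp (z * ((-v : ℝ) : ℂ))
          ∂((rootMeasure k).conv expMeasureOne)) -
        ∫ v, ((-v : ℝ) : ℂ) ^ 2 * Complex.exp (z * ((-v : ℝ) : ℂ))
          ∂((rpowMeasure (1 / (k : ℝ))).conv expMeasureOne)‖ ≤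
      C * (‖z‖ ^ (-(1 + 1 / (k : ℝ))) + ‖z‖ ^ (-(1 / 2) : ℝ)) := by
  have hk0 : k ≠ 0 := by lia
  have hκ0 : 0 < 1 / (k : ℝ) := by positivity
  obtain ⟨R₁, R₂, hR₁, hR₂, C, hC, hb⟩ := exists_hasDerivAt_rootZetaError hk
  refine ⟨C, hC, fun z hz hz1 => ?_⟩
  set M₁ := (rootMeasure k).conv expMeasureOne
  set M₂ := (rpowMeasure (1 / (k : ℝ))).conv expMeasureOne
  have hM₁ : ∀ {σ : ℝ}, 0 < σ → σ ∈ interior (integrableExpSet (fun x : ℝ => -x) M₁) :=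
    mem_interior_integrableExpSet fun σ hσ =>
      integrable_exp_conv hσ (integrable_exp_rootMeasure hk0 hσ)
  have hM₂ : ∀ {σ : ℝ}, 0 < σ → σ ∈ interior (integrableExpSet (fun x : ℝ => -x) M₂) :=
    mem_interior_integrableExpSet fun σ hσ =>
      integrable_exp_conv hσ (integrable_exp_rpowMeasure hκ0 hσ)
  have hUo : IsOpen {w : ℂ | 0 < w.re} := isOpen_lt continuous_const Complex.continuous_re
  have e0 : ∀ w : ℂ, 0 < w.re →
      (∫ v, ((-v : ℝ) : ℂ) ^ 0 * Complex.exp (w * ((-v : ℝ) : ℂ)) ∂M₁) -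
        ∫ v, ((-v : ℝ) : ℂ) ^ 0 * Complex.exp (w * ((-v : ℝ) : ℂ)) ∂M₂ =
      rootZetaError k (1 + w) := by
    intro w hw
    simp only [pow_zero, one_mul]
    rw [integral_cexp_conv hw, integral_cexp_conv hw, integral_cexp_rootMeasure,
      integral_cexp_rpowMeasure hκ0 hw, rootZetaError, add_sub_cancel_left]
    ring
  -- Each differentiation in w brings down a factor -v, so differentiating twice yields the weight
  -- v².
  have e1 : ∀ w : ℂ, 0 < w.re →
      (∫ v, ((-v : ℝ) : ℂ) ^ 1 * Complex.exp (w * ((-v : ℝ) : ℂ)) ∂M₁) -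
        ∫ v, ((-v : ℝ) : ℂ) ^ 1 * Complex.exp (w * ((-v : ℝ) : ℂ)) ∂M₂ = R₁ (1 + w) := by
    intro w hw
    have d := (hasDerivAt_integral_pow_mul_exp (hM₁ hw) 0).sub
      (hasDerivAt_integral_pow_mul_exp (hM₂ hw) 0)
    have d' : HasDerivAt (fun w => rootZetaError k (1 + w)) (R₁ (1 + w)) w := by
      have := (hR₁ (1 + w) (by simpa using hw)).comp_const_add 1 w
      exact this
    refine d.unique (d'.congr_of_eventuallyEq ?_)
    filter_upwards [hUo.mem_nhds hw] with u hu using e0 u hu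
  have e2 : (∫ v, ((-v : ℝ) : ℂ) ^ 2 * Complex.exp (z * ((-v : ℝ) : ℂ)) ∂M₁) -
        ∫ v, ((-v : ℝ) : ℂ) ^ 2 * Complex.exp (z * ((-v : ℝ) : ℂ)) ∂M₂ = R₂ (1 + z) := by
    have d := (hasDerivAt_integral_pow_mul_exp (hM₁ hz) 1).sub
      (hasDerivAt_integral_pow_mul_exp (hM₂ hz) 1)
    have d' : HasDerivAt (fun w => R₁ (1 + w)) (R₂ (1 + z)) z :=
      (hR₂ (1 + z) (by simpa using hz)).comp_const_add 1 z
    refine d.unique (d'.congr_of_eventuallyEq ?_)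
    filter_upwards [hUo.mem_nhds hz] with u hu using e1 u hu
  rw [e2]
  have := hb (1 + z) (by simpa using hz) (by simp; linarith)
  rwa [add_sub_cancel_left] at this

end

section

open MeasureTheory Set Filter Topology ProbabilityTheory
open scoped ENNReal FourierTransform

/-! ### A Tauberian theorem -/

/-- A smooth probability density on `[0, 1]` together with its Fourier inversion formula. -/
lemma exists_bump_fourier : ∃ (φ : ℝ → ℝ) (W : ℝ → ℂ) (B : ℝ), (∀ x, 0 ≤ φ x) ∧
    (∀ x, x ∉ Icc (0 : ℝ) 1 → φ x = 0) ∧ Continuous φ ∧ Integrable φ ∧ ∫ x, φ x = 1 ∧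
    (∀ x, φ x ≤ B) ∧ Continuous W ∧ Integrable W ∧ (∀ ξ, ‖W ξ‖ ≤ B) ∧
    ∀ x : ℝ, (φ x : ℂ) = ∫ ξ : ℝ, W ξ * Complex.exp (2 * Real.pi * ξ * x * Complex.I) := by
  let f : ContDiffBump (1 / 2 : ℝ) := ⟨1 / 4, 1 / 2, by norm_num, by norm_num⟩
  let φ : ℝ → ℝ := f.normed volume
  have hcs : HasCompactSupport fun x => ((φ x : ℝ) : ℂ) :=
    f.hasCompactSupport_normed.comp_left Complex.ofReal_zero
  have hsm : ContDiff ℝ (⊤ : ℕ∞) fun x => ((φ x : ℝ) : ℂ) :=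
    Complex.ofRealCLM.contDiff.comp f.contDiff_normed
  let S : SchwartzMap ℝ ℂ := hcs.toSchwartzMap hsm
  have hS : ∀ x, S x = φ x := fun x => rfl
  have hφc : Continuous φ := f.contDiff_normed (n := 0) |>.continuous
  obtain ⟨x₀, hx₀⟩ := hφc.exists_forall_ge_of_hasCompactSupport f.hasCompactSupport_normed
  obtain ⟨B, hB⟩ : ∃ B, ∀ ξ, ‖(𝓕 S) ξ‖ ≤ B := ⟨_, SchwartzMap.norm_le_seminorm ℝ (𝓕 S)⟩
  refine ⟨φ, fun ξ => (𝓕 S : SchwartzMap ℝ ℂ) ξ, max (φ x₀) B, f.nonneg_normed, fun x hx => ?_, hφc, f.integrable_normed,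
    f.integral_normed, fun x => le_max_of_le_left (hx₀ x), (𝓕 S).continuous, (𝓕 S).integrable,
    fun ξ => le_max_of_le_right (hB ξ), fun x => ?_⟩
  · by_contra h
    have : x ∈ Function.support (f.normed volume) := h
    rw [f.support_normed_eq, Real.ball_eq_Ioo] at this
    refine hx ⟨?_, ?_⟩
    · have := this.1; simp only [f] at this; linarith
    · have := this.2; simp only [f] at this; linarith
  · have h1 : (𝓕⁻ (𝓕 S)) x = S x := by rw [FourierTransform.fourierInv_fourier_eq]
    rw [← hS, ← h1, SchwartzMap.fourierInv_coe, Real.fourierInv_eq']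
    refine integral_congr_ae (Eventually.of_forall fun ξ => ?_)
    simp only [smul_eq_mul]
    rw [mul_comm]
    congr 2
    simp
    ring

lemma integrable_indicator_rpow_neg_half :
    Integrable fun ξ : ℝ => (Icc (-1 : ℝ) 1).indicator (fun ξ => |ξ| ^ (-(1 / 2) : ℝ)) ξ := by
  have h0 : IntegrableOn (fun ξ : ℝ => ξ ^ (-(1 / 2) : ℝ)) (Ioc 0 1) := by
    rw [← intervalIntegrable_iff_integrableOn_Ioc_of_le zero_le_one]
    exact intervalIntegral.intervalIntegrable_rpow' (by norm_num)
  have h1 : Integrable ((Ioc (0 : ℝ) 1).indicator fun ξ : ℝ => ξ ^ (-(1 / 2) : ℝ)) :=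
    (integrable_indicator_iff measurableSet_Ioc).2 h0
  refine (h1.add h1.comp_neg).congr ?_
  have hne : ∀ᵐ ξ : ℝ, ξ ≠ 0 := by simp [ae_iff]
  filter_upwards [hne] with ξ hξ
  rcases lt_or_gt_of_ne hξ with h | h
  · have : ¬ (0 < ξ) := by linarith
    by_cases h2 : -1 ≤ ξ
    · have : -ξ ≤ 1 := by linarith
      have : ξ ≤ 1 := by linarith
      simp [indicator, *, abs_of_neg]
    · have : ¬ -ξ ≤ 1 := by linarith
      simp [indicator, *]
  · have : ¬ (ξ < 0) := by linarith
    have : -1 ≤ ξ := by linarith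
    by_cases h2 : ξ ≤ 1
    · simp [indicator, *, abs_of_pos]
    · simp [indicator, *]

lemma integrable_norm_mul_rpow_neg_half {W : ℝ → ℂ} (hWc : Continuous W) (hW : Integrable W)
    {B : ℝ} (hB : ∀ ξ, ‖W ξ‖ ≤ B) : Integrable fun ξ : ℝ => ‖W ξ‖ * |ξ| ^ (-(1 / 2) : ℝ) := by
  refine ((integrable_indicator_rpow_neg_half.const_mul B).add hW.norm).mono'
    (hWc.norm.measurable.mul (by fun_prop)).aestronglyMeasurable
    (Eventually.of_forall fun ξ => ?_)
  rw [Real.norm_of_nonneg (by positivity)]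
  simp only [Pi.add_apply]
  by_cases h : ξ ∈ Icc (-1 : ℝ) 1
  · rw [indicator_of_mem h]
    have := mul_le_mul_of_nonneg_right (hB ξ) (by positivity : 0 ≤ |ξ| ^ (-(1 / 2) : ℝ))
    linarith [norm_nonneg (W ξ)]
  · rw [indicator_of_notMem h, mul_zero, zero_add]
    have h1 : 1 ≤ |ξ| := by
      by_contra hc
      exact h (abs_le.1 (not_le.1 hc).le)
    exact mul_le_of_le_one_right (norm_nonneg _) (Real.rpow_le_one_of_one_le_of_nonpos h1 (by norm_num))

/-- Mean value of `‖σ - 2πiξ/δ‖ ^ (-(1 + κ)) + ‖σ - 2πiξ/δ‖ ^ (-1/2)` against a bounded integrable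
function. -/
lemma exists_integral_mul_rpow_le {W : ℝ → ℂ} (hWc : Continuous W) (hW : Integrable W)
    {B : ℝ} (hB : ∀ ξ, ‖W ξ‖ ≤ B) {κ : ℝ} (hκ : 0 < κ) :
    ∃ C : ℝ, 0 < C ∧ ∀ σ δ : ℝ, 0 < σ → 0 < δ → ∃ g : ℝ → ℝ, Integrable g ∧
      (∀ ξ : ℝ, ξ ≠ 0 → ‖W ξ‖ * (‖(σ : ℂ) - (2 * Real.pi * ξ / δ : ℝ) * Complex.I‖ ^ (-(1 + κ)) +
        ‖(σ : ℂ) - (2 * Real.pi * ξ / δ : ℝ) * Complex.I‖ ^ (-(1 / 2) : ℝ)) ≤ g ξ) ∧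
      ∫ ξ, g ξ ≤ C * (δ * σ ^ (-κ) + δ ^ (1 / 2 : ℝ)) := by
  have hB0 : 0 ≤ B := (norm_nonneg _).trans (hB 0)
  have hI : Integrable fun x : ℝ => (1 + ‖x‖ ^ 2) ^ (-(1 + κ) / 2) :=
    integrable_rpow_neg_one_add_norm_sq (by simp [hκ])
  set I : ℝ := ∫ x : ℝ, (1 + ‖x‖ ^ 2) ^ (-(1 + κ) / 2) with hIdef
  have hI0 : 0 ≤ I := integral_nonneg fun x => by positivity
  have hJ := integrable_norm_mul_rpow_neg_half hWc hW hB
  set J : ℝ := ∫ ξ : ℝ, ‖W ξ‖ * |ξ| ^ (-(1 / 2) : ℝ) with hJdef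
  have hJ0 : 0 ≤ J := integral_nonneg fun x => by positivity
  have hpi := Real.pi_pos
  refine ⟨B * I + J + 1, by positivity, fun σ δ hσ hδ => ?_⟩
  set c : ℝ := 2 * Real.pi / (δ * σ) with hc
  have hc0 : 0 < c := by positivity
  -- For the singular term W is bounded by B, and the substitution cξ yields δ σ^{-κ}. For the other
  -- term |σ - 2πiξ/δ| ≥ |ξ|/δ extracts δ^{1/2}, and the decay of W gives convergence.
  refine ⟨fun ξ => B * σ ^ (-(1 + κ)) * (1 + ‖c * ξ‖ ^ 2) ^ (-(1 + κ) / 2) +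
    δ ^ (1 / 2 : ℝ) * (‖W ξ‖ * |ξ| ^ (-(1 / 2) : ℝ)),
    ((hI.comp_mul_left' hc0.ne').const_mul _).add (hJ.const_mul _), fun ξ hξ => ?_, ?_⟩
  · have hn : ‖(σ : ℂ) - (2 * Real.pi * ξ / δ : ℝ) * Complex.I‖ =
        Real.sqrt (σ ^ 2 + (2 * Real.pi * ξ / δ) ^ 2) := by
      have := Complex.norm_add_mul_I σ (-(2 * Real.pi * ξ / δ))
      rw [neg_sq] at this
      rw [← this]; push_cast; ring_nf
    rw [mul_add]
    refine add_le_add ?_ ?_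
    · have : ‖(σ : ℂ) - (2 * Real.pi * ξ / δ : ℝ) * Complex.I‖ ^ (-(1 + κ)) =
          σ ^ (-(1 + κ)) * (1 + ‖c * ξ‖ ^ 2) ^ (-(1 + κ) / 2) := by
        have e : σ ^ 2 + (2 * Real.pi * ξ / δ) ^ 2 = σ ^ 2 * (1 + ‖c * ξ‖ ^ 2) := by
          rw [Real.norm_eq_abs, sq_abs, hc]; field_simp
        rw [hn, e, Real.sqrt_mul (by positivity), Real.sqrt_sq hσ.le,
          Real.mul_rpow hσ.le (by positivity), Real.sqrt_eq_rpow, ← Real.rpow_mul (by positivity)]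
        congr 2; ring
      rw [this, ← mul_assoc]
      gcongr
      exact hB ξ
    · have hge : |ξ| / δ ≤ ‖(σ : ℂ) - (2 * Real.pi * ξ / δ : ℝ) * Complex.I‖ := by
        rw [hn]
        refine Real.le_sqrt_of_sq_le ?_
        have : (|ξ| / δ) ^ 2 = (ξ / δ) ^ 2 := by rw [div_pow, sq_abs, div_pow]
        rw [this]
        have h2 : (2 * Real.pi * ξ / δ) ^ 2 = (2 * Real.pi) ^ 2 * (ξ / δ) ^ 2 := by ring
        have h3 : 1 ≤ (2 * Real.pi) ^ 2 := by
          have := Real.pi_gt_three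
          nlinarith
        rw [h2]
        nlinarith [sq_nonneg (ξ / δ), sq_nonneg σ]
      have h0 : 0 < |ξ| / δ := by positivity
      have := Real.rpow_le_rpow_of_nonpos h0 hge (by norm_num : (-(1 / 2) : ℝ) ≤ 0)
      calc _ ≤ ‖W ξ‖ * (|ξ| / δ) ^ (-(1 / 2) : ℝ) := by gcongr
        _ = _ := by
          rw [Real.div_rpow (abs_nonneg _) hδ.le, Real.rpow_neg hδ.le, div_inv_eq_mul]; ring
  · rw [integral_add ((hI.comp_mul_left' hc0.ne').const_mul _) (hJ.const_mul _),
      integral_const_mul, integral_const_mul, ← hJdef,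
      Measure.integral_comp_mul_left (fun x : ℝ => (1 + ‖x‖ ^ 2) ^ (-(1 + κ) / 2)) c, ← hIdef,
      smul_eq_mul, abs_of_pos (inv_pos.2 hc0)]
    have e : B * σ ^ (-(1 + κ)) * (c⁻¹ * I) = B * I * (δ * σ ^ (-κ)) / (2 * Real.pi) := by
      rw [hc, neg_add, Real.rpow_add hσ, Real.rpow_neg_one]; field_simp
    rw [e]
    have h1 : B * I * (δ * σ ^ (-κ)) / (2 * Real.pi) ≤ B * I * (δ * σ ^ (-κ)) :=
      div_le_self (by positivity) (by linarith [Real.pi_gt_three])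
    have : 0 ≤ δ * σ ^ (-κ) := by positivity
    have : 0 ≤ δ ^ (1 / 2 : ℝ) := by positivity
    have := mul_nonneg hJ0 (by positivity : 0 ≤ δ * σ ^ (-κ))
    have := mul_nonneg (mul_nonneg hB0 hI0) (by positivity : 0 ≤ δ ^ (1 / 2 : ℝ))
    nlinarith

lemma integrable_sq_mul_exp {M : Measure ℝ}
    (hM : ∀ σ : ℝ, 0 < σ → Integrable (fun x => Real.exp (σ * -x)) M) {σ : ℝ} (hσ : 0 < σ) :
    Integrable (fun v : ℝ => v ^ 2 * Real.exp (-(σ * v))) M := by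
  have := integrable_pow_mul_exp_of_mem_interior_integrableExpSet
    (mem_interior_integrableExpSet hM hσ) 2
  simpa using this

/-- Smoothing against a bump function expressed through the Laplace transform. -/
lemma integral_bump_eq {M : Measure ℝ} [SFinite M]
    (hM : ∀ σ : ℝ, 0 < σ → Integrable (fun x => Real.exp (σ * -x)) M)
    {φ : ℝ → ℝ} {W : ℝ → ℂ} (hW : Integrable W)
    (hφ : ∀ x : ℝ, (φ x : ℂ) = ∫ ξ : ℝ, W ξ * Complex.exp (2 * Real.pi * ξ * x * Complex.I))
    {σ : ℝ} (hσ : 0 < σ) (δ y : ℝ) :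
    ((∫ v, v ^ 2 * Real.exp (-(σ * v)) * φ ((v - y) / δ) ∂M : ℝ) : ℂ) =
      ∫ ξ : ℝ, W ξ * Complex.exp (-(2 * Real.pi * ξ * y / δ * Complex.I)) *
        ∫ v, ((-v : ℝ) : ℂ) ^ 2 * Complex.exp
          (((σ : ℂ) - (2 * Real.pi * ξ / δ : ℝ) * Complex.I) * ((-v : ℝ) : ℂ)) ∂M := by
  set F : ℝ → ℝ → ℂ := fun v ξ => ((v ^ 2 * Real.exp (-(σ * v)) : ℝ) : ℂ) * (W ξ *
    Complex.exp (2 * Real.pi * ξ * ((v - y) / δ : ℝ) * Complex.I)) with hF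
  have hint : Integrable (Function.uncurry F) (M.prod volume) := by
    have h1 : Integrable (fun p : ℝ × ℝ => ((p.1 ^ 2 * Real.exp (-(σ * p.1)) : ℝ) : ℂ) * W p.2)
        (M.prod volume) := (integrable_sq_mul_exp hM hσ).ofReal.mul_prod hW
    have h2 := h1.mul_bdd (c := 1) (g := fun p : ℝ × ℝ =>
      Complex.exp (2 * Real.pi * p.2 * ((p.1 - y) / δ : ℝ) * Complex.I))
      (by fun_prop) (Eventually.of_forall fun p => ?_)
    · refine h2.congr (Eventually.of_forall fun p => ?_)
      simp only [Function.uncurry, hF]; ring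
    · have := Complex.norm_exp_ofReal_mul_I (2 * Real.pi * p.2 * ((p.1 - y) / δ))
      push_cast at this ⊢
      exact this.le
  rw [← integral_complex_ofReal]
  calc _ = ∫ v, ∫ ξ, F v ξ ∂volume ∂M := by
        refine integral_congr_ae (Eventually.of_forall fun v => ?_)
        simp only [hF]
        rw [integral_const_mul, ← hφ]
        push_cast; ring
    _ = ∫ ξ, ∫ v, F v ξ ∂M ∂volume := integral_integral_swap hint
    _ = _ := by
        refine integral_congr_ae (Eventually.of_forall fun ξ => ?_)
        simp only
        rw [← integral_const_mul]
        refine integral_congr_ae (Eventually.of_forall fun v => ?_)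
        simp only [hF]
        have e : Complex.exp (-(2 * Real.pi * ξ * y / δ * Complex.I)) * Complex.exp
            (((σ : ℂ) - (2 * Real.pi * ξ / δ : ℝ) * Complex.I) * ((-v : ℝ) : ℂ)) =
            Complex.exp (-(σ * v)) *
              Complex.exp (2 * Real.pi * ξ * ((v - y) / δ : ℝ) * Complex.I) := by
          rw [← Complex.exp_add, ← Complex.exp_add]
          congr 1
          push_cast
          ring
        push_cast at e ⊢
        linear_combination (-(W ξ * (v : ℂ) ^ 2)) * e

/-- Comparison of two smoothed measures whose Laplace transforms are close. -/
lemma exists_bump_bound {M₁ M₂ : Measure ℝ} [SFinite M₁] [SFinite M₂]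
    (hM₁ : ∀ σ : ℝ, 0 < σ → Integrable (fun x => Real.exp (σ * -x)) M₁)
    (hM₂ : ∀ σ : ℝ, 0 < σ → Integrable (fun x => Real.exp (σ * -x)) M₂)
    {κ : ℝ} (hκ : 0 < κ) {C : ℝ} (hC : 0 < C)
    (hb : ∀ z : ℂ, 0 < z.re → z.re ≤ 1 →
      ‖(∫ v, ((-v : ℝ) : ℂ) ^ 2 * Complex.exp (z * ((-v : ℝ) : ℂ)) ∂M₁) -
        ∫ v, ((-v : ℝ) : ℂ) ^ 2 * Complex.exp (z * ((-v : ℝ) : ℂ)) ∂M₂‖ ≤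
      C * (‖z‖ ^ (-(1 + κ)) + ‖z‖ ^ (-(1 / 2) : ℝ)))
    {φ : ℝ → ℝ} {W : ℝ → ℂ} (hWc : Continuous W) (hW : Integrable W)
    {B : ℝ} (hB : ∀ ξ, ‖W ξ‖ ≤ B)
    (hφ : ∀ x : ℝ, (φ x : ℂ) = ∫ ξ : ℝ, W ξ * Complex.exp (2 * Real.pi * ξ * x * Complex.I)) :
    ∃ D : ℝ, 0 < D ∧ ∀ σ δ y : ℝ, 0 < σ → σ ≤ 1 → 0 < δ →
      |(∫ v, v ^ 2 * Real.exp (-(σ * v)) * φ ((v - y) / δ) ∂M₁) -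
        ∫ v, v ^ 2 * Real.exp (-(σ * v)) * φ ((v - y) / δ) ∂M₂| ≤
      D * (δ * σ ^ (-κ) + δ ^ (1 / 2 : ℝ)) := by
  obtain ⟨D, hD, h⟩ := exists_integral_mul_rpow_le hWc hW hB hκ
  refine ⟨C * D, by positivity, fun σ δ y hσ hσ1 hδ => ?_⟩
  obtain ⟨g, hg, hle, hgD⟩ := h σ δ hσ hδ
  rw [← Real.norm_eq_abs, ← Complex.norm_real, Complex.ofReal_sub, integral_bump_eq hM₁ hW hφ hσ,
    integral_bump_eq hM₂ hW hφ hσ]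
  have hdom : ∀ M : Measure ℝ, SFinite M →
      (∀ σ : ℝ, 0 < σ → Integrable (fun x => Real.exp (σ * -x)) M) →
      Integrable fun ξ : ℝ => W ξ * Complex.exp (-(2 * Real.pi * ξ * y / δ * Complex.I)) *
        ∫ v, ((-v : ℝ) : ℂ) ^ 2 * Complex.exp
          (((σ : ℂ) - (2 * Real.pi * ξ / δ : ℝ) * Complex.I) * ((-v : ℝ) : ℂ)) ∂M := by
    intro M _ hM
    have hm : Measurable fun ξ : ℝ => ∫ v, ((-v : ℝ) : ℂ) ^ 2 * Complex.exp
          (((σ : ℂ) - (2 * Real.pi * ξ / δ : ℝ) * Complex.I) * ((-v : ℝ) : ℂ)) ∂M := by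
      refine (StronglyMeasurable.integral_prod_right' (f := fun p : ℝ × ℝ => ((-p.2 : ℝ) : ℂ) ^ 2 *
        Complex.exp (((σ : ℂ) - (2 * Real.pi * p.1 / δ : ℝ) * Complex.I) *
          ((-p.2 : ℝ) : ℂ))) ?_).measurable
      exact Continuous.stronglyMeasurable (by fun_prop)
    refine (hW.mul_bdd (c := 1) (g := fun ξ : ℝ =>
      Complex.exp (-(2 * Real.pi * ξ * y / δ * Complex.I))) (by fun_prop)
        (Eventually.of_forall fun ξ => ?_)).mul_bdd
      (c := ∫ v, v ^ 2 * Real.exp (-(σ * v)) ∂M) hm.aestronglyMeasurable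
      (Eventually.of_forall fun ξ => ?_)
    · have := Complex.norm_exp_ofReal_mul_I (-(2 * Real.pi * ξ * y / δ))
      push_cast at this
      rw [neg_mul] at this
      exact this.le
    · refine (norm_integral_le_integral_norm _).trans_eq ?_
      refine integral_congr_ae (Eventually.of_forall fun v => ?_)
      simp only [norm_mul, norm_pow, Complex.norm_real, Real.norm_eq_abs, sq_abs, Complex.norm_exp]
      congr 1
      · ring
      · congr 1; simp
  rw [← integral_sub (hdom M₁ ‹_› hM₁) (hdom M₂ ‹_› hM₂)]
  refine (norm_integral_le_of_norm_le (hg.const_mul C) ?_).trans ?_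
  · have hne : ∀ᵐ ξ : ℝ, ξ ≠ 0 := by simp [ae_iff]
    filter_upwards [hne] with ξ hξ
    rw [← mul_sub, norm_mul, norm_mul]
    have h1 : ‖Complex.exp (-(2 * Real.pi * ξ * y / δ * Complex.I))‖ = 1 := by
      have := Complex.norm_exp_ofReal_mul_I (-(2 * Real.pi * ξ * y / δ))
      push_cast at this
      rwa [neg_mul] at this
    rw [h1, mul_one]
    refine (mul_le_mul_of_nonneg_left (hb _ ?_ ?_) (norm_nonneg _)).trans ?_
    · simpa using hσ
    · simpa using hσ1
    · rw [mul_left_comm]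
      exact mul_le_mul_of_nonneg_left (hle ξ hξ) hC.le
  · rw [integral_const_mul, mul_assoc]
    gcongr

end

/-! ### Exponential means and their averages over windows -/

section

open MeasureTheory Set Filter Topology ProbabilityTheory
open scoped ENNReal FourierTransform

lemma expMeanENN_lt_top {θ : Measure ℝ} {σ : ℝ} (hσ : 0 < σ)
    (h : Integrable (fun x => Real.exp (σ * -x)) θ) (v : ℝ) : expMeanENN θ v < ∞ := by
  have h2 := (h.const_mul (Real.exp (σ * v))).lintegral_lt_top
  refine lt_of_le_of_lt ?_ h2
  refine (setLIntegral_mono' measurableSet_Iic fun x hx => ?_).trans (setLIntegral_le_lintegral _ _)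
  refine ENNReal.ofReal_le_ofReal ?_
  rw [← Real.exp_add]
  have hx : x ≤ v := hx
  refine Real.exp_le_exp.2 ?_
  nlinarith

/-- Multiplied by e^v, the exponential mean becomes the integral of e^x over x ≤ v, which is
nondecreasing in v. This is the one-sided regularity on which the Tauberian argument rests. -/
lemma expMeanENN_mono {θ : Measure ℝ} {y v : ℝ} (hyv : y ≤ v) :
    ENNReal.ofReal (Real.exp (y - v)) * expMeanENN θ y ≤ expMeanENN θ v := by
  rw [expMeanENN, expMeanENN, ← lintegral_const_mul _ (by fun_prop)]
  calc _ = ∫⁻ x in Iic y, ENNReal.ofReal (Real.exp (x - v)) ∂θ := by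
        refine lintegral_congr fun x => ?_
        rw [← ENNReal.ofReal_mul (Real.exp_pos _).le, ← Real.exp_add]
        congr 2; ring
    _ ≤ _ := lintegral_mono_set (Iic_subset_Iic.2 hyv)

lemma expMean_mono {θ : Measure ℝ} (h : ∀ v, expMeanENN θ v < ∞) {y v : ℝ} (hyv : y ≤ v) :
    Real.exp (y - v) * expMean θ y ≤ expMean θ v := by
  have := ENNReal.toReal_mono (h v).ne (expMeanENN_mono (θ := θ) hyv)
  rwa [ENNReal.toReal_mul, ENNReal.toReal_ofReal (Real.exp_pos _).le] at this

lemma expMeanENN_le_add {θ : Measure ℝ} {y v : ℝ} (hyv : y ≤ v) :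
    expMeanENN θ v ≤ expMeanENN θ y + θ (Ioc y v) := by
  have hd : Disjoint (Iic y) (Ioc y v) :=
    Set.disjoint_left.2 fun x (hx : x ≤ y) hx' => not_lt.2 hx hx'.1
  rw [expMeanENN, expMeanENN, ← Iic_union_Ioc_eq_Iic hyv, lintegral_union measurableSet_Ioc hd]
  refine add_le_add (lintegral_mono fun x => ENNReal.ofReal_le_ofReal ?_) ?_
  · exact Real.exp_le_exp.2 (by linarith)
  · rw [← setLIntegral_one]
    refine setLIntegral_mono' measurableSet_Ioc fun x hx => ?_
    rw [← ENNReal.ofReal_one]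
    exact ENNReal.ofReal_le_ofReal (Real.exp_le_one_iff.2 (by linarith [hx.2]))

lemma expMean_nonneg (θ : Measure ℝ) (v : ℝ) : 0 ≤ expMean θ v := ENNReal.toReal_nonneg

/-- On the window the kernel is at least e^{-1}. Bounds for exponential means thereby become bounds
for local masses. -/
lemma measure_Icc_le_expMeanENN (θ : Measure ℝ) (a : ℝ) :
    θ (Icc a (a + 1)) ≤ ENNReal.ofReal (Real.exp 1) * expMeanENN θ (a + 1) := by
  rw [expMeanENN, ← lintegral_const_mul _ (by fun_prop), ← setLIntegral_one]
  refine (setLIntegral_mono' measurableSet_Icc fun x hx => ?_).trans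
    (lintegral_mono_set Icc_subset_Iic_self)
  rw [← ENNReal.ofReal_mul (Real.exp_pos _).le, ← Real.exp_add, ← ENNReal.ofReal_one]
  exact ENNReal.ofReal_le_ofReal (Real.one_le_exp (by linarith [hx.1]))

lemma exp_neg_half_le {x : ℝ} (hx : 0 ≤ x) :
    Real.exp (-(x / 2)) ≤ 16 * (1 + x) ^ (-(3 / 2) : ℝ) := by
  have h1 : (1 + x) ^ (3 / 2 : ℝ) ≤ 16 * Real.exp (x / 2) := by
    calc (1 + x) ^ (3 / 2 : ℝ) ≤ (1 + x) ^ (2 : ℝ) :=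
          Real.rpow_le_rpow_of_exponent_le (by linarith) (by norm_num)
      _ = (1 + x) ^ 2 := by norm_cast
      _ ≤ 16 * (x / 4 + 1) ^ 2 := by nlinarith
      _ ≤ 16 * (Real.exp (x / 4)) ^ 2 := by gcongr; exact Real.add_one_le_exp _
      _ = 16 * Real.exp (x / 2) := by rw [← Real.exp_nat_mul]; congr 2; push_cast; ring
  rw [Real.exp_neg, Real.rpow_neg (by linarith), ← div_eq_mul_inv, inv_eq_one_div,
    div_le_div_iff₀ (Real.exp_pos _) (by positivity)]
  linarith

/-- Exponential averages of a tame measure. -/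
lemma TameMeasure.lintegral_exp_half_le {α C : ℝ} {θ : Measure ℝ} (h : TameMeasure α C θ)
    (hα : 0 < α) (hα1 : α ≤ 1) (hC : 0 ≤ C) {b : ℝ} (hb : 0 ≤ b) :
    ∫⁻ w in Iic b, ENNReal.ofReal (Real.exp (-((b - w) / 2))) ∂θ ≤
      ENNReal.ofReal (16 * (tameIntegralConst α * C * (1 + b) ^ (α - 1))) := by
  rw [ENNReal.ofReal_mul (by norm_num)]
  refine le_trans ?_ (mul_le_mul_right (h.lintegral_le hα hα1 hC hb) _)
  rw [← lintegral_const_mul _ (by fun_prop)]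
  refine setLIntegral_mono' measurableSet_Iic fun w hw => ?_
  rw [← ENNReal.ofReal_mul (by norm_num)]
  exact ENNReal.ofReal_le_ofReal (exp_neg_half_le (sub_nonneg.2 hw))

lemma TameMeasure.expMeanENN_le {α C : ℝ} {θ : Measure ℝ} (h : TameMeasure α C θ)
    (hα : 0 < α) (hα1 : α ≤ 1) (hC : 0 ≤ C) {b : ℝ} (hb : 0 ≤ b) :
    expMeanENN θ b ≤ ENNReal.ofReal (16 * (tameIntegralConst α * C * (1 + b) ^ (α - 1))) := by
  refine le_trans ?_ (h.lintegral_exp_half_le hα hα1 hC hb)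
  refine setLIntegral_mono' measurableSet_Iic fun w hw => ENNReal.ofReal_le_ofReal ?_
  have hw : w ≤ b := hw
  exact Real.exp_le_exp.2 (by linarith)

lemma TameMeasure.expMean_le {α C : ℝ} {θ : Measure ℝ} (h : TameMeasure α C θ)
    (hα : 0 < α) (hα1 : α ≤ 1) (hC : 0 ≤ C) {b : ℝ} (hb : 0 ≤ b) :
    expMean θ b ≤ 16 * (tameIntegralConst α * C * (1 + b) ^ (α - 1)) := by
  have h0 := (tameIntegralConst_pos hα).le
  exact ENNReal.toReal_le_of_le_ofReal (by positivity) (h.expMeanENN_le hα hα1 hC hb)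

lemma integral_conv_expMeasureOne {θ : Measure ℝ} [SFinite θ] (h : ∀ v, expMeanENN θ v < ∞)
    (f : ℝ → ℝ) : ∫ v, f v ∂(θ.conv expMeasureOne) = ∫ v, expMean θ v * f v := by
  rw [conv_expMeasureOne, integral_withDensity_eq_integral_toReal_smul (measurable_expMeanENN θ)
    (Eventually.of_forall h)]
  rfl

lemma integrable_conv_expMeasureOne {θ : Measure ℝ} [SFinite θ] (h : ∀ v, expMeanENN θ v < ∞)
    {f : ℝ → ℝ} (hf : Integrable f (θ.conv expMeasureOne)) :
    Integrable fun v => expMean θ v * f v := by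
  rw [conv_expMeasureOne, integrable_withDensity_iff_integrable_smul' (measurable_expMeanENN θ)
    (Eventually.of_forall h)] at hf
  exact hf

/-- If the exponential means of `θ₁` exceed those of `θ₂` by `E` on a window, then `E` is small. -/
lemma exists_window_bound {θ₁ θ₂ : Measure ℝ} [SFinite θ₁] [SFinite θ₂]
    (h₁ : ∀ σ : ℝ, 0 < σ → Integrable (fun x => Real.exp (σ * -x)) θ₁)
    (h₂ : ∀ σ : ℝ, 0 < σ → Integrable (fun x => Real.exp (σ * -x)) θ₂)
    {κ : ℝ} (hκ : 0 < κ) {C : ℝ} (hC : 0 < C)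
    (hb : ∀ z : ℂ, 0 < z.re → z.re ≤ 1 →
      ‖(∫ v, ((-v : ℝ) : ℂ) ^ 2 * Complex.exp (z * ((-v : ℝ) : ℂ)) ∂(θ₁.conv expMeasureOne)) -
        ∫ v, ((-v : ℝ) : ℂ) ^ 2 * Complex.exp (z * ((-v : ℝ) : ℂ)) ∂(θ₂.conv expMeasureOne)‖ ≤
      C * (‖z‖ ^ (-(1 + κ)) + ‖z‖ ^ (-(1 / 2) : ℝ))) :
    ∃ D : ℝ, 0 < D ∧ ∀ Y δ y E : ℝ, 1 ≤ Y → 0 < δ → Y / 2 ≤ y → y + δ ≤ 2 * Y →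
      ((∀ v ∈ Icc y (y + δ), E ≤ expMean θ₁ v - expMean θ₂ v) ∨
        (∀ v ∈ Icc y (y + δ), E ≤ expMean θ₂ v - expMean θ₁ v)) →
      E ≤ D * (Y ^ (κ - 2) + Y ^ (-2 : ℝ) * δ ^ (-(1 / 2) : ℝ)) := by
  have f₁ : ∀ v, expMeanENN θ₁ v < ∞ := expMeanENN_lt_top one_pos (h₁ 1 one_pos)
  have f₂ : ∀ v, expMeanENN θ₂ v < ∞ := expMeanENN_lt_top one_pos (h₂ 1 one_pos)
  obtain ⟨φ, W, B, φ0, φsupp, φc, φi, φ1, φB, Wc, Wi, WB, hφ⟩ := exists_bump_fourier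
  have g₁ : ∀ σ : ℝ, 0 < σ → Integrable (fun x => Real.exp (σ * -x)) (θ₁.conv expMeasureOne) :=
    fun σ hσ => integrable_exp_conv hσ (h₁ σ hσ)
  have g₂ : ∀ σ : ℝ, 0 < σ → Integrable (fun x => Real.exp (σ * -x)) (θ₂.conv expMeasureOne) :=
    fun σ hσ => integrable_exp_conv hσ (h₂ σ hσ)
  obtain ⟨D, hD, hDb⟩ := exists_bump_bound g₁ g₂ hκ hC hb Wc Wi WB hφ
  refine ⟨32 * D, by positivity, fun Y δ y E hY hδ hy hyδ hE => ?_⟩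
  have hY0 : 0 < Y := by linarith
  rcases lt_or_ge E 0 with hE0 | hE0
  · exact hE0.le.trans (by positivity)
  -- With this choice v² e^{-σv} is at least Y²/32 for v between Y/2 and 2Y, so the Laplace weight
  -- costs only a constant.
  set σ : ℝ := Y⁻¹
  have hσ : 0 < σ := inv_pos.2 hY0
  set f : ℝ → ℝ := fun v => v ^ 2 * Real.exp (-(σ * v)) * φ ((v - y) / δ) with hf
  have key := hDb σ δ y hσ (inv_le_one_of_one_le₀ hY) hδ
  have fi : ∀ {θ : Measure ℝ} [SFinite θ], (∀ v, expMeanENN θ v < ∞) →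
      (∀ σ : ℝ, 0 < σ → Integrable (fun x => Real.exp (σ * -x)) (θ.conv expMeasureOne)) →
      Integrable fun v => expMean θ v * f v := fun hθ hθ' =>
    integrable_conv_expMeasureOne hθ ((integrable_sq_mul_exp hθ' hσ).mul_bdd (c := B)
      (φc.measurable.comp (by fun_prop)).aestronglyMeasurable (Eventually.of_forall fun v => by
        rw [Real.norm_of_nonneg (φ0 _)]; exact φB _))
  change |(∫ v, f v ∂_) - ∫ v, f v ∂_| ≤ _ at key
  rw [integral_conv_expMeasureOne f₁, integral_conv_expMeasureOne f₂,
    ← integral_sub (fi f₁ g₁) (fi f₂ g₂)] at key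
  have hφδ : Integrable fun v => φ ((v - y) / δ) :=
    (φi.comp_div hδ.ne').comp_sub_right y
  have hφint : ∫ v, φ ((v - y) / δ) = δ := by
    rw [integral_sub_right_eq_self (fun v => φ (v / δ)) y, Measure.integral_comp_div, φ1,
      smul_eq_mul, mul_one, abs_of_pos hδ]
  have hc : ∀ v ∈ Icc y (y + δ), Y ^ 2 / 32 ≤ v ^ 2 * Real.exp (-(σ * v)) := by
    intro v hv
    have h1 : Y / 2 ≤ v := hy.trans hv.1
    have h2 : σ * v ≤ 2 := by
      have : v ≤ 2 * Y := hv.2.trans hyδ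
      calc σ * v ≤ σ * (2 * Y) := by gcongr
        _ = 2 := by simp only [σ]; field_simp
    have h3 : (1 / 8 : ℝ) ≤ Real.exp (-(σ * v)) := by
      calc (1 / 8 : ℝ) ≤ Real.exp (-2) := by
            rw [Real.exp_neg, one_div]
            refine inv_anti₀ (Real.exp_pos _) ?_
            have : Real.exp 2 = Real.exp 1 ^ 2 := by rw [← Real.exp_nat_mul]; norm_num
            rw [this]
            have := Real.exp_one_lt_d9
            have := Real.exp_pos 1
            nlinarith
        _ ≤ _ := Real.exp_le_exp.2 (by linarith)
    calc Y ^ 2 / 32 = (Y / 2) ^ 2 * (1 / 8) := by ring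
      _ ≤ _ := by gcongr
  have hwin : ∀ d : ℝ → ℝ, (∀ v ∈ Icc y (y + δ), E ≤ d v) →
      ∀ v, E * (Y ^ 2 / 32) * φ ((v - y) / δ) ≤ d v * f v := by
    intro d hd v
    by_cases hv : v ∈ Icc y (y + δ)
    · rw [hf]
      simp only
      rw [← mul_assoc]
      have h1 := hc v hv
      have h2 := hd v hv
      have : 0 ≤ v ^ 2 * Real.exp (-(σ * v)) := by positivity
      have : E * (Y ^ 2 / 32) ≤ d v * (v ^ 2 * Real.exp (-(σ * v))) :=
        mul_le_mul h2 h1 (by positivity) (hE0.trans h2)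
      exact mul_le_mul_of_nonneg_right this (φ0 _)
    · have : φ ((v - y) / δ) = 0 := by
        refine φsupp _ fun hmem => hv ⟨?_, ?_⟩
        · have := mul_nonneg hmem.1 hδ.le
          rw [div_mul_cancel₀ _ hδ.ne'] at this; linarith
        · have := (div_le_iff₀ hδ).1 hmem.2; linarith
      simp [hf, this]
  have hmain : E * (Y ^ 2 / 32) * δ ≤ D * (δ * σ ^ (-κ) + δ ^ (1 / 2 : ℝ)) := by
    refine le_trans ?_ key
    rw [← hφint, ← integral_const_mul]
    rcases hE with hE | hE
    · refine le_trans ?_ (le_abs_self _)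
      refine integral_mono (hφδ.const_mul _) ((fi f₁ g₁).sub (fi f₂ g₂)) fun v => ?_
      have := hwin _ hE v
      simp only
      linarith
    · refine le_trans ?_ (neg_le_abs _)
      rw [← integral_neg]
      refine integral_mono (hφδ.const_mul _) ((fi f₁ g₁).sub (fi f₂ g₂)).neg fun v => ?_
      have := hwin _ hE v
      simp only
      linarith
  have e1 : δ * σ ^ (-κ) + δ ^ (1 / 2 : ℝ) = (Y ^ 2 * δ) *
      (Y ^ (κ - 2) + Y ^ (-2 : ℝ) * δ ^ (-(1 / 2) : ℝ)) := by
    have a1 : σ ^ (-κ) = Y ^ 2 * Y ^ (κ - 2) := by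
      rw [Real.inv_rpow hY0.le, Real.rpow_neg hY0.le, inv_inv, ← Real.rpow_natCast Y 2,
        ← Real.rpow_add hY0]
      congr 1; push_cast; ring
    have a2 : Y ^ 2 * Y ^ (-2 : ℝ) = 1 := by
      rw [← Real.rpow_natCast Y 2, ← Real.rpow_add hY0]; norm_num
    have a3 : δ ^ (1 / 2 : ℝ) = δ * δ ^ (-(1 / 2) : ℝ) := by
      conv_rhs => rw [← Real.rpow_one δ, Real.rpow_one δ]
      nth_rewrite 2 [← Real.rpow_one δ]
      rw [← Real.rpow_add hδ]; norm_num
    rw [a1, a3]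
    linear_combination (-(δ * δ ^ (-(1 / 2) : ℝ))) * a2
  rw [e1] at hmain
  have hpos : 0 < Y ^ 2 * δ := by positivity
  have : (Y ^ 2 * δ) * E ≤ (Y ^ 2 * δ) *
      (32 * D * (Y ^ (κ - 2) + Y ^ (-2 : ℝ) * δ ^ (-(1 / 2) : ℝ))) := by linarith
  exact le_of_mul_le_mul_left this hpos

end

/-! ### From window averages to pointwise bounds -/

section

open MeasureTheory Set Filter Topology ProbabilityTheory
open scoped ENNReal

lemma one_add_rpow_ge {a Y : ℝ} (ha : -2 ≤ a) (ha0 : a ≤ 0) (hY : 1 ≤ Y) :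
    Y ^ a ≤ 4 * (1 + Y) ^ a := by
  have hY0 : 0 < Y := by linarith
  have h1 : (2 * Y) ^ a ≤ (1 + Y) ^ a :=
    Real.rpow_le_rpow_of_nonpos (by linarith) (by linarith) ha0
  rw [Real.mul_rpow (by norm_num) hY0.le] at h1
  have h2 : (1 / 4 : ℝ) ≤ 2 ^ a := by
    calc (1 / 4 : ℝ) = 2 ^ (-2 : ℝ) := by
          rw [Real.rpow_neg (by norm_num)]; norm_num
      _ ≤ _ := Real.rpow_le_rpow_of_exponent_le (by norm_num) ha
  have h3 : 0 < Y ^ a := Real.rpow_pos_of_pos hY0 a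
  nlinarith

lemma expMean_le_add {θ : Measure ℝ} (h : ∀ v, expMeanENN θ v < ∞) {y v D : ℝ} (hD : 0 ≤ D)
    (hyv : y ≤ v) (hθ : θ (Ioc y v) ≤ ENNReal.ofReal D) :
    expMean θ v ≤ expMean θ y + D := by
  have := (expMeanENN_le_add (θ := θ) hyv).trans (add_le_add le_rfl hθ)
  have := ENNReal.toReal_mono (ENNReal.add_ne_top.2 ⟨(h y).ne, ENNReal.ofReal_ne_top⟩) this
  rwa [ENNReal.toReal_add (h y).ne ENNReal.ofReal_ne_top, ENNReal.toReal_ofReal hD] at this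

set_option maxHeartbeats 1000000 in
/-- A Tauberian theorem: if the Laplace transforms of the exponential means of `θ₁` and `θ₂` are
close and `θ₂` is regular of exponent `κ`, then `θ₁` is tame and its exponential means are close to
those of `θ₂`. -/
theorem exists_tame_and_expMean_sub_le {θ₁ θ₂ : Measure ℝ} [SFinite θ₁] [SFinite θ₂]
    (h₁ : ∀ σ : ℝ, 0 < σ → Integrable (fun x => Real.exp (σ * -x)) θ₁)
    (h₂ : ∀ σ : ℝ, 0 < σ → Integrable (fun x => Real.exp (σ * -x)) θ₂)
    {κ : ℝ} (hκ : 0 < κ) (hκ2 : κ ≤ 1 / 2) {C : ℝ} (hC : 0 < C)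
    (hb : ∀ z : ℂ, 0 < z.re → z.re ≤ 1 →
      ‖(∫ v, ((-v : ℝ) : ℂ) ^ 2 * Complex.exp (z * ((-v : ℝ) : ℂ)) ∂(θ₁.conv expMeasureOne)) -
        ∫ v, ((-v : ℝ) : ℂ) ^ 2 * Complex.exp (z * ((-v : ℝ) : ℂ)) ∂(θ₂.conv expMeasureOne)‖ ≤
      C * (‖z‖ ^ (-(1 + κ)) + ‖z‖ ^ (-(1 / 2) : ℝ)))
    (hnull : θ₁ (Iio 0) = 0) {A : ℝ} (hA : 0 ≤ A) (htame : TameMeasure κ A θ₂)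
    (hincr : ∀ y v : ℝ, 1 ≤ y → y ≤ v → θ₂ (Ioc y v) ≤ ENNReal.ofReal (A * (v - y) * y ^ (κ - 1))) :
    ∃ K : ℝ, 0 < K ∧ TameMeasure κ K θ₁ ∧
      ∀ y, 0 ≤ y → |expMean θ₁ y - expMean θ₂ y| ≤ K * (1 + y) ^ (-(3 / 2) : ℝ) := by
  have f₁ : ∀ v, expMeanENN θ₁ v < ∞ := expMeanENN_lt_top one_pos (h₁ 1 one_pos)
  have f₂ : ∀ v, expMeanENN θ₂ v < ∞ := expMeanENN_lt_top one_pos (h₂ 1 one_pos)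
  obtain ⟨D, hD, hwin⟩ := exists_window_bound h₁ h₂ hκ hC hb
  set B : ℝ := 16 * (tameIntegralConst κ * A) with hBdef
  have hB : 0 ≤ B := by have := tameIntegralConst_pos hκ; positivity
  have hm : ∀ v, 0 ≤ v → expMean θ₂ v ≤ B * (1 + v) ^ (κ - 1) := fun v hv =>
    (htame.expMean_le hκ (by linarith) hA hv).trans_eq (by rw [hBdef]; ring)
  have he1 : Real.exp 1 ≤ 3 := by linarith [Real.exp_one_lt_d9]
  -- the crude upper bound
  have hup : ∀ Y : ℝ, 1 ≤ Y → expMean θ₁ Y ≤ 3 * (B + 2 * D) * Y ^ (κ - 1) := by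
    intro Y hY
    have hY0 : 0 < Y := by linarith
    -- A window of width 1 already gives the right order of magnitude: by monotonicity the first
    -- mean stays above e^{-1} times its value at Y there.
    have h := hwin Y 1 Y (Real.exp (-1) * expMean θ₁ Y - B * Y ^ (κ - 1)) hY one_pos (by linarith)
      (by linarith) (Or.inl fun v hv => ?_)
    · rw [Real.one_rpow, mul_one] at h
      have e1 : Y ^ (κ - 2) ≤ Y ^ (κ - 1) := Real.rpow_le_rpow_of_exponent_le hY (by linarith)
      have e2 : Y ^ (-2 : ℝ) ≤ Y ^ (κ - 1) := Real.rpow_le_rpow_of_exponent_le hY (by linarith)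
      have e3 : D * (Y ^ (κ - 2) + Y ^ (-2 : ℝ)) ≤ D * (Y ^ (κ - 1) + Y ^ (κ - 1)) := by gcongr
      have e4 : Real.exp (-1) * expMean θ₁ Y ≤ (B + 2 * D) * Y ^ (κ - 1) := by linarith
      have e5 : expMean θ₁ Y = Real.exp 1 * (Real.exp (-1) * expMean θ₁ Y) := by
        rw [← mul_assoc, ← Real.exp_add]; simp
      rw [e5]
      calc _ ≤ Real.exp 1 * ((B + 2 * D) * Y ^ (κ - 1)) := by gcongr
        _ ≤ 3 * ((B + 2 * D) * Y ^ (κ - 1)) := by gcongr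
        _ = _ := by ring
    · have e1 : expMean θ₂ v ≤ B * Y ^ (κ - 1) := by
        refine (hm v (by linarith [hv.1])).trans ?_
        gcongr ?_ * ?_
        exact Real.rpow_le_rpow_of_nonpos hY0 (by linarith [hv.1]) (by linarith)
      have e2 : Real.exp (-1) * expMean θ₁ Y ≤ expMean θ₁ v := by
        refine le_trans ?_ (expMean_mono f₁ hv.1)
        have := expMean_nonneg θ₁ Y
        gcongr
        linarith [hv.2]
      linarith
  set K₁ : ℝ := 36 * (B + 2 * D) with hK₁
  have hK₁0 : 0 < K₁ := by positivity
  have hup' : ∀ y : ℝ, 0 ≤ y → expMean θ₁ y ≤ K₁ * (1 + y) ^ (κ - 1) := by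
    intro y hy
    have hBD : 0 ≤ 3 * (B + 2 * D) := by positivity
    rcases le_total 1 y with h | h
    · refine (hup y h).trans ?_
      have e := mul_le_mul_of_nonneg_left
        (one_add_rpow_ge (by linarith : -2 ≤ κ - 1) (by linarith) h) hBD
      refine e.trans ?_
      have : 0 ≤ (1 + y) ^ (κ - 1) := by positivity
      nlinarith
    · have e1 := (expMean_mono f₁ h).trans (hup 1 le_rfl)
      rw [Real.one_rpow, mul_one] at e1
      have e2 : Real.exp (-1) * expMean θ₁ y ≤ 3 * (B + 2 * D) := by
        refine le_trans ?_ e1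
        have := expMean_nonneg θ₁ y
        gcongr
        linarith
      have e3 : expMean θ₁ y = Real.exp 1 * (Real.exp (-1) * expMean θ₁ y) := by
        rw [← mul_assoc, ← Real.exp_add]; simp
      have e4 : (1 / 4 : ℝ) ≤ (1 + y) ^ (κ - 1) := by
        have := one_add_rpow_ge (by linarith : -2 ≤ κ - 1) (by linarith) (le_refl (1 : ℝ))
        rw [Real.one_rpow] at this
        have h2 : (1 + 1 : ℝ) ^ (κ - 1) ≤ (1 + y) ^ (κ - 1) :=
          Real.rpow_le_rpow_of_nonpos (by linarith) (by linarith) (by linarith)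
        linarith
      have e5 : 0 ≤ Real.exp (-1) * expMean θ₁ y :=
        mul_nonneg (Real.exp_pos _).le (expMean_nonneg θ₁ y)
      rw [e3]
      calc _ ≤ 3 * (3 * (B + 2 * D)) := by gcongr
        _ = K₁ * (1 / 4) := by rw [hK₁]; ring
        _ ≤ _ := by gcongr
  have htame₁ : TameMeasure κ (3 * K₁) θ₁ := by
    refine ⟨hnull, fun a ha => (measure_Icc_le_expMeanENN θ₁ a).trans ?_⟩
    rw [← ENNReal.ofReal_toReal (f₁ (a + 1)).ne, ← ENNReal.ofReal_mul (Real.exp_pos _).le]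
    refine ENNReal.ofReal_le_ofReal ?_
    change Real.exp 1 * expMean θ₁ (a + 1) ≤ _
    have e : (1 + (a + 1)) ^ (κ - 1) ≤ (1 + a) ^ (κ - 1) :=
      Real.rpow_le_rpow_of_nonpos (by linarith) (by linarith) (by linarith)
    calc _ ≤ 3 * (K₁ * (1 + (a + 1)) ^ (κ - 1)) := by
          have := expMean_nonneg θ₁ (a + 1)
          gcongr
          exact hup' _ (by linarith)
      _ ≤ 3 * (K₁ * (1 + a) ^ (κ - 1)) := by gcongr
      _ = _ := by ring
  -- the asymptotic bound
  set K₂ : ℝ := 8 * K₁ + 4 * A + 2 * D with hK₂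
  have hK₂0 : 0 < K₂ := by positivity
  -- The window now has width Y^{-1}. Its Fourier error is Y^{-2} (Y^{-1})^{-1/2} = Y^{-3/2}, and
  -- the relevant one-sided variation of the means across it is O(Y^{κ-2}), which is no larger
  -- because κ ≤ 1/2.
  have hfine : ∀ Y : ℝ, 2 ≤ Y → |expMean θ₁ Y - expMean θ₂ Y| ≤ K₂ * Y ^ (-(3 / 2) : ℝ) := by
    intro Y hY
    have hY0 : 0 < Y := by linarith
    have hYi : Y⁻¹ ≤ 1 / 2 := by
      rw [inv_eq_one_div]; exact one_div_le_one_div_of_le (by norm_num) hY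
    have hYi0 : 0 < Y⁻¹ := inv_pos.2 hY0
    have hpow : Y⁻¹ * Y ^ (κ - 1) = Y ^ (κ - 2) := by
      rw [← Real.rpow_neg_one, ← Real.rpow_add hY0]; congr 1; ring
    have hpow2 : Y ^ (-2 : ℝ) * Y⁻¹ ^ (-(1 / 2) : ℝ) = Y ^ (-(3 / 2) : ℝ) := by
      rw [← Real.rpow_neg_one, ← Real.rpow_mul hY0.le, ← Real.rpow_add hY0]; norm_num
    have hle : Y ^ (κ - 2) ≤ Y ^ (-(3 / 2) : ℝ) :=
      Real.rpow_le_rpow_of_exponent_le (by linarith) (by linarith)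
    have hp0 : 0 < Y ^ (κ - 2) := Real.rpow_pos_of_pos hY0 _
    have ht : Y⁻¹ * expMean θ₁ Y ≤ K₁ * Y ^ (κ - 2) := by
      have e : (1 + Y) ^ (κ - 1) ≤ Y ^ (κ - 1) :=
        Real.rpow_le_rpow_of_nonpos hY0 (by linarith) (by linarith)
      calc Y⁻¹ * expMean θ₁ Y ≤ Y⁻¹ * (K₁ * (1 + Y) ^ (κ - 1)) := by gcongr; exact hup' Y hY0.le
        _ ≤ Y⁻¹ * (K₁ * Y ^ (κ - 1)) := by gcongr
        _ = _ := by rw [← hpow]; ring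
    have ht0 := expMean_nonneg θ₁ Y
    rw [abs_le]
    constructor
    -- If the first mean is too small at Y, monotonicity keeps it small to the left, so the window
    -- ends at Y.
    · have h := hwin Y Y⁻¹ (Y - Y⁻¹) (expMean θ₂ Y - expMean θ₁ Y - (2 * K₁ + 4 * A) * Y ^ (κ - 2))
        (by linarith) hYi0 (by linarith) (by linarith) (Or.inr fun v hv => ?_)
      · rw [hpow2] at h
        have : D * (Y ^ (κ - 2) + Y ^ (-(3 / 2) : ℝ)) ≤
          D * (Y ^ (-(3 / 2) : ℝ) + Y ^ (-(3 / 2) : ℝ)) := by gcongr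
        have : (2 * K₁ + 4 * A) * Y ^ (κ - 2) ≤ (2 * K₁ + 4 * A) * Y ^ (-(3 / 2) : ℝ) := by gcongr
        have : 0 ≤ K₁ * Y ^ (-(3 / 2) : ℝ) := by positivity
        rw [hK₂]
        nlinarith
      · have hv1 : Y - Y⁻¹ ≤ v := hv.1
        have hv2 : v ≤ Y := by linarith [hv.2]
        have hv0 : Y / 2 ≤ v := by linarith
        have hvpos : 0 < v := by linarith
        have hvp : v ^ (κ - 1) ≤ 4 * Y ^ (κ - 1) := by
          have e1 : v ^ (κ - 1) ≤ (Y / 2) ^ (κ - 1) :=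
            Real.rpow_le_rpow_of_nonpos (by linarith) hv0 (by linarith)
          have e4 : (Y / 2) ^ (κ - 1) = Y ^ (κ - 1) * 2 ^ (1 - κ) := by
            rw [Real.div_rpow hY0.le (by norm_num), div_eq_mul_inv, ← Real.rpow_neg (by norm_num)]
            congr 2; ring
          have e5 : (2 : ℝ) ^ (1 - κ) ≤ 4 := by
            calc (2 : ℝ) ^ (1 - κ) ≤ 2 ^ (1 : ℝ) :=
                  Real.rpow_le_rpow_of_exponent_le (by norm_num) (by linarith)
              _ ≤ 4 := by norm_num
          rw [e4] at e1
          have : 0 ≤ Y ^ (κ - 1) := by positivity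
          nlinarith
        have m1 : expMean θ₂ Y ≤ expMean θ₂ v + 4 * A * Y ^ (κ - 2) := by
          refine expMean_le_add f₂ (by positivity) hv2 ((hincr v Y (by linarith) hv2).trans
            (ENNReal.ofReal_le_ofReal ?_))
          rw [← hpow]
          calc A * (Y - v) * v ^ (κ - 1) ≤ A * Y⁻¹ * (4 * Y ^ (κ - 1)) := by
                gcongr
                linarith
            _ = _ := by ring
        have m2 : expMean θ₁ v ≤ expMean θ₁ Y + 2 * (Y⁻¹ * expMean θ₁ Y) := by
          have e1 := expMean_mono f₁ hv2
          have e2 : expMean θ₁ v ≤ Real.exp (Y - v) * expMean θ₁ Y := by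
            have := mul_le_mul_of_nonneg_left e1 (Real.exp_pos (Y - v)).le
            rwa [← mul_assoc, ← Real.exp_add, show Y - v + (v - Y) = 0 by ring, Real.exp_zero,
              one_mul] at this
          have e3 : Real.exp (Y - v) ≤ 1 + 2 * Y⁻¹ := by
            have hx : Y - v ≤ Y⁻¹ := by linarith
            have := Real.abs_exp_sub_one_le (x := Y - v)
              (by rw [abs_of_nonneg (by linarith)]; linarith)
            rw [abs_of_nonneg (a := Y - v) (by linarith)] at this
            have := le_abs_self (Real.exp (Y - v) - 1)
            linarith
          nlinarith
        linarith
    -- If the first mean is too large at Y, it stays large to the right, so the window starts at Y.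
    · have h := hwin Y Y⁻¹ Y (expMean θ₁ Y - expMean θ₂ Y - (K₁ + A) * Y ^ (κ - 2))
        (by linarith) hYi0 (by linarith) (by linarith) (Or.inl fun v hv => ?_)
      · rw [hpow2] at h
        have : D * (Y ^ (κ - 2) + Y ^ (-(3 / 2) : ℝ)) ≤
          D * (Y ^ (-(3 / 2) : ℝ) + Y ^ (-(3 / 2) : ℝ)) := by gcongr
        have : (K₁ + A) * Y ^ (κ - 2) ≤ (K₁ + A) * Y ^ (-(3 / 2) : ℝ) := by gcongr
        have : 0 ≤ K₁ * Y ^ (-(3 / 2) : ℝ) := by positivity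
        have : 0 ≤ A * Y ^ (-(3 / 2) : ℝ) := by positivity
        rw [hK₂]
        nlinarith
      · have m1 : expMean θ₂ v ≤ expMean θ₂ Y + A * Y ^ (κ - 2) := by
          refine expMean_le_add f₂ (by positivity) hv.1 ((hincr Y v (by linarith) hv.1).trans
            (ENNReal.ofReal_le_ofReal ?_))
          rw [← hpow]
          calc A * (v - Y) * Y ^ (κ - 1) ≤ A * Y⁻¹ * Y ^ (κ - 1) := by
                gcongr
                linarith [hv.2]
            _ = _ := by ring
        have m2 : expMean θ₁ Y - Y⁻¹ * expMean θ₁ Y ≤ expMean θ₁ v := by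
          refine le_trans ?_ (expMean_mono f₁ hv.1)
          have := Real.add_one_le_exp (Y - v)
          have : 1 - Y⁻¹ ≤ Real.exp (Y - v) := by linarith [hv.2]
          nlinarith
        linarith
  refine ⟨3 * K₁ + 4 * K₂ + 8 * (K₁ + B), by positivity, htame₁.mono_const (by nlinarith),
    fun y hy => ?_⟩
  have hp : 0 < (1 + y) ^ (-(3 / 2) : ℝ) := by positivity
  rcases le_total 2 y with h | h
  · refine (hfine y h).trans ?_
    have e := mul_le_mul_of_nonneg_left (one_add_rpow_ge (by norm_num : (-2 : ℝ) ≤ -(3 / 2))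
      (by norm_num) (by linarith : 1 ≤ y)) hK₂0.le
    have : 0 ≤ K₁ * (1 + y) ^ (-(3 / 2) : ℝ) := by positivity
    have : 0 ≤ B * (1 + y) ^ (-(3 / 2) : ℝ) := by positivity
    nlinarith
  · have e1 : ∀ a : ℝ, a ≤ 0 → (1 + y) ^ a ≤ 1 := fun a ha =>
      Real.rpow_le_one_of_one_le_of_nonpos (by linarith) ha
    have t1 : expMean θ₁ y ≤ K₁ :=
      (hup' y hy).trans (mul_le_of_le_one_right hK₁0.le (e1 _ (by linarith)))
    have t2 : expMean θ₂ y ≤ B := (hm y hy).trans (mul_le_of_le_one_right hB (e1 _ (by linarith)))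
    have e2 : (1 / 8 : ℝ) ≤ (1 + y) ^ (-(3 / 2) : ℝ) := by
      calc (1 / 8 : ℝ) = 4 ^ (-(3 / 2) : ℝ) := by
            rw [show (4 : ℝ) = 2 ^ (2 : ℝ) by norm_num, ← Real.rpow_mul (by norm_num)]
            norm_num [Real.rpow_neg]
        _ ≤ _ := Real.rpow_le_rpow_of_nonpos (by linarith) (by linarith) (by norm_num)
    have e3 : |expMean θ₁ y - expMean θ₂ y| ≤ K₁ + B := by
      rw [abs_le]
      constructor <;> linarith [expMean_nonneg θ₁ y, expMean_nonneg θ₂ y]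
    have e4 : K₁ + B ≤ 8 * (K₁ + B) * (1 + y) ^ (-(3 / 2) : ℝ) := by nlinarith
    have : 0 ≤ K₁ * (1 + y) ^ (-(3 / 2) : ℝ) := by positivity
    have : 0 ≤ K₂ * (1 + y) ^ (-(3 / 2) : ℝ) := by positivity
    nlinarith

end

section

open MeasureTheory Set Filter Topology ProbabilityTheory
open scoped ENNReal

/-! ### The measure with density `v ^ (κ - 1) / Γ(κ)` -/

lemma setLIntegral_rpowMeasure {κ : ℝ} {s : Set ℝ} (hs : MeasurableSet s) {f : ℝ → ℝ≥0∞}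
    (hf : Measurable f) :
    ∫⁻ v in s, f v ∂(rpowMeasure κ) =
      ∫⁻ v in s ∩ Ioi 0, ENNReal.ofReal (rpowDensity κ v) * f v := by
  rw [rpowMeasure, restrict_withDensity hs, lintegral_withDensity_eq_lintegral_mul _
    (measurable_rpowDensity κ).ennreal_ofReal hf, Measure.restrict_restrict hs]
  rfl

lemma rpowMeasure_apply {κ : ℝ} {s : Set ℝ} (hs : MeasurableSet s) :
    rpowMeasure κ s = ∫⁻ v in s ∩ Ioi 0, ENNReal.ofReal (rpowDensity κ v) := by
  rw [← setLIntegral_one, setLIntegral_rpowMeasure hs measurable_const]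
  simp

lemma rpowMeasure_null (κ : ℝ) : rpowMeasure κ (Iio 0) = 0 := by
  rw [rpowMeasure_apply measurableSet_Iio]
  have : Iio (0 : ℝ) ∩ Ioi 0 = ∅ := by ext x; simp; intro h; linarith
  simp [this]

lemma rpowDensity_anti {κ : ℝ} (hκ : 0 < κ) (hκ1 : κ ≤ 1) {y v : ℝ} (hy : 0 < y) (hyv : y ≤ v) :
    rpowDensity κ v ≤ rpowDensity κ y := by
  have := Real.Gamma_pos_of_pos hκ
  unfold rpowDensity
  gcongr ?_ / _
  exact Real.rpow_le_rpow_of_nonpos hy hyv (by linarith)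

lemma rpowMeasure_Icc_le {κ : ℝ} (hκ : 0 < κ) (hκ1 : κ ≤ 1) {y v : ℝ} (hy : 0 < y) :
    rpowMeasure κ (Icc y v) ≤ ENNReal.ofReal ((Real.Gamma κ)⁻¹ * (v - y) * y ^ (κ - 1)) := by
  rw [rpowMeasure_apply measurableSet_Icc]
  calc _ ≤ ∫⁻ x in Icc y v ∩ Ioi 0, ENNReal.ofReal (rpowDensity κ y) :=
        setLIntegral_mono' (measurableSet_Icc.inter measurableSet_Ioi) fun x hx =>
          ENNReal.ofReal_le_ofReal (rpowDensity_anti hκ hκ1 hy hx.1.1)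
    _ ≤ ∫⁻ x in Icc y v, ENNReal.ofReal (rpowDensity κ y) := lintegral_mono_set inter_subset_left
    _ = _ := by
        rw [setLIntegral_const, Real.volume_Icc, ← ENNReal.ofReal_mul
          (rpowDensity_nonneg hκ hy.le), rpowDensity]
        congr 1; ring

lemma rpowMeasure_Iic {κ : ℝ} (hκ : 0 < κ) {b : ℝ} (hb : 0 ≤ b) :
    rpowMeasure κ (Iic b) = ENNReal.ofReal ((Real.Gamma κ)⁻¹ * (b ^ κ / κ)) := by
  rw [rpowMeasure_apply measurableSet_Iic, Iic_inter_Ioi]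
  have hi : IntegrableOn (rpowDensity κ) (Ioc 0 b) := by
    rw [← intervalIntegrable_iff_integrableOn_Ioc_of_le hb]
    exact (intervalIntegral.intervalIntegrable_rpow' (by linarith)).div_const _
  rw [← ofReal_integral_eq_lintegral_ofReal hi, ← intervalIntegral.integral_of_le hb]
  · congr 1
    simp only [rpowDensity]
    rw [intervalIntegral.integral_div, integral_rpow (Or.inl (by linarith))]
    rw [sub_add_cancel, Real.zero_rpow hκ.ne']
    field_simp
    ring
  · filter_upwards [ae_restrict_mem measurableSet_Ioc] with x hx
    exact rpowDensity_nonneg hκ hx.1.le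

lemma exists_tame_rpowMeasure {κ : ℝ} (hκ : 0 < κ) (hκ1 : κ ≤ 1) :
    ∃ A : ℝ, 0 < A ∧ TameMeasure κ A (rpowMeasure κ) ∧ ∀ y v : ℝ, 1 ≤ y → y ≤ v →
      rpowMeasure κ (Ioc y v) ≤ ENNReal.ofReal (A * (v - y) * y ^ (κ - 1)) := by
  have hG := Real.Gamma_pos_of_pos hκ
  set G : ℝ := (Real.Gamma κ)⁻¹
  have hG0 : 0 < G := inv_pos.2 hG
  have hA : 0 < G * (4 + 8 / κ) := by positivity
  refine ⟨G * (4 + 8 / κ), hA, ⟨rpowMeasure_null κ, fun a ha => ?_⟩, fun y v hy hyv => ?_⟩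
  · rcases le_total 1 a with h | h
    · refine (rpowMeasure_Icc_le hκ hκ1 (by linarith)).trans
        (ENNReal.ofReal_le_ofReal ?_)
      have e := one_add_rpow_ge (by linarith : -2 ≤ κ - 1) (by linarith) h
      have e0 : 0 < (1 + a) ^ (κ - 1) := by positivity
      calc _ = G * a ^ (κ - 1) := by ring
        _ ≤ G * (4 * (1 + a) ^ (κ - 1)) := by gcongr
        _ ≤ _ := by
          have : 0 ≤ G * (8 / κ) * (1 + a) ^ (κ - 1) := by positivity
          nlinarith
    · refine (measure_mono Icc_subset_Iic_self).trans ?_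
      rw [rpowMeasure_Iic hκ (by linarith)]
      refine ENNReal.ofReal_le_ofReal ?_
      have e1 : (a + 1) ^ κ ≤ 2 := by
        calc (a + 1) ^ κ ≤ (a + 1) ^ (1 : ℝ) :=
              Real.rpow_le_rpow_of_exponent_le (by linarith) hκ1
          _ ≤ 2 := by rw [Real.rpow_one]; linarith
      have e2 : (1 / 4 : ℝ) ≤ (1 + a) ^ (κ - 1) := by
        have := one_add_rpow_ge (by linarith : -2 ≤ κ - 1) (by linarith) (le_refl (1 : ℝ))
        rw [Real.one_rpow] at this
        have h2 : (1 + 1 : ℝ) ^ (κ - 1) ≤ (1 + a) ^ (κ - 1) :=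
          Real.rpow_le_rpow_of_nonpos (by linarith) (by linarith) (by linarith)
        linarith
      calc G * ((a + 1) ^ κ / κ) ≤ G * (2 / κ) := by gcongr
        _ = G * (8 / κ) * (1 / 4) := by ring
        _ ≤ G * (4 + 8 / κ) * (1 + a) ^ (κ - 1) := by gcongr; linarith
  · refine (measure_mono Ioc_subset_Icc_self).trans ((rpowMeasure_Icc_le hκ hκ1
      (by linarith)).trans (ENNReal.ofReal_le_ofReal ?_))
    gcongr
    have : 0 ≤ 8 / κ := by positivity
    nlinarith

/-- Bernoulli's inequality for (y/x)^{1-κ}; with x ≥ y/2 it gives a Lipschitz bound with constant of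
order y^{κ-2}. -/
lemma rpowDensity_le_add {κ : ℝ} (hκ : 0 < κ) (hκ1 : κ ≤ 1) {x y : ℝ} (hy : 0 < y)
    (hx : y / 2 ≤ x) (hxy : x ≤ y) :
    rpowDensity κ x ≤ rpowDensity κ y + (Real.Gamma κ)⁻¹ * 2 * y ^ (κ - 2) * (y - x) := by
  have hx0 : 0 < x := by linarith
  have hG := Real.Gamma_pos_of_pos hκ
  have h1 : (y / x) ^ (1 - κ) ≤ 1 + 2 * (y - x) / y := by
    have := rpow_one_add_le_one_add_mul_self (s := y / x - 1)
      (by have : 0 < y / x := by positivity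
          linarith) (p := 1 - κ) (by linarith) (by linarith)
    rw [add_sub_cancel] at this
    refine this.trans ?_
    have h2 : y / x - 1 = (y - x) / x := by field_simp
    have h3 : (y - x) / x ≤ 2 * (y - x) / y := by
      rw [div_le_div_iff₀ hx0 hy]; nlinarith
    have h4 : 0 ≤ (y - x) / x := div_nonneg (by linarith) hx0.le
    rw [h2]; nlinarith
  have h5 : x ^ (κ - 1) = y ^ (κ - 1) * (y / x) ^ (1 - κ) := by
    rw [Real.div_rpow hy.le hx0.le, ← neg_sub κ 1, Real.rpow_neg hx0.le, Real.rpow_neg hy.le]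
    have : 0 < y ^ (κ - 1) := by positivity
    field_simp
  have h6 : y ^ (κ - 2) * y = y ^ (κ - 1) := by
    rw [← Real.rpow_add_one hy.ne']; congr 1; ring
  have h7 : x ^ (κ - 1) ≤ y ^ (κ - 1) + 2 * y ^ (κ - 2) * (y - x) := by
    rw [h5]
    calc _ ≤ y ^ (κ - 1) * (1 + 2 * (y - x) / y) := by gcongr
      _ = _ := by rw [← h6]; field_simp
  unfold rpowDensity
  rw [div_eq_mul_inv, div_eq_mul_inv]
  have := mul_le_mul_of_nonneg_right h7 (inv_pos.2 hG).le
  linarith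

lemma lintegral_exp_sub_Iic {y c : ℝ} (hc : 0 < c) :
    ∫⁻ x in Iic y, ENNReal.ofReal (Real.exp (c * (x - y))) = ENNReal.ofReal (1 / c) := by
  have e : ∀ x, Real.exp (c * (x - y)) = Real.exp (-(c * y)) * Real.exp (c * x) := by
    intro x; rw [← Real.exp_add]; congr 1; ring
  simp_rw [e]
  rw [← ofReal_integral_eq_lintegral_ofReal ((integrableOn_exp_mul_Iic hc y).const_mul _)
    (Eventually.of_forall fun x => by positivity), integral_const_mul, integral_exp_mul_Iic hc,
    ← mul_div_assoc, ← Real.exp_add]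
  simp

/-- The exponential means of `rpowMeasure κ` approximate its density. -/
lemma exists_expMean_rpowMeasure_sub_le {κ : ℝ} (hκ : 0 < κ) (hκ2 : κ ≤ 1 / 2) :
    ∃ A : ℝ, 0 < A ∧ ∀ y : ℝ, 1 ≤ y →
      |expMean (rpowMeasure κ) y - rpowDensity κ y| ≤ A * (1 + y) ^ (-(3 / 2) : ℝ) := by
  have hG := Real.Gamma_pos_of_pos hκ
  set G : ℝ := (Real.Gamma κ)⁻¹ with hGdef
  have hG0 : 0 < G := inv_pos.2 hG
  refine ⟨G * (1 / κ * 128 + 128), by positivity, fun y hy => ?_⟩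
  have hy0 : 0 < y := by linarith
  have hm0 := rpowDensity_nonneg hκ hy0.le
  have hfin : expMeanENN (rpowMeasure κ) y < ∞ :=
    expMeanENN_lt_top one_pos (integrable_exp_rpowMeasure hκ one_pos) y
  have hp : 0 < (1 + y) ^ (-(3 / 2) : ℝ) := by positivity
  have hquarter : Real.exp (-(y / 2)) * y ≤ 128 * (1 + y) ^ (-(3 / 2) : ℝ) := by
    have h1 : y * (1 + y) ^ (3 / 2 : ℝ) ≤ 128 * Real.exp (y / 2) := by
      have h2 : (1 + y) ^ (3 / 2 : ℝ) ≤ (1 + y) ^ 2 := by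
        rw [← Real.rpow_natCast]
        exact Real.rpow_le_rpow_of_exponent_le (by linarith) (by norm_num)
      have h3 := Real.pow_div_factorial_le_exp (y / 2) (by positivity) 3
      have h3' := Real.pow_div_factorial_le_exp (y / 2) (by positivity) 2
      have h4 := Real.add_one_le_exp (y / 2)
      norm_num [Nat.factorial] at h3 h3'
      calc y * (1 + y) ^ (3 / 2 : ℝ) ≤ y * (1 + y) ^ 2 := by gcongr
        _ ≤ 128 * Real.exp (y / 2) := by nlinarith
    rw [Real.exp_neg, Real.rpow_neg (by linarith), inv_mul_eq_div, ← div_eq_mul_inv,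
      div_le_div_iff₀ (Real.exp_pos _) (by positivity)]
    exact h1
  rw [abs_le]
  constructor
  -- The density is nonincreasing, so on (0, y] it may be replaced from below by its value at y.
  · have h1 : ENNReal.ofReal (rpowDensity κ y * (1 - Real.exp (-y))) ≤
        expMeanENN (rpowMeasure κ) y := by
      rw [expMeanENN, setLIntegral_rpowMeasure measurableSet_Iic (by fun_prop), Iic_inter_Ioi]
      calc _ = ENNReal.ofReal (rpowDensity κ y) *
            ∫⁻ x in Ioc 0 y, ENNReal.ofReal (Real.exp (x - y)) := by
            rw [ENNReal.ofReal_mul hm0]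
            congr 1
            rw [← ofReal_integral_eq_lintegral_ofReal _ (Eventually.of_forall fun x =>
              (Real.exp_pos _).le), ← intervalIntegral.integral_of_le hy0.le,
              intervalIntegral.integral_comp_sub_right (fun x => Real.exp x), integral_exp]
            · simp
            · exact (Continuous.integrableOn_Icc (by fun_prop)).mono_set Ioc_subset_Icc_self
        _ ≤ _ := by
            rw [← lintegral_const_mul _ (by fun_prop)]
            refine setLIntegral_mono' measurableSet_Ioc fun x hx => ?_
            gcongr
            exact rpowDensity_anti hκ (by linarith) hx.1 hx.2
    have h2 : rpowDensity κ y * (1 - Real.exp (-y)) ≤ expMean (rpowMeasure κ) y :=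
      (ENNReal.ofReal_le_iff_le_toReal hfin.ne).1 h1
    have h3 : rpowDensity κ y ≤ G := by
      rw [rpowDensity, div_eq_mul_inv]
      exact mul_le_of_le_one_left hG0.le
        (Real.rpow_le_one_of_one_le_of_nonpos hy (by linarith))
    have h4 : Real.exp (-y) ≤ Real.exp (-(y / 2)) * y := by
      calc Real.exp (-y) ≤ Real.exp (-(y / 2)) := Real.exp_le_exp.2 (by linarith)
        _ ≤ _ := le_mul_of_one_le_right (Real.exp_pos _).le hy
    have h5 : rpowDensity κ y * Real.exp (-y) ≤ G * (128 * (1 + y) ^ (-(3 / 2) : ℝ)) := by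
      have := Real.exp_pos (-y)
      gcongr
      linarith
    have : 0 ≤ G * (1 / κ * 128) * (1 + y) ^ (-(3 / 2) : ℝ) := by positivity
    nlinarith
  -- Splitting at y/2: below it the kernel is exponentially small, above it the Lipschitz bound
  -- applies, and (y-x)e^{x-y} ≤ 2e^{(x-y)/2} is integrable.
  · have hbnd : expMeanENN (rpowMeasure κ) y ≤ ENNReal.ofReal
        (Real.exp (-(y / 2)) * (G * ((y / 2) ^ κ / κ)) + (rpowDensity κ y +
          G * 2 * y ^ (κ - 2) * 4)) := by
      have hd : Disjoint (Iic (y / 2)) (Ioc (y / 2) y) :=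
        Set.disjoint_left.2 fun x (hx : x ≤ y / 2) hx' => not_lt.2 hx hx'.1
      rw [expMeanENN, ← Iic_union_Ioc_eq_Iic (by linarith : y / 2 ≤ y),
        lintegral_union measurableSet_Ioc hd, ENNReal.ofReal_add (by positivity) (by positivity)]
      refine add_le_add ?_ ?_
      · calc _ ≤ ∫⁻ x in Iic (y / 2), ENNReal.ofReal (Real.exp (-(y / 2))) ∂(rpowMeasure κ) := by
              refine setLIntegral_mono' measurableSet_Iic fun x (hx : x ≤ y / 2) => ?_
              exact ENNReal.ofReal_le_ofReal (Real.exp_le_exp.2 (by linarith))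
          _ = _ := by
              rw [setLIntegral_const, rpowMeasure_Iic hκ (by positivity),
                ← ENNReal.ofReal_mul (Real.exp_pos _).le]
      · rw [setLIntegral_rpowMeasure measurableSet_Ioc (by fun_prop)]
        calc _ ≤ ∫⁻ x in Ioc (y / 2) y ∩ Ioi 0,
              (ENNReal.ofReal (rpowDensity κ y) * ENNReal.ofReal (Real.exp (1 * (x - y))) +
                ENNReal.ofReal (G * 2 * y ^ (κ - 2) * 2) *
                  ENNReal.ofReal (Real.exp (1 / 2 * (x - y)))) := by
              refine setLIntegral_mono' (measurableSet_Ioc.inter measurableSet_Ioi) fun x hx => ?_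
              have hc0 : 0 ≤ G * 2 * y ^ (κ - 2) := by positivity
              rw [← ENNReal.ofReal_mul (rpowDensity_nonneg hκ (le_of_lt hx.2)),
                ← ENNReal.ofReal_mul hm0, ← ENNReal.ofReal_mul (by positivity),
                ← ENNReal.ofReal_add (by positivity) (by positivity), one_mul]
              refine ENNReal.ofReal_le_ofReal ?_
              have e1 := rpowDensity_le_add hκ (by linarith) hy0 hx.1.1.le hx.1.2
              have e2 : (y - x) * Real.exp (x - y) ≤ 2 * Real.exp (1 / 2 * (x - y)) := by
                have a1 := Real.add_one_le_exp ((y - x) / 2)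
                have a2 : (y - x) ≤ 2 * Real.exp ((y - x) / 2) := by linarith
                calc (y - x) * Real.exp (x - y) ≤
                      2 * Real.exp ((y - x) / 2) * Real.exp (x - y) := by gcongr
                  _ = _ := by rw [mul_assoc, ← Real.exp_add]; congr 2; ring
              calc _ ≤ (rpowDensity κ y + G * 2 * y ^ (κ - 2) * (y - x)) * Real.exp (x - y) := by
                    gcongr
                _ = rpowDensity κ y * Real.exp (x - y) +
                    G * 2 * y ^ (κ - 2) * ((y - x) * Real.exp (x - y)) := by ring
                _ ≤ rpowDensity κ y * Real.exp (x - y) +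
                    G * 2 * y ^ (κ - 2) * (2 * Real.exp (1 / 2 * (x - y))) := by gcongr
                _ = _ := by ring
          _ ≤ ∫⁻ x in Iic y, _ := lintegral_mono_set fun x hx => hx.1.2
          _ = _ := by
              rw [lintegral_add_left (by fun_prop), lintegral_const_mul _ (by fun_prop),
                lintegral_const_mul _ (by fun_prop), lintegral_exp_sub_Iic one_pos,
                lintegral_exp_sub_Iic (by norm_num), ← ENNReal.ofReal_mul hm0,
                ← ENNReal.ofReal_mul (by positivity), ← ENNReal.ofReal_add (by positivity)
                  (by positivity)]
              congr 1; ring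
    have h2 := ENNReal.toReal_le_of_le_ofReal (by positivity) hbnd
    change expMean (rpowMeasure κ) y ≤ _ at h2
    have h3 : (y / 2) ^ κ ≤ y := by
      calc (y / 2) ^ κ ≤ y ^ κ := by gcongr; linarith
        _ ≤ y ^ (1 : ℝ) := Real.rpow_le_rpow_of_exponent_le hy (by linarith)
        _ = y := Real.rpow_one y
    have h4 : y ^ (κ - 2) ≤ 4 * (1 + y) ^ (-(3 / 2) : ℝ) :=
      (Real.rpow_le_rpow_of_exponent_le hy (by linarith)).trans
        (one_add_rpow_ge (by norm_num) (by norm_num) hy)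
    have h5 : Real.exp (-(y / 2)) * (G * ((y / 2) ^ κ / κ)) ≤
        G * (1 / κ) * (128 * (1 + y) ^ (-(3 / 2) : ℝ)) := by
      calc _ ≤ Real.exp (-(y / 2)) * (G * (y / κ)) := by gcongr
        _ = G * (1 / κ) * (Real.exp (-(y / 2)) * y) := by ring
        _ ≤ _ := by gcongr
    have h6 : G * 2 * y ^ (κ - 2) * 4 ≤ G * 2 * (4 * (1 + y) ^ (-(3 / 2) : ℝ)) * 4 := by gcongr
    have : 0 ≤ G * (1 + y) ^ (-(3 / 2) : ℝ) := by positivity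
    nlinarith

/-- The Tauberian theorem applied to `rootMeasure k`. -/
theorem exists_tame_rootMeasure {k : ℕ} (hk : 2 ≤ k) :
    ∃ K : ℝ, 0 < K ∧ TameMeasure (1 / (k : ℝ)) K (rootMeasure k) ∧
      ∀ y, 0 ≤ y → |expMean (rootMeasure k) y - expMean (rpowMeasure (1 / (k : ℝ))) y| ≤
        K * (1 + y) ^ (-(3 / 2) : ℝ) := by
  have hk0 : k ≠ 0 := by lia
  have hκ0 : 0 < 1 / (k : ℝ) := by positivity
  have hκ2 : 1 / (k : ℝ) ≤ 1 / 2 := one_div_le_one_div_of_le (by norm_num) (by exact_mod_cast hk)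
  obtain ⟨C, hC, hb⟩ := exists_laplace_bound hk
  obtain ⟨A, hA, htame, hincr⟩ := exists_tame_rpowMeasure hκ0 (by linarith)
  exact exists_tame_and_expMean_sub_le (fun σ hσ => integrable_exp_rootMeasure hk0 hσ)
    (fun σ hσ => integrable_exp_rpowMeasure hκ0 hσ) hκ0 hκ2 hC hb (rootMeasure_null k) hA.le htame
    hincr

end

section

open MeasureTheory Set Filter Topology ProbabilityTheory
open scoped ENNReal

/-! ### Sums of independent coordinates -/

/-- The law of the sum of the coordinates under the product of the measures `θ i`. -/
noncomputable def sumPi {n : ℕ} (θ : Fin n → Measure ℝ) : Measure ℝ :=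
  (Measure.pi θ).map fun t => ∑ i, t i

instance {n : ℕ} (θ : Fin n → Measure ℝ) [∀ i, SigmaFinite (θ i)] : SFinite (sumPi θ) := by
  unfold sumPi; infer_instance

lemma measurable_sum_fin (n : ℕ) : Measurable fun t : Fin n → ℝ => ∑ i, t i := by fun_prop

lemma lintegral_sumPi {n : ℕ} (θ : Fin n → Measure ℝ) {f : ℝ → ℝ≥0∞} (hf : Measurable f) :
    ∫⁻ w, f w ∂(sumPi θ) = ∫⁻ t, f (∑ i, t i) ∂(Measure.pi θ) :=
  lintegral_map hf (measurable_sum_fin n)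

lemma lintegral_pi_succAbove {n : ℕ} (θ : Fin (n + 1) → Measure ℝ) [∀ i, SigmaFinite (θ i)]
    (i : Fin (n + 1)) {g : ℝ × ℝ → ℝ≥0∞} (hg : Measurable g) :
    ∫⁻ t, g (t i, ∑ j, t (i.succAbove j)) ∂(Measure.pi θ) =
      ∫⁻ w, ∫⁻ z, g (z, w) ∂(θ i) ∂(sumPi fun j => θ (i.succAbove j)) := by
  have h := measurePreserving_piFinSuccAbove θ i
  have hm : Measurable fun p : ℝ × (Fin n → ℝ) => g (p.1, ∑ j, p.2 j) := by fun_prop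
  have h1 := h.lintegral_comp hm
  rw [lintegral_prod_symm _ hm.aemeasurable] at h1
  rw [lintegral_sumPi _ hg.lintegral_prod_left', ← h1]
  rfl

lemma sumPi_succAbove {n : ℕ} (θ : Fin (n + 1) → Measure ℝ) [∀ i, SigmaFinite (θ i)]
    (i : Fin (n + 1)) : sumPi θ = (θ i).conv (sumPi fun j => θ (i.succAbove j)) := by
  refine Measure.ext_of_lintegral _ fun f hf => ?_
  rw [lintegral_sumPi θ hf, Measure.lintegral_conv hf, lintegral_lintegral_swap (by fun_prop),
    ← lintegral_pi_succAbove θ i (g := fun p => f (p.1 + p.2)) (by fun_prop)]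
  refine lintegral_congr fun t => ?_
  rw [Fin.sum_univ_succAbove _ i]

lemma sumPi_zero (θ : Fin 0 → Measure ℝ) : sumPi θ = Measure.dirac 0 := by
  rw [sumPi, Measure.pi_of_empty θ (0 : Fin 0 → ℝ)]
  exact (Measure.map_dirac' (measurable_sum_fin 0) _).trans (by simp)

lemma sumPi_one (θ : Fin 1 → Measure ℝ) [∀ i, SigmaFinite (θ i)] : sumPi θ = θ 0 := by
  rw [sumPi_succAbove θ 0, sumPi_zero, Measure.conv_dirac_zero]

/-- Sums of independent coordinates with tame laws have a tame law. -/
lemma exists_tame_sumPi {κ K : ℝ} (hκ : 0 < κ) (hK : 0 ≤ K) (n : ℕ) (hn : (n + 1) * κ ≤ 1) :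
    ∃ C : ℝ, 0 ≤ C ∧ ∀ θ : Fin (n + 1) → Measure ℝ, (∀ i, SigmaFinite (θ i)) →
      (∀ i, TameMeasure κ K (θ i)) → TameMeasure ((n + 1) * κ) C (sumPi θ) := by
  induction n with
  | zero =>
    refine ⟨K, hK, fun θ _ h => ?_⟩
    rw [sumPi_one]
    simpa using h 0
  | succ n ih =>
    push_cast at hn
    have hn0 : 0 < (n + 1) * κ := by positivity
    obtain ⟨C, hC, h⟩ := ih (by linarith)
    refine ⟨(4 / κ + 4 / ((n + 1) * κ)) * K * C, by positivity, fun θ _ hθ => ?_⟩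
    rw [sumPi_succAbove θ 0]
    have := (hθ 0).conv (h (fun j => θ ((0 : Fin (n + 2)).succAbove j)) (fun _ => inferInstance)
      fun _ => hθ _) hκ (by linarith) hn0 (by linarith) hK hC
    convert this using 1
    push_cast; ring

lemma expMeanENN_conv (α ρ : Measure ℝ) [SFinite α] [SFinite ρ] (L : ℝ) :
    expMeanENN (α.conv ρ) L =
      ∫⁻ w, ∫⁻ z, (if z + w ≤ L then ENNReal.ofReal (Real.exp (z + w - L)) else 0) ∂α ∂ρ := by
  have hm : Measurable fun x : ℝ => if x ≤ L then ENNReal.ofReal (Real.exp (x - L)) else 0 :=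
    Measurable.ite measurableSet_Iic (by fun_prop) measurable_const
  rw [expMeanENN_eq, Measure.lintegral_conv hm, lintegral_lintegral_swap]
  exact (hm.comp (measurable_fst.add measurable_snd)).aemeasurable

/-- Convolution with a truncated measure, in terms of its exponential means. -/
lemma expMeanENN_restrict_conv (α ρ : Measure ℝ) [SFinite α] [SFinite ρ] (a L : ℝ) :
    expMeanENN ((α.restrict (Iic a)).conv ρ) L =
      ∫⁻ w, ENNReal.ofReal (Real.exp (w + min a (L - w) - L)) * expMeanENN α (min a (L - w)) ∂ρ := by
  rw [expMeanENN_conv]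
  refine lintegral_congr fun w => ?_
  rw [expMeanENN_eq, ← lintegral_const_mul _
    (Measurable.ite measurableSet_Iic (by fun_prop) measurable_const),
    ← lintegral_indicator measurableSet_Iic]
  refine lintegral_congr fun z => ?_
  simp only [indicator, mem_Iic, le_min_iff]
  by_cases h1 : z ≤ a
  · by_cases h2 : z + w ≤ L
    · have h3 : z ≤ L - w := by linarith
      simp only [h1, h2, h3, and_self, if_true]
      rw [← ENNReal.ofReal_mul (Real.exp_pos _).le, ← Real.exp_add]
      congr 2; ring
    · have h3 : ¬ z ≤ L - w := by intro; exact h2 (by linarith)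
      simp [h1, h2, h3]
  · simp [h1]

lemma expMeanENN_eq_zero {α : Measure ℝ} (h : α (Iio 0) = 0) {b : ℝ} (hb : b < 0) :
    expMeanENN α b = 0 := by
  have : α.restrict (Iic b) = 0 := by
    rw [Measure.restrict_eq_zero]
    exact measure_mono_null (Iic_subset_Iio.2 hb) h
  rw [expMeanENN, this, lintegral_zero_measure]

/-- (1 + a)(1 + L - a) ≥ 1 + L on the whole range of a. This keeps the errors uniform in the
truncation levels. -/
lemma one_add_rpow_mul_le {a L κ : ℝ} (hκ : 0 < κ) (ha : 0 ≤ a) (haL : a ≤ L) :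
    (1 + a) ^ (-κ) * (1 + (L - a)) ^ (-κ) ≤ (1 + L) ^ (-κ) := by
  rw [← Real.mul_rpow (by linarith) (by linarith)]
  exact Real.rpow_le_rpow_of_nonpos (by linarith) (by nlinarith) (by linarith)

/-- Replacing a truncated factor in a convolution by one with close exponential means. -/
lemma expMeanENN_restrict_conv_le {α β ρ : Measure ℝ} [SFinite α] [SFinite β] [SFinite ρ]
    (hα : α (Iio 0) = 0) {K : ℝ} (hK : 0 ≤ K)
    (hr : ∀ b, 0 ≤ b → expMeanENN α b ≤
      expMeanENN β b + ENNReal.ofReal (K * (1 + b) ^ (-(3 / 2) : ℝ)))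
    {κ C : ℝ} (hκ : 0 < κ) (hκ1 : κ < 1) (hC : 0 ≤ C) (hρ : TameMeasure (1 - κ) C ρ)
    {a L : ℝ} (ha : 0 ≤ a) (haL : a ≤ L) :
    expMeanENN ((α.restrict (Iic a)).conv ρ) L ≤ expMeanENN ((β.restrict (Iic a)).conv ρ) L +
      ENNReal.ofReal (17 * K * (tameIntegralConst (1 - κ) * C) * (1 + L) ^ (-κ)) := by
  have hL : 0 ≤ L := ha.trans haL
  have hT := tameIntegralConst_pos (α := 1 - κ) (by linarith)
  -- The mean of α is taken at min(a, L - w). If L - w is the smaller, the error is the direct one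
  -- at L - w. If a is the smaller, it is the error at a, damped by the exponential distance of w
  -- from L - a.
  set e : ℝ → ℝ≥0∞ := fun w =>
    (Iic L).indicator (fun w => ENNReal.ofReal (K * (1 + (L - w)) ^ (-(3 / 2) : ℝ))) w +
    (Iic (L - a)).indicator (fun w => ENNReal.ofReal (K * (1 + a) ^ (-(3 / 2) : ℝ)) *
      ENNReal.ofReal (Real.exp (-((L - a - w) / 2)))) w with he
  have hem : Measurable e := by
    refine Measurable.add ?_ ?_ <;> exact Measurable.indicator (by fun_prop) measurableSet_Iic
  have hpt : ∀ w, ENNReal.ofReal (Real.exp (w + min a (L - w) - L)) *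
      expMeanENN α (min a (L - w)) ≤ ENNReal.ofReal (Real.exp (w + min a (L - w) - L)) *
      expMeanENN β (min a (L - w)) + e w := by
    intro w
    rcases lt_or_ge (min a (L - w)) 0 with h0 | h0
    · rw [expMeanENN_eq_zero hα h0, mul_zero]; exact bot_le
    · refine (mul_le_mul_right (hr _ h0) _).trans ?_
      rw [mul_add]
      refine add_le_add le_rfl ?_
      rw [← ENNReal.ofReal_mul (Real.exp_pos _).le]
      rcases le_total a (L - w) with h | h
      · rw [min_eq_left h]
        have hw : w ∈ Iic (L - a) := by simp only [mem_Iic]; linarith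
        refine le_trans ?_ le_add_self
        rw [indicator_of_mem hw, ← ENNReal.ofReal_mul (by positivity), mul_comm]
        refine ENNReal.ofReal_le_ofReal ?_
        gcongr
        linarith
      · rw [min_eq_right h]
        have hw : w ∈ Iic L := by
          rw [min_eq_right h] at h0
          simp only [mem_Iic]; linarith
        refine le_trans ?_ le_self_add
        rw [indicator_of_mem hw, show w + (L - w) - L = 0 by ring, Real.exp_zero, one_mul]
  rw [expMeanENN_restrict_conv, expMeanENN_restrict_conv]
  refine (lintegral_mono hpt).trans ?_
  rw [lintegral_add_right _ hem]
  refine add_le_add le_rfl ?_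
  rw [he, lintegral_add_left (Measurable.indicator (by fun_prop) measurableSet_Iic),
    lintegral_indicator measurableSet_Iic, lintegral_indicator measurableSet_Iic]
  have e1 : ∫⁻ w in Iic L, ENNReal.ofReal (K * (1 + (L - w)) ^ (-(3 / 2) : ℝ)) ∂ρ ≤
      ENNReal.ofReal (K * (tameIntegralConst (1 - κ) * C * (1 + L) ^ (-κ))) := by
    simp_rw [ENNReal.ofReal_mul hK]
    rw [lintegral_const_mul _ (by fun_prop)]
    refine mul_le_mul_right ?_ _
    have := hρ.lintegral_le (by linarith) (by linarith) hC hL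
    rwa [show 1 - κ - 1 = -κ by ring] at this
  have e2 : ∫⁻ w in Iic (L - a), ENNReal.ofReal (K * (1 + a) ^ (-(3 / 2) : ℝ)) *
      ENNReal.ofReal (Real.exp (-((L - a - w) / 2))) ∂ρ ≤
      ENNReal.ofReal (K * (16 * (tameIntegralConst (1 - κ) * C * (1 + L) ^ (-κ)))) := by
    rw [lintegral_const_mul _ (by fun_prop)]
    refine (mul_le_mul_right (hρ.lintegral_exp_half_le (by linarith) (by linarith) hC
      (sub_nonneg.2 haL)) _).trans ?_
    rw [← ENNReal.ofReal_mul (by positivity), show 1 - κ - 1 = -κ by ring]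
    refine ENNReal.ofReal_le_ofReal ?_
    have h1 : (1 + a) ^ (-(3 / 2) : ℝ) ≤ (1 + a) ^ (-κ) :=
      Real.rpow_le_rpow_of_exponent_le (by linarith) (by linarith)
    have h2 := one_add_rpow_mul_le hκ ha haL
    have h3 : 0 ≤ (1 + (L - a)) ^ (-κ) := Real.rpow_nonneg (by linarith) _
    calc _ = K * (16 * (tameIntegralConst (1 - κ) * C *
          ((1 + a) ^ (-(3 / 2) : ℝ) * (1 + (L - a)) ^ (-κ)))) := by ring
      _ ≤ K * (16 * (tameIntegralConst (1 - κ) * C *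
          ((1 + a) ^ (-κ) * (1 + (L - a)) ^ (-κ)))) := by gcongr
      _ ≤ _ := by gcongr
  refine (add_le_add e1 e2).trans_eq ?_
  rw [← ENNReal.ofReal_add (by positivity) (by positivity)]
  congr 1; ring

/-- Replacing all truncated factors in a convolution. -/
lemma expMeanENN_sumPi_restrict_le {α β : Measure ℝ} [SigmaFinite α] [SigmaFinite β]
    {K : ℝ} (hK : 0 ≤ K) {κ : ℝ} (hκ : 0 < κ)
    (hα : TameMeasure κ K α) (hβ : TameMeasure κ K β)
    (hr : ∀ b, 0 ≤ b → expMeanENN α b ≤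
      expMeanENN β b + ENNReal.ofReal (K * (1 + b) ^ (-(3 / 2) : ℝ)))
    (n : ℕ) (hn : (n + 2) * κ = 1) :
    ∃ C : ℝ, 0 ≤ C ∧ ∀ (a : Fin (n + 2) → ℝ) (L : ℝ), (∀ i, 0 ≤ a i) → (∀ i, a i ≤ L) →
      expMeanENN (sumPi fun i => α.restrict (Iic (a i))) L ≤
        expMeanENN (sumPi fun i => β.restrict (Iic (a i))) L +
          ENNReal.ofReal (C * (1 + L) ^ (-κ)) := by
  -- Removing one coordinate leaves n + 1 of them, whose sum is tame of exponent 1 - κ: this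
  -- produces the rate L^{-κ}.
  have hκn : (n + 1) * κ = 1 - κ := by linarith
  have hκ1 : κ < 1 := by nlinarith [(Nat.cast_nonneg n : (0 : ℝ) ≤ n)]
  obtain ⟨C, hC, htame⟩ := exists_tame_sumPi hκ hK n (by linarith)
  set c : ℝ := 17 * K * (tameIntegralConst (1 - κ) * C) with hc
  have hT := tameIntegralConst_pos (α := 1 - κ) (by linarith)
  have hc0 : 0 ≤ c := by positivity
  refine ⟨(n + 2) * c, by positivity, fun a L ha haL => ?_⟩
  -- Hybrid families: the first j coordinates carry the new measure, the others the old one.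
  -- Consecutive hybrids differ in one coordinate only.
  set h : ℕ → Fin (n + 2) → Measure ℝ := fun j i =>
    if (i : ℕ) < j then β.restrict (Iic (a i)) else α.restrict (Iic (a i)) with hh
  have hσ : ∀ j i, SigmaFinite (h j i) := by
    intro j i; simp only [hh]; split_ifs <;> infer_instance
  have htm : ∀ j i, TameMeasure κ K (h j i) := by
    intro j i
    simp only [hh]
    split_ifs
    · exact hβ.mono Measure.restrict_le_self
    · exact hα.mono Measure.restrict_le_self
  have key : ∀ j : ℕ, j ≤ n + 2 → expMeanENN (sumPi (h 0)) L ≤ expMeanENN (sumPi (h j)) L +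
      ENNReal.ofReal (j * (c * (1 + L) ^ (-κ))) := by
    intro j
    have hL : 0 ≤ L := (ha 0).trans (haL 0)
    induction j with
    | zero => intro _; simp
    | succ j ih =>
      intro hj
      refine (ih (by lia)).trans ?_
      set i : Fin (n + 2) := ⟨j, by lia⟩ with hi
      have hrest : (fun l => h j (i.succAbove l)) = fun l => h (j + 1) (i.succAbove l) := by
        funext l
        have hne : ((i.succAbove l : Fin (n + 2)) : ℕ) ≠ j := fun hcon =>
          Fin.succAbove_ne i l (Fin.ext hcon)
        simp only [hh]
        have : ((i.succAbove l : Fin (n + 2)) : ℕ) < j ↔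
          ((i.succAbove l : Fin (n + 2)) : ℕ) < j + 1 := by lia
        simp only [this]
      have h1 : h j i = α.restrict (Iic (a i)) := by simp [hh, hi]
      have h2 : h (j + 1) i = β.restrict (Iic (a i)) := by simp [hh, hi]
      have step : expMeanENN (sumPi (h j)) L ≤ expMeanENN (sumPi (h (j + 1))) L +
          ENNReal.ofReal (c * (1 + L) ^ (-κ)) := by
        rw [sumPi_succAbove (h j) i, sumPi_succAbove (h (j + 1)) i, hrest, h1, h2]
        refine expMeanENN_restrict_conv_le hα.null hK hr hκ hκ1 hC ?_ (ha i) (haL i)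
        rw [← hκn]
        exact htame _ (fun l => hσ _ _) fun l => htm _ _
      refine (add_le_add step le_rfl).trans_eq ?_
      rw [add_assoc, ← ENNReal.ofReal_add (by positivity) (by positivity)]
      congr 2; push_cast; ring
  have := key (n + 2) le_rfl
  have e0 : h 0 = fun i => α.restrict (Iic (a i)) := by funext i; simp [hh]
  have e1 : h (n + 2) = fun i => β.restrict (Iic (a i)) := by funext i; simp [hh, i.isLt]
  rw [e0, e1] at this
  refine this.trans_eq ?_
  congr 2; push_cast; ring

end

/-! ### The continuous model and the Dirichlet distribution function -/

section

open MeasureTheory Set Filter Topology ProbabilityTheory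
open scoped ENNReal

instance (κ : ℝ) : SigmaFinite (rpowMeasure κ) := by
  unfold rpowMeasure
  exact SigmaFinite.withDensity_ofReal _

lemma lintegral_pi_prod {n : ℕ} (μ : Fin n → Measure ℝ) [∀ i, SigmaFinite (μ i)]
    {f : Fin n → ℝ → ℝ≥0∞} (hf : ∀ i, Measurable (f i)) :
    ∫⁻ t, ∏ i, f i (t i) ∂(Measure.pi μ) = ∏ i, ∫⁻ x, f i x ∂(μ i) := by
  induction n with
  | zero => simp
  | succ n ih =>
    have h := measurePreserving_piFinSuccAbove μ 0
    have hm : Measurable fun p : ℝ × (Fin n → ℝ) => f 0 p.1 * ∏ i, f i.succ (p.2 i) := by fun_prop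
    have h1 := h.lintegral_comp hm
    rw [Fin.prod_univ_succ, ← ih (fun i => μ i.succ) fun i => hf i.succ,
      ← lintegral_prod_mul (hf 0).aemeasurable
        (Finset.measurable_fun_prod _ fun i _ => (hf i.succ).comp (measurable_pi_apply i)).aemeasurable]
    refine Eq.trans ?_ h1
    refine lintegral_congr fun t => ?_
    rw [Fin.prod_univ_succ]
    rfl

lemma pi_withDensity {n : ℕ} (μ : Fin n → Measure ℝ) [∀ i, SigmaFinite (μ i)]
    {f : Fin n → ℝ → ℝ≥0∞} (hf : ∀ i, Measurable (f i))
    [∀ i, SigmaFinite ((μ i).withDensity (f i))] :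
    Measure.pi (fun i => (μ i).withDensity (f i)) =
      (Measure.pi μ).withDensity fun t => ∏ i, f i (t i) := by
  refine (Measure.pi_eq fun s hs => ?_)
  rw [withDensity_apply _ (MeasurableSet.univ_pi hs), Measure.restrict_pi_pi,
    lintegral_pi_prod _ hf]
  exact Finset.prod_congr rfl fun i _ => (withDensity_apply _ (hs i)).symm

lemma lintegral_comp_div {v : ℝ} (hv : 0 < v) {f : ℝ → ℝ≥0∞} (hf : Measurable f) :
    ∫⁻ x, f (x / v) = ENNReal.ofReal v * ∫⁻ x, f x := by
  have h := Real.smul_map_volume_mul_left (a := v⁻¹) (by positivity)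
  conv_rhs => rw [← h]
  rw [lintegral_smul_measure, lintegral_map hf (by fun_prop), abs_of_pos (by positivity),
    smul_eq_mul, ← mul_assoc, ← ENNReal.ofReal_mul hv.le, mul_inv_cancel₀ hv.ne', ENNReal.ofReal_one,
    one_mul]
  simp_rw [div_eq_inv_mul]

/-- After x ↦ x/v the integrand is a multiple of the beta density, whose total mass is 1. Hence the
Gamma-normalized power densities form a convolution semigroup. -/
lemma setLIntegral_rpowDensity_mul {α β v : ℝ} (hα : 0 < α) (hβ : 0 < β) (hv : 0 < v) :
    ∫⁻ x in Ioo 0 v, ENNReal.ofReal (rpowDensity α x) * ENNReal.ofReal (rpowDensity β (v - x)) =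
      ENNReal.ofReal (rpowDensity (α + β) v) := by
  have hA := Real.Gamma_pos_of_pos hα
  have hB := Real.Gamma_pos_of_pos hβ
  have hAB := Real.Gamma_pos_of_pos (add_pos hα hβ)
  have hpt : ∀ x, (Ioo 0 v).indicator (fun x => ENNReal.ofReal (rpowDensity α x) *
      ENNReal.ofReal (rpowDensity β (v - x))) x =
      ENNReal.ofReal (v ^ (α + β - 2) / Real.Gamma (α + β)) * betaPDF α β (x / v) := by
    intro x
    by_cases hx : x ∈ Ioo 0 v
    · have h1 : 0 < x / v := div_pos hx.1 hv
      have h2 : x / v < 1 := (div_lt_one hv).2 hx.2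
      rw [indicator_of_mem hx, betaPDF_of_pos_lt_one h1 h2,
        ← ENNReal.ofReal_mul (rpowDensity_nonneg hα hx.1.le), ← ENNReal.ofReal_mul (by positivity)]
      congr 1
      have e1 : 1 - x / v = (v - x) / v := by field_simp
      have e2 : v ^ (α + β - 2) = v ^ (α - 1) * v ^ (β - 1) := by
        rw [← Real.rpow_add hv]; congr 1; ring
      have p1 : 0 < v ^ (α - 1) := by positivity
      have p2 : 0 < v ^ (β - 1) := by positivity
      rw [e1, Real.div_rpow hx.1.le hv.le, Real.div_rpow (by linarith [hx.2]) hv.le, e2, beta,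
        rpowDensity, rpowDensity]
      field_simp
    · rw [indicator_of_notMem hx]
      rcases le_or_gt x 0 with h | h
      · rw [betaPDF_eq_zero_of_nonpos (div_nonpos_of_nonpos_of_nonneg h hv.le), mul_zero]
      · have : v ≤ x := by by_contra hc; exact hx ⟨h, not_le.1 hc⟩
        rw [betaPDF_eq_zero_of_one_le ((one_le_div hv).2 this), mul_zero]
  have hbm : Measurable (betaPDF α β) := (measurable_betaPDFReal α β).ennreal_ofReal
  have hbm' : Measurable fun x => betaPDF α β (x / v) := hbm.comp (by fun_prop)
  rw [← lintegral_indicator measurableSet_Ioo, lintegral_congr hpt, lintegral_const_mul _ hbm',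
    lintegral_comp_div hv hbm, lintegral_betaPDF_eq_one hα hβ, mul_one,
    ← ENNReal.ofReal_mul (by positivity)]
  congr 1
  have e : v ^ (α + β - 1) = v ^ (α + β - 2) * v := by
    rw [← Real.rpow_add_one hv.ne']; congr 1; ring
  rw [rpowDensity, e]
  ring

lemma rpowMeasure_eq_withDensity (κ : ℝ) : rpowMeasure κ =
    volume.withDensity ((Ioi 0).indicator fun v => ENNReal.ofReal (rpowDensity κ v)) := by
  rw [withDensity_indicator measurableSet_Ioi]; rfl

lemma measurable_indicator_rpowDensity (κ : ℝ) :
    Measurable ((Ioi (0 : ℝ)).indicator fun v => ENNReal.ofReal (rpowDensity κ v)) :=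
  (measurable_rpowDensity κ).ennreal_ofReal.indicator measurableSet_Ioi

lemma rpowMeasure_conv {α β : ℝ} (hα : 0 < α) (hβ : 0 < β) :
    (rpowMeasure α).conv (rpowMeasure β) = rpowMeasure (α + β) := by
  rw [rpowMeasure_eq_withDensity, rpowMeasure_eq_withDensity, rpowMeasure_eq_withDensity,
    conv_withDensity_eq_lconvolution (measurable_indicator_rpowDensity α)
      (measurable_indicator_rpowDensity β)]
  congr 1
  funext v
  rw [lconvolution_def]
  have hpt : ∀ x, (Ioi (0 : ℝ)).indicator (fun v => ENNReal.ofReal (rpowDensity α v)) x *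
      (Ioi (0 : ℝ)).indicator (fun v => ENNReal.ofReal (rpowDensity β v)) (-x + v) =
      (Ioo 0 v).indicator (fun x => ENNReal.ofReal (rpowDensity α x) *
      ENNReal.ofReal (rpowDensity β (v - x))) x := by
    intro x
    rw [neg_add_eq_sub]
    by_cases h1 : 0 < x <;> by_cases h2 : x < v <;> simp [indicator, h1, h2]
  rw [lintegral_congr hpt, lintegral_indicator measurableSet_Ioo]
  rcases lt_or_ge 0 v with hv | hv
  · rw [setLIntegral_rpowDensity_mul hα hβ hv, indicator_of_mem (mem_Ioi.2 hv)]
  · rw [Ioo_eq_empty (not_lt.2 hv), indicator_of_notMem (by simpa using hv)]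
    simp

lemma sumPi_rpowMeasure {κ : ℝ} (hκ : 0 < κ) (n : ℕ) :
    sumPi (fun _ : Fin (n + 1) => rpowMeasure κ) = rpowMeasure ((n + 1) * κ) := by
  induction n with
  | zero => rw [sumPi_one]; simp
  | succ n ih =>
    rw [sumPi_succAbove _ 0, ih, rpowMeasure_conv hκ (by positivity)]
    congr 1; push_cast; ring

lemma sumPi_restrict_le {n : ℕ} (θ : Fin n → Measure ℝ) [∀ i, SigmaFinite (θ i)]
    (s : Fin n → Set ℝ) : sumPi (fun i => (θ i).restrict (s i)) ≤ sumPi θ := by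
  rw [sumPi, sumPi, ← Measure.restrict_pi_pi]
  exact Measure.map_mono Measure.restrict_le_self (measurable_sum_fin n)

/-- The singular part of the convolution of `v ^ (κ - 1)` and `v ^ (-κ)` near the end point. -/
lemma exists_setLIntegral_Ico_le {κ : ℝ} (hκ : 0 < κ) (hκ1 : κ < 1) :
    ∃ C : ℝ, 0 ≤ C ∧ ∀ L : ℝ, 0 < L →
      ∫⁻ w in Ico (L - 1) L, ENNReal.ofReal (rpowDensity κ (L - w)) ∂(rpowMeasure (1 - κ)) ≤
        ENNReal.ofReal (C * (1 + L) ^ (-κ)) := by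
  have hG := Real.Gamma_pos_of_pos hκ
  have hG' := Real.Gamma_pos_of_pos (s := 1 - κ) (by linarith)
  set A : ℝ := (Real.Gamma (1 - κ))⁻¹ * ((Real.Gamma κ)⁻¹ * κ⁻¹) with hA
  have hA0 : 0 ≤ A := by positivity
  have hmd : Measurable (rpowDensity κ) := measurable_rpowDensity κ
  refine ⟨3 * (A + 1), by positivity, fun L hL => ?_⟩
  have hp : 0 < (1 + L) ^ (-κ) := by positivity
  rw [setLIntegral_rpowMeasure measurableSet_Ico (by fun_prop)]
  have h3 : (3 : ℝ) ^ κ ≤ 3 := by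
    calc (3 : ℝ) ^ κ ≤ 3 ^ (1 : ℝ) := Real.rpow_le_rpow_of_exponent_le (by norm_num) hκ1.le
      _ = 3 := Real.rpow_one 3
  rcases le_or_gt 2 L with h | h
  -- Away from the origin the density of exponent 1 - κ is O(L^{-κ}) on the window, and the
  -- singularity at w = L is integrable.
  · calc _ ≤ ∫⁻ w in Ico (L - 1) L, ENNReal.ofReal (rpowDensity (1 - κ) (L - 1)) *
          ENNReal.ofReal (rpowDensity κ (L - w)) := by
          refine (setLIntegral_mono' (measurableSet_Ico.inter measurableSet_Ioi)
            fun w hw => ?_).trans (lintegral_mono_set inter_subset_left)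
          gcongr
          exact rpowDensity_anti (by linarith) (by linarith) (by linarith) hw.1.1
      _ = ENNReal.ofReal (rpowDensity (1 - κ) (L - 1)) * rpowMeasure κ (Iic 1) := by
          rw [lintegral_const_mul _ (by fun_prop), rpowMeasure_apply measurableSet_Iic,
            Iic_inter_Ioi, ← lintegral_indicator measurableSet_Ico,
            ← lintegral_indicator measurableSet_Ioc]
          congr 1
          rw [← lintegral_sub_left_eq_self _ L]
          refine lintegral_congr fun x => ?_
          simp only [indicator, mem_Ico, mem_Ioc]
          have e1 : L - 1 ≤ L - x ∧ L - x < L ↔ 0 < x ∧ x ≤ 1 := by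
            constructor <;> rintro ⟨_, _⟩ <;> constructor <;> linarith
          simp only [e1, sub_sub_cancel]
      _ ≤ _ := by
          rw [rpowMeasure_Iic hκ zero_le_one, ← ENNReal.ofReal_mul
            (rpowDensity_nonneg (by linarith) (by linarith))]
          refine ENNReal.ofReal_le_ofReal ?_
          have e : (L - 1) ^ (-κ) ≤ 3 * (1 + L) ^ (-κ) := by
            calc (L - 1) ^ (-κ) ≤ ((1 + L) / 3) ^ (-κ) :=
                  Real.rpow_le_rpow_of_nonpos (by positivity) (by linarith) (by linarith)
              _ = 3 ^ κ * (1 + L) ^ (-κ) := by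
                  rw [Real.div_rpow (by positivity) (by norm_num), Real.rpow_neg (by norm_num : (0 : ℝ) ≤ 3),
                    div_inv_eq_mul, mul_comm]
              _ ≤ _ := by gcongr
          rw [rpowDensity, Real.one_rpow, show 1 - κ - 1 = -κ by ring]
          calc _ = A * (L - 1) ^ (-κ) := by rw [hA]; ring
            _ ≤ A * (3 * (1 + L) ^ (-κ)) := by gcongr
            _ ≤ _ := by nlinarith
  -- For bounded L the full convolution suffices: the exponents add to 1, so it equals 1.
  · calc _ ≤ ∫⁻ w in Ioo 0 L, ENNReal.ofReal (rpowDensity (1 - κ) w) *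
          ENNReal.ofReal (rpowDensity κ (L - w)) :=
          lintegral_mono_set fun w hw => ⟨hw.2, hw.1.2⟩
      _ = 1 := by
          rw [setLIntegral_rpowDensity_mul (by linarith) hκ hL, sub_add_cancel, rpowDensity]
          simp
      _ ≤ _ := by
          rw [← ENNReal.ofReal_one]
          refine ENNReal.ofReal_le_ofReal ?_
          have e : (1 / 3 : ℝ) ≤ (1 + L) ^ (-κ) := by
            calc (1 / 3 : ℝ) ≤ 3 ^ (-κ) := by
                  rw [Real.rpow_neg (by norm_num), one_div]
                  exact inv_anti₀ (by positivity) h3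
              _ ≤ _ := Real.rpow_le_rpow_of_nonpos (by linarith) (by linarith) (by linarith)
          nlinarith

/-- Comparison of the exponential means of `rpowMeasure κ` with its density. -/
lemma exists_expMeanENN_rpowMeasure_le {κ : ℝ} (hκ : 0 < κ) (hκ2 : κ ≤ 1 / 2) :
    ∃ A : ℝ, 0 ≤ A ∧ ∀ y : ℝ, 0 ≤ y →
      expMeanENN (rpowMeasure κ) y ≤ ENNReal.ofReal (rpowDensity κ y) +
        ENNReal.ofReal (A * (1 + y) ^ (-(3 / 2) : ℝ)) ∧
      ENNReal.ofReal (rpowDensity κ y) ≤ expMeanENN (rpowMeasure κ) y +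
        ENNReal.ofReal (A * (1 + y) ^ (-(3 / 2) : ℝ)) +
        (Ioc (0 : ℝ) 1).indicator (fun y => ENNReal.ofReal (rpowDensity κ y)) y := by
  obtain ⟨A, hA, h⟩ := exists_expMean_rpowMeasure_sub_le hκ hκ2
  obtain ⟨B, hB, htame, -⟩ := exists_tame_rpowMeasure hκ (by linarith)
  have hT := tameIntegralConst_pos hκ
  set D : ℝ := 16 * (tameIntegralConst κ * B) with hD
  have hD0 : 0 ≤ D := by positivity
  refine ⟨A + 8 * D, by positivity, fun y hy => ?_⟩
  have hm0 := rpowDensity_nonneg hκ hy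
  have hfin : expMeanENN (rpowMeasure κ) y < ∞ :=
    expMeanENN_lt_top one_pos (integrable_exp_rpowMeasure hκ one_pos) y
  have hp : 0 < (1 + y) ^ (-(3 / 2) : ℝ) := by positivity
  have hE : expMeanENN (rpowMeasure κ) y = ENNReal.ofReal (expMean (rpowMeasure κ) y) :=
    (ENNReal.ofReal_toReal hfin.ne).symm
  have hE0 := expMean_nonneg (rpowMeasure κ) y
  rcases le_or_gt 1 y with h1 | h1
  · have := abs_le.1 (h y h1)
    have hle : A * (1 + y) ^ (-(3 / 2) : ℝ) ≤ (A + 8 * D) * (1 + y) ^ (-(3 / 2) : ℝ) := by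
      gcongr; linarith
    rw [hE]
    constructor
    · rw [← ENNReal.ofReal_add hm0 (by positivity)]
      exact ENNReal.ofReal_le_ofReal (by linarith)
    · refine le_trans ?_ le_self_add
      rw [← ENNReal.ofReal_add hE0 (by positivity)]
      exact ENNReal.ofReal_le_ofReal (by linarith)
  · constructor
    · refine le_trans ?_ le_add_self
      refine (htame.expMeanENN_le hκ (by linarith) hB.le hy).trans (ENNReal.ofReal_le_ofReal ?_)
      have e1 : (1 + y) ^ (κ - 1) ≤ 1 :=
        Real.rpow_le_one_of_one_le_of_nonpos (by linarith) (by linarith)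
      have e2 : (1 / 8 : ℝ) ≤ (1 + y) ^ (-(3 / 2) : ℝ) := by
        calc (1 / 8 : ℝ) = 4 ^ (-(3 / 2) : ℝ) := by
              rw [show (4 : ℝ) = 2 ^ (2 : ℝ) by norm_num, ← Real.rpow_mul (by norm_num)]
              norm_num [Real.rpow_neg]
          _ ≤ _ := Real.rpow_le_rpow_of_nonpos (by linarith) (by linarith) (by norm_num)
      calc 16 * (tameIntegralConst κ * B * (1 + y) ^ (κ - 1)) = D * (1 + y) ^ (κ - 1) := by
            rw [hD]; ring
        _ ≤ D * 1 := by gcongr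
        _ ≤ _ := by nlinarith
    · rcases hy.eq_or_lt with rfl | hy0
      · rw [rpowDensity, Real.zero_rpow (by linarith)]
        simp
      · rw [indicator_of_mem (show y ∈ Ioc (0 : ℝ) 1 from ⟨hy0, h1.le⟩)]
        exact le_add_self

end

section

open MeasureTheory Set Filter Topology ProbabilityTheory
open scoped ENNReal Pointwise

/-- Scaling by L leaves no factor behind, since (n+2)(κ-1) + (n+1) = 0. As the parameters sum to 1,
the numerator Γ(1) is 1. -/
lemma dirichletDensity_simplexPoint {n : ℕ} {κ : ℝ} (hn : (n + 2) * κ = 1) {L : ℝ} (hL : 0 < L)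
    {t : Fin (n + 1) → ℝ} (ht : ∀ i, 0 ≤ t i) (ht1 : ∑ i, t i ≤ 1) :
    dirichletDensity (fun _ : Fin (n + 2) => κ) (simplexPoint (k := n + 2) t) =
      L ^ (n + 1) * ((∏ i, rpowDensity κ (L * t i)) * rpowDensity κ (L - ∑ i, L * t i)) := by
  have h1 : ∀ i : Fin (n + 1), simplexPoint (k := n + 2) t i.castSucc = t i := by
    intro i
    have : ((i.castSucc : Fin (n + 2)) : ℕ) < n + 2 - 1 := i.isLt
    rw [simplexPoint, dif_pos this]
    rfl
  have h2 : simplexPoint (k := n + 2) t (Fin.last (n + 1)) = 1 - ∑ i, t i := by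
    simp [simplexPoint]
  have h3 : L - ∑ i, L * t i = L * (1 - ∑ i, t i) := by rw [← Finset.mul_sum]; ring
  have h4 : L ^ (n + 1) * (L ^ (κ - 1)) ^ (n + 2) = 1 := by
    rw [← Real.rpow_natCast, ← Real.rpow_natCast, ← Real.rpow_mul hL.le, ← Real.rpow_add hL]
    push_cast
    rw [show (n : ℝ) + 1 + (κ - 1) * (n + 2) = (n + 2) * κ - 1 by ring, hn]
    simp
  simp only [dirichletDensity, rpowDensity]
  rw [Fin.prod_univ_castSucc (fun i => simplexPoint (k := n + 2) t i ^ (κ - 1)), h2, h3,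
    Real.mul_rpow hL.le (by linarith)]
  simp_rw [h1, Real.mul_rpow hL.le (ht _)]
  have h5 : ∑ _i : Fin (n + 2), κ = 1 := by simp [← hn]
  rw [h5, Real.Gamma_one, Finset.prod_div_distrib, Finset.prod_mul_distrib]
  simp only [Finset.prod_const, Finset.card_univ, Fintype.card_fin]
  calc _ = (L ^ (n + 1) * (L ^ (κ - 1)) ^ (n + 2)) *
      (1 / Real.Gamma κ ^ (n + 2) * ((∏ i, t i ^ (κ - 1)) * (1 - ∑ i, t i) ^ (κ - 1))) := by
        rw [h4, one_mul]
    _ = _ := by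
        rw [pow_succ (L ^ (κ - 1)), pow_succ (Real.Gamma κ)]
        simp only [div_eq_mul_inv, mul_inv]
        ring

lemma dirichletCDF_eq {n : ℕ} {κ : ℝ} (hn : (n + 2) * κ = 1) {L : ℝ} (hL : 0 < L)
    {u : Fin (n + 1) → ℝ} (hu1 : ∑ i, u i ≤ 1) :
    dirichletCDF (k := n + 2) (fun _ => κ) u = ∫ v in Icc (0 : Fin (n + 1) → ℝ) (L • u),
      (∏ i, rpowDensity κ (v i)) * rpowDensity κ (L - ∑ i, v i) := by
  set h : (Fin (n + 1) → ℝ) → ℝ := fun v =>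
    (∏ i, rpowDensity κ (v i)) * rpowDensity κ (L - ∑ i, v i) with hh
  have e1 : dirichletCDF (k := n + 2) (fun _ => κ) u =
      ∫ t in Icc (0 : Fin (n + 1) → ℝ) u, L ^ (n + 1) * h (L • t) := by
    refine setIntegral_congr_fun measurableSet_Icc fun t ht => ?_
    exact dirichletDensity_simplexPoint hn hL (fun i => ht.1 i)
      ((Finset.sum_le_sum fun i _ => ht.2 i).trans hu1)
  have e2 : L • Icc (0 : Fin (n + 1) → ℝ) u = Icc (0 : Fin (n + 1) → ℝ) (L • u) := by
    ext v
    rw [Set.mem_smul_set_iff_inv_smul_mem₀ hL.ne']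
    simp only [mem_Icc, Pi.le_def, Pi.zero_apply, Pi.smul_apply, smul_eq_mul]
    refine and_congr (forall_congr' fun i => ?_) (forall_congr' fun i => ?_)
    · exact mul_nonneg_iff_of_pos_left (inv_pos.2 hL)
    · rw [inv_mul_le_iff₀ hL]
  rw [e1, integral_const_mul, Measure.setIntegral_comp_smul_of_pos volume h _ hL, e2, smul_eq_mul,
    Module.finrank_fintype_fun_eq_card, Fintype.card_fin, ← mul_assoc, mul_inv_cancel₀ (by positivity),
    one_mul]

lemma pi_rpowMeasure (κ : ℝ) (n : ℕ) : Measure.pi (fun _ : Fin n => rpowMeasure κ) =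
    volume.withDensity fun t : Fin n → ℝ =>
      ∏ i, (Ioi (0 : ℝ)).indicator (fun v => ENNReal.ofReal (rpowDensity κ v)) (t i) := by
  have : SigmaFinite (volume.withDensity
      ((Ioi 0).indicator fun v => ENNReal.ofReal (rpowDensity κ v))) := by
    rw [← rpowMeasure_eq_withDensity]; infer_instance
  simp_rw [rpowMeasure_eq_withDensity]
  exact pi_withDensity (fun _ : Fin n => (volume : Measure ℝ))
    (f := fun _ => (Ioi 0).indicator fun v => ENNReal.ofReal (rpowDensity κ v)) fun _ => measurable_indicator_rpowDensity κ

/-- The variable w is the sum of the first n + 1 coordinates, and the last density is evaluated at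
what is left of L. Finiteness is required because `dirichletCDF` is a Bochner integral, which a
divergent integrand would send to 0. -/
lemma lintegral_sumPi_rpowMeasure {n : ℕ} {κ : ℝ} (hκ : 0 < κ) (hn : (n + 2) * κ = 1) {L : ℝ}
    (hL : 0 < L) {u : Fin (n + 1) → ℝ} (hu1 : ∑ i, u i ≤ 1)
    (hfin : ∫⁻ w, ENNReal.ofReal (rpowDensity κ (L - w))
      ∂(sumPi fun i => (rpowMeasure κ).restrict (Iic (L * u i))) ≠ ∞) :
    ∫⁻ w, ENNReal.ofReal (rpowDensity κ (L - w))
      ∂(sumPi fun i => (rpowMeasure κ).restrict (Iic (L * u i))) =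
      ENNReal.ofReal (dirichletCDF (k := n + 2) (fun _ => κ) u) := by
  have hκ1 : κ < 1 := by nlinarith [(Nat.cast_nonneg n : (0 : ℝ) ≤ n)]
  have hmd : Measurable (rpowDensity κ) := measurable_rpowDensity κ
  have hm0 : rpowDensity κ 0 = 0 := by
    rw [rpowDensity, Real.zero_rpow (by linarith), zero_div]
  have e : ∫⁻ w, ENNReal.ofReal (rpowDensity κ (L - w))
      ∂(sumPi fun i => (rpowMeasure κ).restrict (Iic (L * u i))) =
      ∫⁻ v in Icc (0 : Fin (n + 1) → ℝ) (L • u), ENNReal.ofReal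
        ((∏ i, rpowDensity κ (v i)) * rpowDensity κ (L - ∑ i, v i)) := by
    have hS : MeasurableSet (Set.univ.pi fun i : Fin (n + 1) => Iic (L * u i)) :=
      MeasurableSet.univ_pi fun i => measurableSet_Iic
    have hmD : Measurable fun t : Fin (n + 1) → ℝ =>
        ∏ i, (Ioi (0 : ℝ)).indicator (fun v => ENNReal.ofReal (rpowDensity κ v)) (t i) :=
      Finset.measurable_fun_prod _ fun i _ =>
        (measurable_indicator_rpowDensity κ).comp (measurable_pi_apply i)
    rw [lintegral_sumPi _ (by fun_prop), ← Measure.restrict_pi_pi, pi_rpowMeasure,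
      restrict_withDensity hS, lintegral_withDensity_eq_lintegral_mul _ hmD (by fun_prop),
      ← lintegral_indicator hS, ← lintegral_indicator measurableSet_Icc]
    refine lintegral_congr fun t => ?_
    by_cases h1 : t ∈ Set.univ.pi fun i : Fin (n + 1) => Iic (L * u i)
    · by_cases h2 : ∀ i, 0 ≤ t i
      · have h3 : t ∈ Icc (0 : Fin (n + 1) → ℝ) (L • u) := ⟨h2, fun i => h1 i (mem_univ i)⟩
        rw [indicator_of_mem h1, indicator_of_mem h3, Pi.mul_apply, ENNReal.ofReal_mul
          (Finset.prod_nonneg fun i _ => rpowDensity_nonneg hκ (h2 i)),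
          ENNReal.ofReal_prod_of_nonneg fun i _ => rpowDensity_nonneg hκ (h2 i)]
        congr 1
        refine Finset.prod_congr rfl fun i _ => ?_
        rcases (h2 i).eq_or_lt with h4 | h4
        · rw [← h4, hm0]; simp
        · rw [indicator_of_mem (mem_Ioi.2 h4)]
      · rw [indicator_of_mem h1, indicator_of_notMem fun h3 => h2 h3.1, Pi.mul_apply]
        push Not at h2
        obtain ⟨i, hi⟩ := h2
        rw [Finset.prod_eq_zero (Finset.mem_univ i), zero_mul]
        exact indicator_of_notMem (by simpa using hi.le) _
    · rw [indicator_of_notMem h1, indicator_of_notMem fun h3 => h1 fun i _ => h3.2 i]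
  rw [e, dirichletCDF_eq hn hL hu1, integral_eq_lintegral_of_nonneg_ae, ENNReal.ofReal_toReal]
  · rwa [← e]
  · filter_upwards [ae_restrict_mem measurableSet_Icc] with v hv
    refine mul_nonneg (Finset.prod_nonneg fun i _ => rpowDensity_nonneg hκ (hv.1 i))
      (rpowDensity_nonneg hκ ?_)
    have : ∑ i, v i ≤ ∑ i, L * u i := Finset.sum_le_sum fun i _ => hv.2 i
    rw [← Finset.mul_sum] at this
    nlinarith
  · exact (Measurable.mul (Finset.measurable_fun_prod _ fun i _ => hmd.comp (measurable_pi_apply i))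
      (by fun_prop)).aestronglyMeasurable

/-- The continuous model: the exponential means of truncated powers approximate the Dirichlet
distribution function. -/
lemma exists_sumPi_rpowMeasure_le {n : ℕ} {κ : ℝ} (hκ : 0 < κ) (hn : (n + 2) * κ = 1) :
    ∃ C : ℝ, 0 ≤ C ∧ ∀ (L : ℝ) (u : Fin (n + 1) → ℝ), 0 < L → (∀ i, 0 ≤ u i) → ∑ i, u i ≤ 1 →
      expMeanENN (sumPi fun i : Fin (n + 2) => (rpowMeasure κ).restrict
        (Iic (Fin.snoc (α := fun _ => ℝ) (fun j => L * u j) L i))) L ≤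
        ENNReal.ofReal (dirichletCDF (k := n + 2) (fun _ => κ) u) +
          ENNReal.ofReal (C * (1 + L) ^ (-κ)) ∧
      ENNReal.ofReal (dirichletCDF (k := n + 2) (fun _ => κ) u) ≤
        expMeanENN (sumPi fun i : Fin (n + 2) => (rpowMeasure κ).restrict
          (Iic (Fin.snoc (α := fun _ => ℝ) (fun j => L * u j) L i))) L +
          ENNReal.ofReal (C * (1 + L) ^ (-κ)) := by
  have hn0 : (0 : ℝ) ≤ n := Nat.cast_nonneg n
  have hκ2 : κ ≤ 1 / 2 := by nlinarith
  have hκn : (n + 1) * κ = 1 - κ := by linarith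
  obtain ⟨K, hK, htK, -⟩ := exists_tame_rpowMeasure hκ (by linarith)
  obtain ⟨C₁, hC₁, htame⟩ := exists_tame_sumPi hκ hK.le n (by linarith)
  obtain ⟨A, hA, hAb⟩ := exists_expMeanENN_rpowMeasure_le hκ hκ2
  obtain ⟨C₂, hC₂, hnear⟩ := exists_setLIntegral_Ico_le hκ (by linarith)
  have hT := tameIntegralConst_pos (α := 1 - κ) (by linarith)
  have hmd : Measurable (rpowDensity κ) := measurable_rpowDensity κ
  refine ⟨A * (tameIntegralConst (1 - κ) * C₁) + C₂, by positivity, fun L u hL hu hu1 => ?_⟩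
  set η := sumPi fun i : Fin (n + 1) => (rpowMeasure κ).restrict (Iic (L * u i)) with hη
  have hηt : TameMeasure (1 - κ) C₁ η := by
    rw [← hκn]
    exact htame _ (fun _ => inferInstance) fun _ => htK.mono Measure.restrict_le_self
  have hη0 : ∀ᵐ w ∂η, 0 ≤ w := by
    rw [ae_iff]
    simp only [not_le]
    exact hηt.null
  have hηL : ∀ᵐ w ∂η, w ∈ Iic L := by
    rw [hη, sumPi, ae_map_iff (p := fun w => w ∈ Iic L) (measurable_sum_fin _).aemeasurable
      measurableSet_Iic,
      ← Measure.restrict_pi_pi]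
    filter_upwards [ae_restrict_mem (MeasurableSet.univ_pi fun i => measurableSet_Iic)] with t ht
    have : ∑ i, t i ≤ ∑ i, L * u i := Finset.sum_le_sum fun i _ => ht i (mem_univ i)
    rw [← Finset.mul_sum] at this
    simp only [mem_Iic]
    nlinarith
  -- The truncation of the last coordinate at L is vacuous, because the sum w of the other
  -- coordinates is nonnegative.
  have hQ : expMeanENN (sumPi fun i : Fin (n + 2) => (rpowMeasure κ).restrict
        (Iic (Fin.snoc (α := fun _ => ℝ) (fun j => L * u j) L i))) L =
      ∫⁻ w, expMeanENN (rpowMeasure κ) (L - w) ∂η := by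
    rw [sumPi_succAbove _ (Fin.last (n + 1))]
    simp only [Fin.succAbove_last, Fin.snoc_last, Fin.snoc_castSucc]
    rw [expMeanENN_restrict_conv, ← hη]
    refine lintegral_congr_ae ?_
    filter_upwards [hη0] with w hw
    rw [min_eq_right (by linarith), show w + (L - w) - L = 0 by ring]
    simp
  have herr : ∫⁻ w, ENNReal.ofReal (A * (1 + (L - w)) ^ (-(3 / 2) : ℝ)) ∂η ≤
      ENNReal.ofReal (A * (tameIntegralConst (1 - κ) * C₁) * (1 + L) ^ (-κ)) := by
    have h := hηt.lintegral_le (by linarith) (by linarith) hC₁ hL.le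
    rw [Measure.restrict_eq_self_of_ae_mem hηL, show 1 - κ - 1 = -κ by ring] at h
    simp_rw [ENNReal.ofReal_mul hA]
    rw [lintegral_const_mul _ (by fun_prop), mul_assoc, ENNReal.ofReal_mul hA]
    exact mul_le_mul_right h _
  -- Window masses alone cannot control the singularity at w = L. The law η is dominated by its
  -- untruncated version, which by the semigroup property has an explicit density.
  have hnr : ∫⁻ w, (Ioc (0 : ℝ) 1).indicator (fun y => ENNReal.ofReal (rpowDensity κ y)) (L - w) ∂η ≤
      ENNReal.ofReal (C₂ * (1 + L) ^ (-κ)) := by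
    have hle : η ≤ rpowMeasure (1 - κ) := by
      rw [← hκn, ← sumPi_rpowMeasure hκ]
      exact sumPi_restrict_le _ _
    refine (lintegral_mono' hle le_rfl).trans (le_of_eq_of_le ?_ (hnear L hL))
    rw [← lintegral_indicator measurableSet_Ico]
    refine lintegral_congr fun w => ?_
    have e1 : 0 < L - w ∧ L - w ≤ 1 ↔ L - 1 ≤ w ∧ w < L := by
      constructor <;> rintro ⟨_, _⟩ <;> constructor <;> linarith
    simp only [indicator, mem_Ioc, mem_Ico, e1]
  have hEm : Measurable fun w => expMeanENN (rpowMeasure κ) (L - w) :=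
    (measurable_expMeanENN _).comp (by fun_prop)
  have hind : Measurable fun w : ℝ =>
      (Ioc (0 : ℝ) 1).indicator (fun y => ENNReal.ofReal (rpowDensity κ y)) (L - w) :=
    (hmd.ennreal_ofReal.indicator measurableSet_Ioc).comp (by fun_prop)
  have hp : 0 < (1 + L) ^ (-κ) := by positivity
  have hsum : ENNReal.ofReal ((A * (tameIntegralConst (1 - κ) * C₁) + C₂) * (1 + L) ^ (-κ)) =
      ENNReal.ofReal (A * (tameIntegralConst (1 - κ) * C₁) * (1 + L) ^ (-κ)) +
      ENNReal.ofReal (C₂ * (1 + L) ^ (-κ)) := by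
    rw [add_mul, ENNReal.ofReal_add (by positivity) (by positivity)]
  have hupper : ∫⁻ w, expMeanENN (rpowMeasure κ) (L - w) ∂η ≤
      ∫⁻ w, ENNReal.ofReal (rpowDensity κ (L - w)) ∂η +
        ENNReal.ofReal ((A * (tameIntegralConst (1 - κ) * C₁) + C₂) * (1 + L) ^ (-κ)) := by
    rw [hsum, ← add_assoc]
    refine le_trans ?_ le_self_add
    refine le_trans ?_ (add_le_add le_rfl herr)
    rw [← lintegral_add_left (by fun_prop)]
    refine lintegral_mono_ae ?_
    filter_upwards [hηL] with w hw
    exact (hAb (L - w) (sub_nonneg.2 hw)).1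
  have hlower : ∫⁻ w, ENNReal.ofReal (rpowDensity κ (L - w)) ∂η ≤
      ∫⁻ w, expMeanENN (rpowMeasure κ) (L - w) ∂η +
        ENNReal.ofReal ((A * (tameIntegralConst (1 - κ) * C₁) + C₂) * (1 + L) ^ (-κ)) := by
    rw [hsum, ← add_assoc]
    refine le_trans ?_ (add_le_add (add_le_add le_rfl herr) hnr)
    rw [← lintegral_add_left hEm, ← lintegral_add_right _ hind]
    refine lintegral_mono_ae ?_
    filter_upwards [hηL] with w hw
    exact (hAb (L - w) (sub_nonneg.2 hw)).2
  -- Exponential means are bounded and η is finite; through `hlower` this gives the finiteness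
  -- needed to recognize the Dirichlet integral.
  have hEfin : ∫⁻ w, expMeanENN (rpowMeasure κ) (L - w) ∂η ≠ ∞ := by
    refine ne_top_of_le_ne_top ?_ (lintegral_mono_ae (g := fun _ =>
      ENNReal.ofReal (16 * (tameIntegralConst κ * K))) ?_)
    · rw [lintegral_const]
      refine ENNReal.mul_ne_top ENNReal.ofReal_ne_top ?_
      have h := hηt.measure_Iic_le (by linarith) (by linarith) hC₁ hL.le
      rw [← Measure.restrict_apply_univ, Measure.restrict_eq_self_of_ae_mem hηL] at h
      exact ne_top_of_le_ne_top ENNReal.ofReal_ne_top h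
    · filter_upwards [hηL] with w hw
      have hw : w ≤ L := hw
      refine (htK.expMeanENN_le hκ (by linarith) hK.le (sub_nonneg.2 hw)).trans
        (ENNReal.ofReal_le_ofReal ?_)
      have hT' := tameIntegralConst_pos hκ
      have e1 : (1 + (L - w)) ^ (κ - 1) ≤ 1 :=
        Real.rpow_le_one_of_one_le_of_nonpos (by linarith) (by linarith)
      have := mul_le_of_le_one_right (by positivity : 0 ≤ tameIntegralConst κ * K) e1
      linarith
  have hFfin : ∫⁻ w, ENNReal.ofReal (rpowDensity κ (L - w)) ∂η ≠ ∞ :=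
    ne_top_of_le_ne_top (ENNReal.add_ne_top.2 ⟨hEfin, ENNReal.ofReal_ne_top⟩) hlower
  rw [hQ, ← lintegral_sumPi_rpowMeasure hκ hn hL hu1 hFfin]
  exact ⟨hupper, hlower⟩

end

section

open MeasureTheory Set Filter Topology
open scoped ENNReal

/-! ### Sums over ordered factorizations as integrals -/

lemma TameMeasure.sigmaFinite {α C : ℝ} {θ : Measure ℝ} (h : TameMeasure α C θ) (hα : 0 < α)
    (hα1 : α ≤ 1) (hC : 0 ≤ C) : SigmaFinite θ :=
  ⟨⟨{ set := fun n => Iic (n : ℝ)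
      set_mem := fun _ => trivial
      finite := fun n => (h.measure_Iic_le hα hα1 hC (Nat.cast_nonneg n)).trans_lt
        ENNReal.ofReal_lt_top
      spanning := iUnion_eq_univ_iff.2 fun x => exists_nat_ge x }⟩⟩

/-- The measure is the image under log of a weighted counting measure on ℕ. The product measure then
comes from a countable space, where integrals are sums over points. -/
lemma lintegral_pi_rootMeasure (k n : ℕ) [SigmaFinite (rootMeasure k)]
    {G : (Fin n → ℝ) → ℝ≥0∞} (hG : Measurable G) :
    ∫⁻ t, G t ∂(Measure.pi fun _ : Fin n => rootMeasure k) =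
      ∑' d : Fin n → ℕ, G (fun i => Real.log (d i)) *
        ∏ i, ENNReal.ofReal (rootZeta k (d i) / d i) := by
  set M : Measure ℕ :=
    Measure.sum fun n : ℕ => ENNReal.ofReal (rootZeta k n / n) • Measure.dirac n with hM
  have hlog : Measurable fun n : ℕ => Real.log n := measurable_from_top
  have hmap : rootMeasure k = M.map fun n : ℕ => Real.log n := by
    rw [hM, Measure.map_sum hlog.aemeasurable, rootMeasure]
    congr 1
    funext n
    rw [Measure.map_smul, Measure.map_dirac' hlog]
  have hσ : SigmaFinite (M.map fun n : ℕ => Real.log n) := hmap ▸ inferInstance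
  have hσM : SigmaFinite M := hσ.of_map _ hlog.aemeasurable
  have hMs : ∀ m : ℕ, M {m} = ENNReal.ofReal (rootZeta k m / m) := by
    intro m
    rw [hM, Measure.sum_apply _ (measurableSet_singleton m), tsum_eq_single m]
    · simp
    · intro j hj
      simp [hj]
  have hpi : (Measure.pi fun _ : Fin n => rootMeasure k) =
      (Measure.pi fun _ : Fin n => M).map fun d i => Real.log (d i) := by
    rw [Measure.pi_map_pi (μ := fun _ : Fin n => M) (f := fun _ m => Real.log (m : ℕ))
      fun _ => hlog.aemeasurable, hmap]
  have hlogs : Measurable fun (d : Fin n → ℕ) i => Real.log (d i) :=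
    measurable_pi_lambda _ fun i => hlog.comp (measurable_pi_apply i)
  rw [hpi, lintegral_map hG hlogs, lintegral_countable']
  refine tsum_congr fun d => ?_
  rw [Measure.pi_singleton]
  simp_rw [hMs]

/-- Integrals over the simplex `∑ t ≤ log x` as sums over ordered factorizations. -/
lemma lintegral_pi_rootMeasure_eq_sum (k n : ℕ) [SigmaFinite (rootMeasure k)] {x : ℝ} (hx : 1 ≤ x)
    {G : (Fin n → ℝ) → ℝ≥0∞} (hG : Measurable G) (hG0 : ∀ t, Real.log x < ∑ i, t i → G t = 0) :
    ∫⁻ t, G t ∂(Measure.pi fun _ : Fin n => rootMeasure k) =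
      ∑ N ∈ Finset.Icc 1 ⌊x⌋₊, ∑ d ∈ Nat.finMulAntidiag n N,
        ENNReal.ofReal ((∏ i, rootZeta k (d i)) / N) * G (fun i => Real.log (d i)) := by
  have hterm : ∀ N, ∀ d ∈ Nat.finMulAntidiag n N,
      ENNReal.ofReal ((∏ i, rootZeta k (d i)) / N) * G (fun i => Real.log (d i)) =
        G (fun i => Real.log (d i)) * ∏ i, ENNReal.ofReal (rootZeta k (d i) / d i) := by
    intro N d hd
    rw [← ENNReal.ofReal_prod_of_nonneg
      fun i _ => div_nonneg (rootZeta_nonneg k _) (Nat.cast_nonneg _), Finset.prod_div_distrib,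
      ← Nat.cast_prod, Nat.prod_eq_of_mem_finMulAntidiag hd, mul_comm]
  rw [lintegral_pi_rootMeasure k n hG,
    Finset.sum_congr rfl fun N _ => Finset.sum_congr rfl (hterm N), ← Finset.sum_biUnion]
  · refine tsum_eq_sum fun d hd => ?_
    by_cases h0 : ∀ i, d i ≠ 0
    · rw [hG0, zero_mul]
      by_contra hle
      refine hd (Finset.mem_biUnion.2 ⟨∏ i, d i, Finset.mem_Icc.2 ⟨?_, ?_⟩,
        Nat.mem_finMulAntidiag.2 ⟨rfl, Finset.prod_ne_zero_iff.2 fun i _ => h0 i⟩⟩)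
      · exact Nat.one_le_iff_ne_zero.2 (Finset.prod_ne_zero_iff.2 fun i _ => h0 i)
      · have hpos : (0 : ℝ) < ((∏ i, d i : ℕ) : ℝ) := by
          exact_mod_cast Nat.pos_of_ne_zero (Finset.prod_ne_zero_iff.2 fun i _ => h0 i)
        refine Nat.le_floor ((Real.log_le_log_iff hpos (by linarith)).1 ?_)
        rw [Nat.cast_prod, Real.log_prod fun i _ => Nat.cast_ne_zero.2 (h0 i)]
        exact not_lt.1 hle
    -- Tuples with a zero entry, which the convention log 0 = 0 could place in the simplex, have
    -- weight zero.
    · push Not at h0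
      obtain ⟨i, hi⟩ := h0
      rw [Finset.prod_eq_zero (Finset.mem_univ i) (by simp [hi]), mul_zero]
  · intro N _ N' _ hne
    refine Finset.disjoint_left.2 fun d hd hd' => hne ?_
    rw [← Nat.prod_eq_of_mem_finMulAntidiag hd, Nat.prod_eq_of_mem_finMulAntidiag hd']

end

section

open scoped Classical

/-! ### Uniform and weighted ordered factorizations -/

/-- Each factor splits uniquely as gcd(d_i, q) · gcd(d_i, s). The two products divide q and s and
multiply to qs, so they are equal to q and s. -/
lemma Nat.sum_finMulAntidiag_mul {M : Type*} [AddCommMonoid M] {k q s : ℕ} (h : q.Coprime s)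
    (f : (Fin k → ℕ) → M) :
    ∑ d ∈ finMulAntidiag k (q * s), f d =
      ∑ c ∈ finMulAntidiag k s, ∑ e ∈ finMulAntidiag k q, f (e * c) := by
  rw [← Finset.sum_product']
  symm
  refine Finset.sum_bij' (fun p _ => p.2 * p.1)
    (fun d _ => (fun i => (d i).gcd s, fun i => (d i).gcd q)) ?_ ?_ ?_ ?_ ?_
  · rintro ⟨c, e⟩ hp
    rw [Finset.mem_product, mem_finMulAntidiag, mem_finMulAntidiag] at hp
    rw [mem_finMulAntidiag]
    exact ⟨by rw [← hp.1.1, ← hp.2.1, ← Finset.prod_mul_distrib]; rfl,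
      mul_ne_zero hp.2.2 hp.1.2⟩
  · intro d hd
    rw [mem_finMulAntidiag] at hd
    have h0 := mul_ne_zero_iff.1 hd.2
    have hd' : ∀ i, (d i).gcd q * (d i).gcd s = d i := by
      intro i
      rw [← h.gcd_mul, Nat.gcd_eq_left]
      rw [← hd.1]
      exact Finset.dvd_prod_of_mem d (Finset.mem_univ i)
    have hprod : (∏ i, (d i).gcd q) * ∏ i, (d i).gcd s = q * s := by
      rw [← Finset.prod_mul_distrib, ← hd.1]
      exact Finset.prod_congr rfl fun i _ => hd' i
    have hA : (∏ i, (d i).gcd q) ∣ q := by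
      refine Nat.Coprime.dvd_of_dvd_mul_right (n := s) ?_ (hprod ▸ Dvd.intro _ rfl)
      exact Nat.Coprime.prod_left fun i _ => h.coprime_dvd_left (Nat.gcd_dvd_right _ _)
    have hB : (∏ i, (d i).gcd s) ∣ s := by
      refine Nat.Coprime.dvd_of_dvd_mul_left (m := q) ?_ (hprod ▸ Dvd.intro_left _ rfl)
      exact Nat.Coprime.prod_left fun i _ => h.symm.coprime_dvd_left (Nat.gcd_dvd_right _ _)
    have hAle := Nat.le_of_dvd (Nat.pos_of_ne_zero h0.1) hA
    have hBle := Nat.le_of_dvd (Nat.pos_of_ne_zero h0.2) hB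
    have hq : 0 < q := Nat.pos_of_ne_zero h0.1
    have hs : 0 < s := Nat.pos_of_ne_zero h0.2
    rw [Finset.mem_product, mem_finMulAntidiag, mem_finMulAntidiag]
    refine ⟨⟨?_, h0.2⟩, ?_, h0.1⟩
    · refine le_antisymm hBle (Nat.le_of_mul_le_mul_left ?_ hq)
      rw [← hprod]; exact Nat.mul_le_mul_right _ hAle
    · refine le_antisymm hAle (Nat.le_of_mul_le_mul_right ?_ hs)
      rw [← hprod]; exact Nat.mul_le_mul_left _ hBle
  · rintro ⟨c, e⟩ hp
    rw [Finset.mem_product] at hp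
    have hc := fun i => dvd_of_mem_finMulAntidiag hp.1 i
    have he := fun i => dvd_of_mem_finMulAntidiag hp.2 i
    refine Prod.ext (funext fun i => ?_) (funext fun i => ?_)
    · change (e i * c i).gcd s = c i
      rw [Nat.Coprime.gcd_mul_left_cancel _ (h.coprime_dvd_left (he i)), Nat.gcd_eq_left (hc i)]
    · change (e i * c i).gcd q = e i
      rw [Nat.Coprime.gcd_mul_right_cancel _ (h.symm.coprime_dvd_left (hc i)),
        Nat.gcd_eq_left (he i)]
  · intro d hd
    rw [mem_finMulAntidiag] at hd
    funext i
    change (d i).gcd q * (d i).gcd s = d i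
    rw [← h.gcd_mul, Nat.gcd_eq_left]
    rw [← hd.1]
    exact Finset.dvd_prod_of_mem d (Finset.mem_univ i)
  · intros; rfl

lemma tauK_mul {k q s : ℕ} (h : q.Coprime s) : tauK k (q * s) = tauK k s * tauK k q := by
  simp only [tauK, Finset.card_eq_sum_ones]
  simp only [Nat.sum_finMulAntidiag_mul h, Finset.sum_mul_sum, mul_one]

lemma tauK_ne_zero {k n : ℕ} (hk : k ≠ 0) (hn : n ≠ 0) : tauK k n ≠ 0 := by
  obtain ⟨k, rfl⟩ := Nat.exists_eq_succ_of_ne_zero hk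
  refine Finset.card_ne_zero.2 ⟨Fin.cons n fun _ => 1, ?_⟩
  rw [Nat.mem_finMulAntidiag, Fin.prod_univ_succ]
  simp [hn]

/-- The factors of a squarefree number are pairwise coprime, so by multiplicativity every
factorization has the same weight. The weights sum to 1. -/
lemma prod_rootZeta_of_squarefree {k s : ℕ} (hk : k ≠ 0) (hs : Squarefree s) {c : Fin k → ℕ}
    (hc : c ∈ Nat.finMulAntidiag k s) : ∏ i, rootZeta k (c i) = 1 / (tauK k s : ℝ) := by
  have hval : ∀ c ∈ Nat.finMulAntidiag k s, ∏ i, rootZeta k (c i) = rootZeta k s := by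
    intro c hc
    have hprod := Nat.prod_eq_of_mem_finMulAntidiag hc
    rw [← (rootZeta_isMultiplicative k).map_prod _ _, hprod]
    intro i _ j _ hij
    refine Nat.coprime_of_squarefree_mul (hs.squarefree_of_dvd ?_)
    rw [← hprod, ← Finset.prod_pair hij]
    exact Finset.prod_dvd_prod_of_subset _ _ _ (Finset.subset_univ _)
  have h1 := sum_prod_rootZeta hk hs.ne_zero
  rw [Finset.sum_congr rfl hval, Finset.sum_const, nsmul_eq_mul] at h1
  rw [hval c hc, eq_div_iff (Nat.cast_ne_zero.2 (tauK_ne_zero hk hs.ne_zero)), mul_comm]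
  exact h1

lemma prod_rootZeta_mul {k q s : ℕ} (h : q.Coprime s) {c e : Fin k → ℕ}
    (hc : c ∈ Nat.finMulAntidiag k s) (he : e ∈ Nat.finMulAntidiag k q) :
    ∏ i, rootZeta k ((e * c) i) = (∏ i, rootZeta k (c i)) * ∏ i, rootZeta k (e i) := by
  rw [← Finset.prod_mul_distrib]
  refine Finset.prod_congr rfl fun i _ => ?_
  rw [Pi.mul_apply, (rootZeta_isMultiplicative k).map_mul_of_coprime, mul_comm]
  exact (h.coprime_dvd_left (Nat.dvd_of_mem_finMulAntidiag he i)).coprime_dvd_right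
    (Nat.dvd_of_mem_finMulAntidiag hc i)

/-- The weighted proportion of ordered factorizations `d` of `N` with `d i ≤ T i` for all `i`
but the last. -/
noncomputable def weightedCDF (n : ℕ) (T : Fin (n + 1) → ℝ) (N : ℕ) : ℝ :=
  ∑ d ∈ Nat.finMulAntidiag (n + 2) N,
    (∏ j, rootZeta (n + 2) (d j)) * if ∀ i : Fin (n + 1), (d i.castSucc : ℝ) ≤ T i then 1 else 0

lemma factorizationCDF_eq {n N : ℕ} (hN : N ≠ 0) (u : Fin (n + 1) → ℝ) :
    factorizationCDF (n + 2) N u = ∑ d ∈ Nat.finMulAntidiag (n + 2) N,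
      1 / (tauK (n + 2) N : ℝ) *
        if ∀ i : Fin (n + 1), (d i.castSucc : ℝ) ≤ (N : ℝ) ^ u i then 1 else 0 := by
  rw [← Finset.mul_sum, Finset.sum_boole, factorizationCDF]
  congr 2
  refine Finset.card_bij' (fun d _ => Fin.snoc (α := fun _ => ℕ) d (N / ∏ i, d i))
    (fun d _ => Fin.init d) ?_ ?_ ?_ ?_
  · intro d hd
    rw [smallTuples, Finset.mem_filter] at hd
    rw [Finset.mem_filter, Nat.mem_finMulAntidiag, Fin.prod_univ_castSucc]
    simp only [Fin.snoc_castSucc, Fin.snoc_last]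
    exact ⟨⟨Nat.mul_div_cancel' hd.2.1, hN⟩, hd.2.2⟩
  · intro d hd
    rw [Finset.mem_filter, Nat.mem_finMulAntidiag, Fin.prod_univ_castSucc] at hd
    rw [smallTuples, Finset.mem_filter, Fintype.mem_piFinset]
    have hdvd : (∏ i : Fin (n + 1), d i.castSucc) ∣ N := by
      rw [← hd.1.1]; exact Dvd.intro _ rfl
    refine ⟨fun i => Nat.mem_divisors.2 ⟨?_, hN⟩, hdvd, hd.2⟩
    exact (Finset.dvd_prod_of_mem (fun i : Fin (n + 1) => d i.castSucc) (Finset.mem_univ i)).trans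
      hdvd
  · intro d _
    exact Fin.init_snoc (α := fun _ => ℕ) _ _
  · intro d hd
    rw [Finset.mem_filter, Nat.mem_finMulAntidiag, Fin.prod_univ_castSucc] at hd
    have h0 : 0 < ∏ i : Fin (n + 1), d i.castSucc :=
      Nat.pos_of_ne_zero (left_ne_zero_of_mul (hd.1.1.symm ▸ hN))
    have : N / ∏ i : Fin (n + 1), d i.castSucc = d (Fin.last (n + 1)) := by
      rw [← hd.1.1, Nat.mul_div_cancel_left _ h0]
    change Fin.snoc (α := fun _ => ℕ) (Fin.init d) (N / ∏ i : Fin (n + 1), d i.castSucc) = d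
    rw [this]
    exact Fin.snoc_init_self d

/-- The uniform and the weighted proportions differ only through the borderline factorizations of
the squarefree part. -/
lemma abs_factorizationCDF_sub_le {n q s : ℕ} (hqs : q.Coprime s) (hs : Squarefree s) (hq : q ≠ 0)
    {x : ℝ} (hx : ((q * s : ℕ) : ℝ) ≤ x) {u : Fin (n + 1) → ℝ} (hu : ∀ i, 0 ≤ u i)
    (hu1 : ∀ i, u i ≤ 1) :
    |factorizationCDF (n + 2) (q * s) u - weightedCDF n (fun i => x ^ u i) (q * s)| ≤
      ∑ i : Fin (n + 1), ∑ c ∈ Nat.finMulAntidiag (n + 2) s,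
        (∏ j, rootZeta (n + 2) (c j)) *
          if x ^ u i * s / x < c i.castSucc ∧ c i.castSucc ≤ x ^ u i then 1 else 0 := by
  have hk : n + 2 ≠ 0 := by lia
  have hN : q * s ≠ 0 := mul_ne_zero hq hs.ne_zero
  have hN0 : (0 : ℝ) < ((q * s : ℕ) : ℝ) := by exact_mod_cast Nat.pos_of_ne_zero hN
  have hx0 : 0 < x := hN0.trans_le hx
  have hw0 : ∀ c : Fin (n + 2) → ℕ, 0 ≤ ∏ j, rootZeta (n + 2) (c j) := fun c =>
    Finset.prod_nonneg fun j _ => rootZeta_nonneg _ _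
  have hTle : ∀ i, ((q * s : ℕ) : ℝ) ^ u i ≤ x ^ u i := fun i =>
    Real.rpow_le_rpow hN0.le hx (hu i)
  set ind : (Fin (n + 1) → ℝ) → (Fin (n + 2) → ℕ) → ℝ := fun T d =>
    if ∀ i : Fin (n + 1), (d i.castSucc : ℝ) ≤ T i then 1 else 0 with hind
  have hind0 : ∀ T d, 0 ≤ ind T d := by intro T d; simp only [hind]; split_ifs <;> norm_num
  have hind1 : ∀ T d, ind T d ≤ 1 := by intro T d; simp only [hind]; split_ifs <;> norm_num
  set w : (Fin (n + 2) → ℕ) → ℝ := fun c => ∏ j, rootZeta (n + 2) (c j) with hw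
  set TN : Fin (n + 1) → ℝ := fun i => ((q * s : ℕ) : ℝ) ^ u i with hTN
  set TX : Fin (n + 1) → ℝ := fun i => x ^ u i with hTX
  -- Both laws factor over q and s and give the s-part the same weight, so the discrepancy lives in
  -- the q-part alone.
  have e1 : factorizationCDF (n + 2) (q * s) u - weightedCDF n TX (q * s) =
      ∑ c ∈ Nat.finMulAntidiag (n + 2) s, w c * ∑ e ∈ Nat.finMulAntidiag (n + 2) q,
        (1 / (tauK (n + 2) q : ℝ) * ind TN (e * c) - w e * ind TX (e * c)) := by
    rw [factorizationCDF_eq hN, weightedCDF, ← Finset.sum_sub_distrib,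
      Nat.sum_finMulAntidiag_mul hqs]
    refine Finset.sum_congr rfl fun c hc => ?_
    rw [Finset.mul_sum]
    refine Finset.sum_congr rfl fun e he => ?_
    rw [prod_rootZeta_mul hqs hc he, tauK_mul hqs]
    have := prod_rootZeta_of_squarefree hk hs hc
    simp only [hw, hind, hTN, hTX]
    rw [mul_sub, this]
    push_cast
    ring
  have hsum1 : ∑ e ∈ Nat.finMulAntidiag (n + 2) q, 1 / (tauK (n + 2) q : ℝ) = 1 := by
    rw [Finset.sum_const, nsmul_eq_mul, mul_one_div]
    exact div_self (Nat.cast_ne_zero.2 (tauK_ne_zero hk hq))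
  have hsum2 : ∑ e ∈ Nat.finMulAntidiag (n + 2) q, w e = 1 := sum_prod_rootZeta hk hq
  have hinner : ∀ c ∈ Nat.finMulAntidiag (n + 2) s, |∑ e ∈ Nat.finMulAntidiag (n + 2) q,
        (1 / (tauK (n + 2) q : ℝ) * ind TN (e * c) - w e * ind TX (e * c))| ≤
      ∑ i : Fin (n + 1), if x ^ u i * s / x < c i.castSucc ∧ c i.castSucc ≤ x ^ u i
        then (1 : ℝ) else 0 := by
    intro c hc
    -- Once c fixes both indicators at a common value, the two total masses over e are 1 and cancel.
    have hconst : ∀ v : ℝ, (∀ e ∈ Nat.finMulAntidiag (n + 2) q,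
        ind TN (e * c) = v ∧ ind TX (e * c) = v) → |∑ e ∈ Nat.finMulAntidiag (n + 2) q,
        (1 / (tauK (n + 2) q : ℝ) * ind TN (e * c) - w e * ind TX (e * c))| = 0 := by
      intro v hv
      rw [Finset.sum_congr rfl fun e he => by rw [(hv e he).1, (hv e he).2],
        Finset.sum_sub_distrib, ← Finset.sum_mul, ← Finset.sum_mul, hsum1, hsum2]
      simp
    by_cases hbad : ∃ i : Fin (n + 1), x ^ u i * s / x < c i.castSucc ∧ c i.castSucc ≤ x ^ u i
    · obtain ⟨i, hi⟩ := hbad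
      have hge : (1 : ℝ) ≤ ∑ i : Fin (n + 1),
          if x ^ u i * s / x < c i.castSucc ∧ c i.castSucc ≤ x ^ u i then (1 : ℝ) else 0 := by
        refine le_trans (by rw [if_pos hi]) (Finset.single_le_sum (f := fun i : Fin (n + 1) =>
          if x ^ u i * s / x < c i.castSucc ∧ c i.castSucc ≤ x ^ u i then (1 : ℝ) else 0)
          (fun j _ => by positivity) (Finset.mem_univ i))
      refine le_trans ?_ hge
      rw [Finset.sum_sub_distrib]
      have a1 : ∑ e ∈ Nat.finMulAntidiag (n + 2) q,
          1 / (tauK (n + 2) q : ℝ) * ind TN (e * c) ≤ 1 := by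
        refine (Finset.sum_le_sum fun e _ => ?_).trans_eq hsum1
        exact mul_le_of_le_one_right (by positivity) (hind1 _ _)
      have a2 : ∑ e ∈ Nat.finMulAntidiag (n + 2) q, w e * ind TX (e * c) ≤ 1 := by
        refine (Finset.sum_le_sum fun e _ => ?_).trans_eq hsum2
        exact mul_le_of_le_one_right (hw0 e) (hind1 _ _)
      have a3 : 0 ≤ ∑ e ∈ Nat.finMulAntidiag (n + 2) q,
          1 / (tauK (n + 2) q : ℝ) * ind TN (e * c) :=
        Finset.sum_nonneg fun e _ => mul_nonneg (by positivity) (hind0 _ _)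
      have a4 : 0 ≤ ∑ e ∈ Nat.finMulAntidiag (n + 2) q, w e * ind TX (e * c) :=
        Finset.sum_nonneg fun e _ => mul_nonneg (hw0 e) (hind0 _ _)
      rw [abs_le]
      constructor <;> linarith
    · push Not at hbad
      refine le_trans (le_of_eq ?_) (Finset.sum_nonneg fun i _ => by positivity)
      by_cases hbig : ∃ i : Fin (n + 1), x ^ u i < c i.castSucc
      · obtain ⟨i, hi⟩ := hbig
        refine hconst 0 fun e he => ?_
        have he1 : (1 : ℝ) ≤ e i.castSucc := by
          exact_mod_cast Nat.one_le_iff_ne_zero.2 (Nat.ne_zero_of_mem_finMulAntidiag he _)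
        have hlt : x ^ u i < ((e * c) i.castSucc : ℕ) := by
          rw [Pi.mul_apply, Nat.cast_mul]
          exact hi.trans_le (le_mul_of_one_le_left (Nat.cast_nonneg _) he1)
        simp only [hind]
        refine ⟨if_neg fun h => ?_, if_neg fun h => ?_⟩
        · exact absurd ((h i).trans (hTle i)) (not_le.2 hlt)
        · exact absurd (h i) (not_le.2 hlt)
      · push Not at hbig
        -- Here every c_i is at most x^{u_i} s/x. Since e_i ≤ q, the product is at most x^{u_i} r
        -- with r = qs/x ≤ 1, and r ≤ r^{u_i} gives the bound (qs)^{u_i}.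
        refine hconst 1 fun e he => ?_
        have hle : ∀ i : Fin (n + 1), (((e * c) i.castSucc : ℕ) : ℝ) ≤
            ((q * s : ℕ) : ℝ) ^ u i := by
          intro i
          have hc1 : (c i.castSucc : ℝ) ≤ x ^ u i * s / x := by
            by_contra hcon
            exact absurd (hbad i (not_le.1 hcon)) (not_lt.2 (hbig i))
          have he1 : (e i.castSucc : ℝ) ≤ q := by
            exact_mod_cast Nat.le_of_dvd (Nat.pos_of_ne_zero hq)
              (Nat.dvd_of_mem_finMulAntidiag he _)
          set r : ℝ := ((q * s : ℕ) : ℝ) / x with hr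
          have hr0 : 0 < r := by positivity
          have hr1 : r ≤ 1 := (div_le_one hx0).2 hx
          have hrle : r ≤ r ^ u i := by
            calc r = r ^ (1 : ℝ) := (Real.rpow_one r).symm
              _ ≤ r ^ u i := Real.rpow_le_rpow_of_exponent_ge hr0 hr1 (hu1 i)
          calc (((e * c) i.castSucc : ℕ) : ℝ) = e i.castSucc * c i.castSucc := by
                rw [Pi.mul_apply, Nat.cast_mul]
            _ ≤ q * (x ^ u i * s / x) := by gcongr
            _ = x ^ u i * r := by rw [hr]; push_cast; ring
            _ ≤ x ^ u i * r ^ u i := by gcongr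
            _ = _ := by
              rw [← Real.mul_rpow hx0.le hr0.le, hr, mul_div_cancel₀ _ hx0.ne']
        simp only [hind]
        exact ⟨if_pos hle, if_pos fun i => (hle i).trans (hTle i)⟩
  rw [e1]
  refine (Finset.abs_sum_le_sum_abs _ _).trans ?_
  rw [Finset.sum_comm]
  refine Finset.sum_le_sum fun c hc => ?_
  rw [abs_mul, abs_of_nonneg (hw0 c), ← Finset.mul_sum]
  exact mul_le_mul_of_nonneg_left (hinner c hc) (hw0 c)

end

section

open MeasureTheory Set
open scoped ENNReal Classical

/-! ### Summation over the squarefull part -/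

/-- Start from N = b²a with a squarefree and divide out g = gcd(a, b): with a = gs and b = gc one
has N = g³c²s. Squarefreeness of gs makes s coprime to g, and the division makes it coprime to c. -/
lemma Nat.exists_squarefree_mul (N : ℕ) :
    ∃ s g c : ℕ, N = g ^ 3 * c ^ 2 * s ∧ Squarefree s ∧ (g ^ 3 * c ^ 2).Coprime s := by
  obtain ⟨a, b, hab, ha⟩ := Nat.sq_mul_squarefree N
  have ha0 : a ≠ 0 := ha.ne_zero
  have hg : 0 < a.gcd b := Nat.gcd_pos_of_pos_left _ (Nat.pos_of_ne_zero ha0)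
  obtain ⟨s, hs⟩ := Nat.gcd_dvd_left a b
  obtain ⟨c, hc⟩ := Nat.gcd_dvd_right a b
  have hcop := Nat.coprime_div_gcd_div_gcd hg
  set g := a.gcd b
  have hsa : Squarefree (g * s) := hs ▸ ha
  have e1 : a / g = s := by rw [hs, Nat.mul_div_cancel_left _ hg]
  have e2 : b / g = c := by rw [hc, Nat.mul_div_cancel_left _ hg]
  rw [e1, e2] at hcop
  refine ⟨s, g, c, ?_, hsa.of_mul_right, ?_⟩
  · rw [← hab, hs, hc]; ring
  · exact Nat.Coprime.mul_left ((Nat.coprime_of_squarefree_mul hsa).pow_left 3)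
      (hcop.symm.pow_left 2)

lemma card_filter_sq_le {X : ℕ} {y : ℝ} :
    (((Finset.Icc 1 X).filter fun c : ℕ => (c : ℝ) ^ 2 ≤ y).card : ℝ) ≤ √y := by
  calc (((Finset.Icc 1 X).filter fun c : ℕ => (c : ℝ) ^ 2 ≤ y).card : ℝ)
      ≤ ((Finset.Icc 1 ⌊√y⌋₊).card : ℝ) := by
        gcongr
        intro c hc
        rw [Finset.mem_filter, Finset.mem_Icc] at hc
        exact Finset.mem_Icc.2 ⟨hc.1.1, Nat.le_floor (Real.le_sqrt_of_sq_le hc.2)⟩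
    _ ≤ √y := by
        rw [Nat.card_Icc, Nat.add_sub_cancel]
        exact Nat.floor_le (Real.sqrt_nonneg y)

/-- The triple (s, g, c) determines N. For given s = m and g there are at most √(x/(m g³)) values of
c, and the sum of g^{-3/2} converges. -/
lemma exists_sum_squarefree_part_le : ∃ Z : ℝ, 0 ≤ Z ∧ ∀ (s g c : ℕ → ℕ) (Φ : ℕ → ℝ) (x : ℝ),
    (∀ N, N ≠ 0 → N = g N ^ 3 * c N ^ 2 * s N) → (∀ N, 0 ≤ Φ N) → 0 ≤ x →
      ∑ N ∈ Finset.Icc 1 ⌊x⌋₊, Φ (s N) ≤ Z * ∑ m ∈ Finset.Icc 1 ⌊x⌋₊, Φ m * √(x / m) := by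
  have hsum : Summable fun g : ℕ => (g : ℝ) ^ (-(3 / 2) : ℝ) :=
    Real.summable_nat_rpow.2 (by norm_num)
  refine ⟨∑' g : ℕ, (g : ℝ) ^ (-(3 / 2) : ℝ), tsum_nonneg fun g => by positivity,
    fun s g c Φ x hN hΦ hx => ?_⟩
  set X := ⌊x⌋₊
  set I := Finset.Icc 1 X
  set F : ℕ → ℕ × ℕ × ℕ := fun N => (s N, g N, c N) with hF
  have hinj : Set.InjOn F I := by
    intro N hN1 M hM1 hNM
    simp only [hF, Prod.mk.injEq] at hNM
    rw [hN N (by have := (Finset.mem_Icc.1 hN1).1; lia),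
      hN M (by have := (Finset.mem_Icc.1 hM1).1; lia), hNM.1, hNM.2.1, hNM.2.2]
  set S : Finset (ℕ × ℕ × ℕ) := (I ×ˢ I ×ˢ I).filter fun p =>
    (p.2.2 : ℝ) ^ 2 ≤ x / (p.1 * (p.2.1 : ℝ) ^ 3) with hS
  have hsub : I.image F ⊆ S := by
    intro p hp
    obtain ⟨N, hNI, rfl⟩ := Finset.mem_image.1 hp
    have hNI' := Finset.mem_Icc.1 hNI
    have hN0 : N ≠ 0 := by lia
    have h := hN N hN0
    have hne : g N ^ 3 * c N ^ 2 * s N ≠ 0 := h ▸ hN0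
    have hs0 : s N ≠ 0 := right_ne_zero_of_mul hne
    have hg0 : g N ≠ 0 := fun h0 => hne (by simp [h0])
    have hc0 : c N ≠ 0 := fun h0 => hne (by simp [h0])
    have d1 : s N ∣ N := ⟨_, by rw [mul_comm]; exact h⟩
    have d2 : g N ∣ N := by
      refine Dvd.dvd.trans ?_ (Dvd.intro _ h.symm)
      exact (dvd_pow_self _ (by norm_num)).mul_right _
    have d3 : c N ∣ N := by
      refine Dvd.dvd.trans ?_ (Dvd.intro _ h.symm)
      exact (dvd_pow_self _ (by norm_num)).mul_left _
    have hmem : ∀ d, d ≠ 0 → d ∣ N → d ∈ I := fun d hd0 hd =>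
      Finset.mem_Icc.2 ⟨Nat.one_le_iff_ne_zero.2 hd0,
        (Nat.le_of_dvd (Nat.pos_of_ne_zero hN0) hd).trans hNI'.2⟩
    simp only [hS, hF, Finset.mem_filter, Finset.mem_product]
    refine ⟨⟨hmem _ hs0 d1, hmem _ hg0 d2, hmem _ hc0 d3⟩, ?_⟩
    have hs0' : (0 : ℝ) < s N := by exact_mod_cast Nat.pos_of_ne_zero hs0
    have hg0' : (0 : ℝ) < g N := by exact_mod_cast Nat.pos_of_ne_zero hg0
    rw [le_div_iff₀ (by positivity)]
    have hNx : (N : ℝ) ≤ x := (Nat.le_floor_iff hx).1 hNI'.2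
    have h' : (N : ℝ) = (g N : ℝ) ^ 3 * (c N : ℝ) ^ 2 * s N := by exact_mod_cast h
    linarith
  calc ∑ N ∈ I, Φ (s N) = ∑ p ∈ I.image F, Φ p.1 := by rw [Finset.sum_image hinj]
    _ ≤ ∑ p ∈ S, Φ p.1 := Finset.sum_le_sum_of_subset_of_nonneg hsub fun _ _ _ => hΦ _
    _ = ∑ m ∈ I, ∑ b ∈ I, ((I.filter fun d : ℕ => (d : ℝ) ^ 2 ≤ x / (m * (b : ℝ) ^ 3)).card : ℝ) *
          Φ m := by
        rw [hS, Finset.sum_filter, Finset.sum_product]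
        refine Finset.sum_congr rfl fun m _ => ?_
        rw [Finset.sum_product]
        refine Finset.sum_congr rfl fun b _ => ?_
        dsimp only
        rw [← Finset.sum_filter, Finset.sum_const, nsmul_eq_mul]
    _ ≤ ∑ m ∈ I, ∑ b ∈ I, (√(x / m) * (b : ℝ) ^ (-(3 / 2) : ℝ)) * Φ m := by
        refine Finset.sum_le_sum fun m hm => Finset.sum_le_sum fun b hb => ?_
        refine mul_le_mul_of_nonneg_right (card_filter_sq_le.trans_eq ?_) (hΦ m)
        rw [← div_div, Real.sqrt_div' _ (by positivity), div_eq_mul_inv]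
        congr 1
        rw [Real.rpow_neg (by positivity), Real.sqrt_eq_rpow, ← Real.rpow_natCast,
          ← Real.rpow_mul (by positivity)]
        norm_num
    _ = (∑ b ∈ I, (b : ℝ) ^ (-(3 / 2) : ℝ)) * ∑ m ∈ I, Φ m * √(x / m) := by
        rw [Finset.sum_mul_sum, Finset.sum_comm]
        refine Finset.sum_congr rfl fun b _ => Finset.sum_congr rfl fun m _ => ?_
        ring
    _ ≤ _ := by
        refine mul_le_mul_of_nonneg_right (hsum.sum_le_tsum _ fun b _ => by positivity)
          (Finset.sum_nonneg fun m _ => mul_nonneg (hΦ m) (Real.sqrt_nonneg _))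

/-! ### The borderline factorizations -/

/-- The mass of the borderline factorizations. -/
lemma exists_borderline_le {n : ℕ} {κ K : ℝ} (hκ : 0 < κ) (hn : (n + 2) * κ = 1) (hK : 0 ≤ K)
    (htame : TameMeasure κ K (rootMeasure (n + 2))) :
    ∃ C : ℝ, 0 ≤ C ∧ ∀ (x v : ℝ) (i : Fin (n + 2)), 1 ≤ x → 0 ≤ v → v ≤ 1 →
      1 / x * ∑ s ∈ Finset.Icc 1 ⌊x⌋₊, (∑ c ∈ Nat.finMulAntidiag (n + 2) s,
        (∏ j, rootZeta (n + 2) (c j)) *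
          if x ^ v * s / x < c i ∧ c i ≤ x ^ v then 1 else 0) * √(x / s) ≤
      C * (1 + Real.log x) ^ (-κ) := by
  have hn0 : (0 : ℝ) ≤ n := Nat.cast_nonneg n
  have hκ2 : κ ≤ 1 / 2 := by nlinarith
  have hκn : (n + 1) * κ = 1 - κ := by linarith
  have hσ : SigmaFinite (rootMeasure (n + 2)) := htame.sigmaFinite hκ (by linarith) hK
  obtain ⟨C₁, hC₁, hρ⟩ := exists_tame_sumPi hκ hK n (by linarith)
  have hρt : TameMeasure (1 - κ) C₁ (sumPi fun _ : Fin (n + 1) => rootMeasure (n + 2)) := by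
    rw [← hκn]; exact hρ _ (fun _ => hσ) fun _ => htame
  have hT := tameIntegralConst_pos hκ
  have hT' := tameIntegralConst_pos (α := 1 - κ) (by linarith)
  refine ⟨16 * (tameIntegralConst κ * K) * (16 * (tameIntegralConst (1 - κ) * C₁)), by positivity,
    fun x v i hx hv hv1 => ?_⟩
  have hx0 : 0 < x := by linarith
  set L := Real.log x with hLdef
  have hL : 0 ≤ L := Real.log_nonneg hx
  set a := v * L with ha
  have ha0 : 0 ≤ a := by positivity
  have haL : a ≤ L := by nlinarith
  -- In logarithms the borderline condition says that coordinate i is at most a and the others sum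
  -- to at most L - a. The weight √(s/x) = e^{(log s - L)/2} splits as a product of exponentials of
  -- the two gaps, so the integral factors.
  set g : ℝ × ℝ → ℝ≥0∞ := fun p =>
    (Iic (L - a)).indicator (fun w => ENNReal.ofReal (Real.exp (-((L - a - w) / 2)))) p.2 *
    (Iic a).indicator (fun z => ENNReal.ofReal (Real.exp (-((a - z) / 2)))) p.1 with hg
  have m1 : Measurable ((Iic (L - a)).indicator fun w =>
      ENNReal.ofReal (Real.exp (-((L - a - w) / 2)))) :=
    Measurable.indicator (by fun_prop) measurableSet_Iic
  have m2 : Measurable ((Iic a).indicator fun z => ENNReal.ofReal (Real.exp (-((a - z) / 2)))) :=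
    Measurable.indicator (by fun_prop) measurableSet_Iic
  have hgm : Measurable g := (m1.comp measurable_snd).mul (m2.comp measurable_fst)
  set G : (Fin (n + 2) → ℝ) → ℝ≥0∞ := fun t => g (t i, ∑ j, t (i.succAbove j)) with hG
  have hGm : Measurable G := hgm.comp (by fun_prop)
  have hG0 : ∀ t, L < ∑ j, t j → G t = 0 := by
    intro t ht
    rw [Fin.sum_univ_succAbove _ i] at ht
    simp only [hG, hg]
    by_cases h1 : t i ≤ a
    · rw [indicator_of_notMem, zero_mul]
      simp only [mem_Iic, not_le]; linarith
    · rw [indicator_of_notMem (s := Iic a) (by simpa using h1), mul_zero]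
  have hint : ∫⁻ t, G t ∂(Measure.pi fun _ : Fin (n + 2) => rootMeasure (n + 2)) ≤
      ENNReal.ofReal (16 * (tameIntegralConst κ * K) * (16 * (tameIntegralConst (1 - κ) * C₁)) *
        (1 + L) ^ (-κ)) := by
    rw [hG, lintegral_pi_succAbove (fun _ : Fin (n + 2) => rootMeasure (n + 2)) i hgm]
    simp only [hg]
    simp_rw [lintegral_const_mul _ m2]
    rw [lintegral_mul_const _ m1, lintegral_indicator measurableSet_Iic,
      lintegral_indicator measurableSet_Iic]
    refine (mul_le_mul' (hρt.lintegral_exp_half_le (by linarith) (by linarith) hC₁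
      (sub_nonneg.2 haL)) (htame.lintegral_exp_half_le hκ (by linarith) hK ha0)).trans ?_
    have h3 : 0 ≤ (1 + (L - a)) ^ (-κ) := Real.rpow_nonneg (by linarith) _
    rw [show 1 - κ - 1 = -κ by ring, ← ENNReal.ofReal_mul (by positivity)]
    refine ENNReal.ofReal_le_ofReal ?_
    have h1 : (1 + a) ^ (κ - 1) ≤ (1 + a) ^ (-κ) :=
      Real.rpow_le_rpow_of_exponent_le (by linarith) (by linarith)
    have h2 := one_add_rpow_mul_le hκ ha0 haL
    calc _ = 16 * (tameIntegralConst κ * K) * (16 * (tameIntegralConst (1 - κ) * C₁)) *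
          ((1 + a) ^ (κ - 1) * (1 + (L - a)) ^ (-κ)) := by ring
      _ ≤ 16 * (tameIntegralConst κ * K) * (16 * (tameIntegralConst (1 - κ) * C₁)) *
          ((1 + a) ^ (-κ) * (1 + (L - a)) ^ (-κ)) := by gcongr
      _ ≤ _ := by gcongr
  rw [lintegral_pi_rootMeasure_eq_sum (n + 2) (n + 2) hx hGm hG0] at hint
  refine (ENNReal.ofReal_le_ofReal_iff (by positivity)).1 (le_trans ?_ hint)
  have hw0 : ∀ c : Fin (n + 2) → ℕ, 0 ≤ ∏ j, rootZeta (n + 2) (c j) := fun c =>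
    Finset.prod_nonneg fun j _ => rootZeta_nonneg _ _
  simp_rw [Finset.mul_sum, Finset.sum_mul, Finset.mul_sum]
  rw [ENNReal.ofReal_sum_of_nonneg fun s _ => Finset.sum_nonneg fun c _ => by
    have := hw0 c; positivity]
  refine Finset.sum_le_sum fun s hs => ?_
  rw [ENNReal.ofReal_sum_of_nonneg fun c _ => by have := hw0 c; positivity]
  refine Finset.sum_le_sum fun c hc => ?_
  split_ifs with hbad
  · have hs1 := (Finset.mem_Icc.1 hs).1
    have hs0 : (0 : ℝ) < s := by exact_mod_cast hs1
    have hc0 : ∀ j, (c j : ℝ) ≠ 0 := fun j =>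
      Nat.cast_ne_zero.2 (Nat.ne_zero_of_mem_finMulAntidiag hc j)
    have hci : (0 : ℝ) < c i := lt_of_le_of_ne (Nat.cast_nonneg _) (hc0 i).symm
    have hlog : ∑ j, Real.log (c j) = Real.log s := by
      rw [← Real.log_prod fun j _ => hc0 j, ← Nat.cast_prod, Nat.prod_eq_of_mem_finMulAntidiag hc]
    rw [Fin.sum_univ_succAbove _ i] at hlog
    have h1 : Real.log (c i) ≤ a := by
      rw [ha, hLdef, ← Real.log_rpow hx0]
      exact Real.log_le_log hci hbad.2
    have h2 : ∑ j, Real.log (c (i.succAbove j)) ≤ L - a := by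
      have := Real.log_le_log (by positivity) hbad.1.le
      rw [Real.log_div (by positivity) hx0.ne', Real.log_mul (by positivity) hs0.ne',
        Real.log_rpow hx0] at this
      linarith
    have hGval : G (fun j => Real.log (c j)) = ENNReal.ofReal (√(s / x)) := by
      simp only [hG, hg]
      rw [indicator_of_mem (mem_Iic.2 h2), indicator_of_mem (mem_Iic.2 h1),
        ← ENNReal.ofReal_mul (Real.exp_pos _).le, ← Real.exp_add]
      congr 1
      rw [show -((L - a - ∑ j, Real.log (c (i.succAbove j))) / 2) + -((a - Real.log (c i)) / 2) =
        (Real.log s - L) / 2 by linarith, hLdef, ← Real.log_div hs0.ne' hx0.ne',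
        Real.exp_half, Real.exp_log (by positivity)]
    rw [hGval, ← ENNReal.ofReal_mul (by have := hw0 c; positivity)]
    refine ENNReal.ofReal_le_ofReal (le_of_eq ?_)
    have hss : √(s / x) = s / x * √(x / s) := by
      rw [Real.sqrt_eq_iff_mul_self_eq (by positivity) (by positivity)]
      have : √(x / s) * √(x / s) = x / s := Real.mul_self_sqrt (by positivity)
      symm
      calc s / x * √(x / s) * (s / x * √(x / s)) = (s / x) ^ 2 * (√(x / s) * √(x / s)) := by ring
        _ = s / x := by rw [this]; field_simp
    rw [hss]
    field_simp
  · simp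

end

section

open MeasureTheory Set
open scoped ENNReal Classical

/-! ### The main theorem -/

/-- The weighted count as an exponential mean of a truncated convolution power. -/
lemma ofReal_sum_weightedCDF {n : ℕ} [SigmaFinite (rootMeasure (n + 2))] {x : ℝ} (hx : 1 ≤ x)
    (u : Fin (n + 1) → ℝ) :
    ENNReal.ofReal (1 / x * ∑ N ∈ Finset.Icc 1 ⌊x⌋₊, weightedCDF n (fun i => x ^ u i) N) =
      expMeanENN (sumPi fun i : Fin (n + 2) => (rootMeasure (n + 2)).restrict
        (Iic (Fin.snoc (α := fun _ => ℝ) (fun j => Real.log x * u j) (Real.log x) i)))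
          (Real.log x) := by
  have hx0 : 0 < x := by linarith
  set L := Real.log x with hL
  set b : Fin (n + 2) → ℝ := Fin.snoc (α := fun _ => ℝ) (fun j => L * u j) L with hb
  have hm : Measurable fun w : ℝ => if w ≤ L then ENNReal.ofReal (Real.exp (w - L)) else 0 :=
    Measurable.ite measurableSet_Iic (by fun_prop) measurable_const
  have hS : MeasurableSet (Set.univ.pi fun i : Fin (n + 2) => Iic (b i)) :=
    MeasurableSet.univ_pi fun i => measurableSet_Iic
  set G : (Fin (n + 2) → ℝ) → ℝ≥0∞ := (Set.univ.pi fun i : Fin (n + 2) => Iic (b i)).indicator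
    fun t => if ∑ i, t i ≤ L then ENNReal.ofReal (Real.exp (∑ i, t i - L)) else 0 with hG
  have hGm : Measurable G := (hm.comp (measurable_sum_fin _)).indicator hS
  have hG0 : ∀ t, L < ∑ i, t i → G t = 0 := by
    intro t ht
    simp only [hG, indicator]
    rw [if_neg (not_le.2 ht), ite_self]
  have hw0 : ∀ c : Fin (n + 2) → ℕ, 0 ≤ ∏ j, rootZeta (n + 2) (c j) := fun c =>
    Finset.prod_nonneg fun j _ => rootZeta_nonneg _ _
  rw [expMeanENN_eq, lintegral_sumPi _ hm, ← Measure.restrict_pi_pi, ← lintegral_indicator hS,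
    lintegral_pi_rootMeasure_eq_sum (n + 2) (n + 2) hx hGm hG0]
  simp_rw [weightedCDF, Finset.mul_sum]
  rw [ENNReal.ofReal_sum_of_nonneg fun s _ => Finset.sum_nonneg fun c _ => by
    have := hw0 c; positivity]
  refine Finset.sum_congr rfl fun N hN => ?_
  rw [ENNReal.ofReal_sum_of_nonneg fun c _ => by have := hw0 c; positivity]
  refine Finset.sum_congr rfl fun d hd => ?_
  have hN' := Finset.mem_Icc.1 hN
  have hN0 : (0 : ℝ) < N := by exact_mod_cast hN'.1
  have hNx : (N : ℝ) ≤ x := (Nat.le_floor_iff hx0.le).1 hN'.2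
  have hd0 : ∀ j, (0 : ℝ) < d j := fun j => by
    exact_mod_cast Nat.pos_of_ne_zero (Nat.ne_zero_of_mem_finMulAntidiag hd j)
  have hlog : ∑ j, Real.log (d j) = Real.log N := by
    rw [← Real.log_prod fun j _ => (hd0 j).ne', ← Nat.cast_prod,
      Nat.prod_eq_of_mem_finMulAntidiag hd]
  have hmem : (fun j => Real.log (d j)) ∈ (Set.univ.pi fun i : Fin (n + 2) => Iic (b i)) ↔
      ∀ i : Fin (n + 1), (d i.castSucc : ℝ) ≤ x ^ u i := by
    simp only [Set.mem_pi, mem_univ, true_implies, mem_Iic]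
    rw [Fin.forall_fin_succ']
    simp only [hb, Fin.snoc_castSucc, Fin.snoc_last]
    have hlast : Real.log (d (Fin.last (n + 1))) ≤ L := by
      refine Real.log_le_log (hd0 _) (le_trans ?_ hNx)
      exact_mod_cast Nat.le_of_dvd hN'.1 (Nat.dvd_of_mem_finMulAntidiag hd _)
    rw [and_iff_left hlast]
    refine forall_congr' fun i => ?_
    rw [mul_comm, hL, ← Real.log_rpow hx0, Real.log_le_log_iff (hd0 _) (by positivity)]
  by_cases h : ∀ i : Fin (n + 1), (d i.castSucc : ℝ) ≤ x ^ u i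
  · rw [if_pos h, mul_one, hG, indicator_of_mem (hmem.2 h), hlog,
      if_pos (Real.log_le_log hN0 hNx), ← ENNReal.ofReal_mul (div_nonneg (hw0 d) hN0.le), hL,
      ← Real.log_div hN0.ne' hx0.ne', Real.exp_log (by positivity)]
    congr 1
    field_simp
  · rw [if_neg h, hG, indicator_of_notMem fun hcon => h (hmem.1 hcon)]
    simp

lemma dirichletCDF_nonneg {n : ℕ} {κ : ℝ} (hκ : 0 < κ) (hn : (n + 2) * κ = 1)
    {u : Fin (n + 1) → ℝ} (hu1 : ∑ i, u i ≤ 1) :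
    0 ≤ dirichletCDF (k := n + 2) (fun _ => κ) u := by
  rw [dirichletCDF_eq hn one_pos hu1]
  refine setIntegral_nonneg measurableSet_Icc fun v hv => ?_
  refine mul_nonneg (Finset.prod_nonneg fun i _ => rpowDensity_nonneg hκ (hv.1 i))
    (rpowDensity_nonneg hκ ?_)
  have : ∑ i, v i ≤ ∑ i, u i := Finset.sum_le_sum fun i _ => by simpa using hv.2 i
  linarith

lemma weightedCDF_nonneg (n : ℕ) (T : Fin (n + 1) → ℝ) (N : ℕ) : 0 ≤ weightedCDF n T N :=
  Finset.sum_nonneg fun d _ => mul_nonneg (Finset.prod_nonneg fun j _ => rootZeta_nonneg _ _)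
    (by positivity)

/-- The mean of the weighted proportions is close to the Dirichlet distribution function. -/
lemma exists_weighted_mean_sub_dirichletCDF_le (n : ℕ) :
    ∃ C : ℝ, 0 ≤ C ∧ ∀ x : ℝ, 1 < x → ∀ u : Fin (n + 1) → ℝ, (∀ i, 0 ≤ u i) → ∑ i, u i ≤ 1 →
      |1 / x * ∑ N ∈ Finset.Icc 1 ⌊x⌋₊, weightedCDF n (fun i => x ^ u i) N -
        dirichletCDF (k := n + 2) (fun _ => 1 / ((n + 2 : ℕ) : ℝ)) u| ≤
      C * (1 + Real.log x) ^ (-(1 / ((n + 2 : ℕ) : ℝ))) := by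
  set κ : ℝ := 1 / ((n + 2 : ℕ) : ℝ) with hκdef
  have hκ : 0 < κ := by positivity
  have hn : (n + 2) * κ = 1 := by rw [hκdef]; push_cast; field_simp
  have hn0 : (0 : ℝ) ≤ n := Nat.cast_nonneg n
  have hκ1 : κ ≤ 1 := by nlinarith
  obtain ⟨K₁, hK₁, ht₁, hr⟩ := exists_tame_rootMeasure (k := n + 2) (by lia)
  obtain ⟨K₂, hK₂, ht₂, -⟩ := exists_tame_rpowMeasure hκ hκ1
  rw [← hκdef] at ht₁ hr
  have hσ : SigmaFinite (rootMeasure (n + 2)) := ht₁.sigmaFinite hκ hκ1 hK₁.le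
  set K := K₁ + K₂ with hK
  have hK0 : 0 ≤ K := by positivity
  have f₁ : ∀ v, expMeanENN (rootMeasure (n + 2)) v < ∞ :=
    expMeanENN_lt_top one_pos (integrable_exp_rootMeasure (by lia) one_pos)
  have f₂ : ∀ v, expMeanENN (rpowMeasure κ) v < ∞ :=
    expMeanENN_lt_top one_pos (integrable_exp_rpowMeasure hκ one_pos)
  have hr' : ∀ {θ₁ θ₂ : Measure ℝ}, (∀ v, expMeanENN θ₁ v < ∞) → (∀ v, expMeanENN θ₂ v < ∞) →
      (∀ y, 0 ≤ y → |expMean θ₁ y - expMean θ₂ y| ≤ K₁ * (1 + y) ^ (-(3 / 2) : ℝ)) →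
      ∀ b, 0 ≤ b → expMeanENN θ₁ b ≤
        expMeanENN θ₂ b + ENNReal.ofReal (K * (1 + b) ^ (-(3 / 2) : ℝ)) := by
    intro θ₁ θ₂ g₁ g₂ h b hb
    rw [← ENNReal.ofReal_toReal (g₁ b).ne, ← ENNReal.ofReal_toReal (g₂ b).ne,
      ← ENNReal.ofReal_add ENNReal.toReal_nonneg (by positivity)]
    refine ENNReal.ofReal_le_ofReal ?_
    have h1 := (abs_le.1 (h b hb)).2
    have h2 : K₁ * (1 + b) ^ (-(3 / 2) : ℝ) ≤ K * (1 + b) ^ (-(3 / 2) : ℝ) := by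
      gcongr; linarith
    simp only [expMean] at h1
    linarith
  have ht₁' := ht₁.mono_const (show K₁ ≤ K by linarith)
  have ht₂' := ht₂.mono_const (show K₂ ≤ K by linarith)
  -- The replacement lemma is one-sided and is applied with the two measures in either order.
  obtain ⟨A, hA, hAb⟩ := expMeanENN_sumPi_restrict_le hK0 hκ ht₁' ht₂' (hr' f₁ f₂ hr) n hn
  obtain ⟨B, hB, hBb⟩ := expMeanENN_sumPi_restrict_le hK0 hκ ht₂' ht₁'
    (hr' f₂ f₁ fun y hy => by rw [abs_sub_comm]; exact hr y hy) n hn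
  obtain ⟨D, hD, hDb⟩ := exists_sumPi_rpowMeasure_le hκ hn
  refine ⟨A + B + D, by positivity, fun x hx u hu hu1 => ?_⟩
  have hL : 0 < Real.log x := Real.log_pos hx
  set L := Real.log x
  have hp : 0 < (1 + L) ^ (-κ) := by positivity
  have hui : ∀ i, u i ≤ 1 := fun i =>
    (Finset.single_le_sum (fun j _ => hu j) (Finset.mem_univ i)).trans hu1
  set b : Fin (n + 2) → ℝ := Fin.snoc (α := fun _ => ℝ) (fun j => L * u j) L with hb
  have hb0 : ∀ i, 0 ≤ b i := by
    refine (Fin.forall_fin_succ').2 ⟨fun i => ?_, ?_⟩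
    · rw [hb, Fin.snoc_castSucc]; exact mul_nonneg hL.le (hu i)
    · rw [hb, Fin.snoc_last]; exact hL.le
  have hbL : ∀ i, b i ≤ L := by
    refine (Fin.forall_fin_succ').2 ⟨fun i => ?_, ?_⟩
    · rw [hb, Fin.snoc_castSucc]; exact mul_le_of_le_one_right hL.le (hui i)
    · rw [hb, Fin.snoc_last]
  set S := 1 / x * ∑ N ∈ Finset.Icc 1 ⌊x⌋₊, weightedCDF n (fun i => x ^ u i) N with hS
  have hS0 : 0 ≤ S := mul_nonneg (by positivity)
    (Finset.sum_nonneg fun N _ => weightedCDF_nonneg _ _ _)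
  have hF0 := dirichletCDF_nonneg hκ hn hu1
  set F := dirichletCDF (k := n + 2) (fun _ => κ) u with hF
  have hSE : ENNReal.ofReal S = _ := ofReal_sum_weightedCDF hx.le u
  obtain ⟨d1, d2⟩ := hDb L u hL hu hu1
  have u1 : ENNReal.ofReal S ≤ ENNReal.ofReal (F + D * (1 + L) ^ (-κ) + A * (1 + L) ^ (-κ)) := by
    rw [hSE, ENNReal.ofReal_add (by positivity) (by positivity),
      ENNReal.ofReal_add hF0 (by positivity)]
    exact (hAb b L hb0 hbL).trans (add_le_add d1 le_rfl)
  have u2 : ENNReal.ofReal F ≤ ENNReal.ofReal (S + B * (1 + L) ^ (-κ) + D * (1 + L) ^ (-κ)) := by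
    rw [ENNReal.ofReal_add (by positivity) (by positivity), ENNReal.ofReal_add hS0 (by positivity),
      hSE]
    exact d2.trans (add_le_add (hBb b L hb0 hbL) le_rfl)
  rw [ENNReal.ofReal_le_ofReal_iff (by positivity)] at u1 u2
  have : 0 ≤ A * (1 + L) ^ (-κ) := by positivity
  have : 0 ≤ B * (1 + L) ^ (-κ) := by positivity
  rw [abs_le]
  constructor <;> linarith

/-- The means of the uniform and of the weighted proportions are close. -/
lemma exists_factorization_mean_sub_weighted_le (n : ℕ) :
    ∃ C : ℝ, 0 ≤ C ∧ ∀ x : ℝ, 1 < x → ∀ u : Fin (n + 1) → ℝ, (∀ i, 0 ≤ u i) → (∀ i, u i ≤ 1) →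
      |1 / x * ∑ N ∈ Finset.Icc 1 ⌊x⌋₊, factorizationCDF (n + 2) N u -
        1 / x * ∑ N ∈ Finset.Icc 1 ⌊x⌋₊, weightedCDF n (fun i => x ^ u i) N| ≤
      C * (1 + Real.log x) ^ (-(1 / ((n + 2 : ℕ) : ℝ))) := by
  set κ : ℝ := 1 / ((n + 2 : ℕ) : ℝ) with hκdef
  have hκ : 0 < κ := by positivity
  have hn : (n + 2) * κ = 1 := by rw [hκdef]; push_cast; field_simp
  obtain ⟨K, hK, ht, -⟩ := exists_tame_rootMeasure (k := n + 2) (by lia)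
  obtain ⟨C, hC, hCb⟩ := exists_borderline_le hκ hn hK.le ht
  obtain ⟨Z, hZ, hZb⟩ := exists_sum_squarefree_part_le
  choose s g c hN hs hcop using Nat.exists_squarefree_mul
  refine ⟨(n + 1) * (Z * C), by positivity, fun x hx u hu hu1 => ?_⟩
  have hx0 : 0 < x := by linarith
  set Ψ : Fin (n + 1) → ℕ → ℝ := fun i m => ∑ c ∈ Nat.finMulAntidiag (n + 2) m,
    (∏ j, rootZeta (n + 2) (c j)) *
      if x ^ u i * m / x < c i.castSucc ∧ c i.castSucc ≤ x ^ u i then 1 else 0 with hΨ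
  have hΨ0 : ∀ i m, 0 ≤ Ψ i m := fun i m => Finset.sum_nonneg fun c _ =>
    mul_nonneg (Finset.prod_nonneg fun j _ => rootZeta_nonneg _ _) (by positivity)
  have hpt : ∀ N ∈ Finset.Icc 1 ⌊x⌋₊,
      |factorizationCDF (n + 2) N u - weightedCDF n (fun i => x ^ u i) N| ≤ ∑ i, Ψ i (s N) := by
    intro N hNI
    have hNI' := Finset.mem_Icc.1 hNI
    have h0 : N ≠ 0 := by lia
    have hq : g N ^ 3 * c N ^ 2 ≠ 0 := left_ne_zero_of_mul ((hN N) ▸ h0)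
    have hNx : ((g N ^ 3 * c N ^ 2 * s N : ℕ) : ℝ) ≤ x := by
      rw [← hN N]; exact (Nat.le_floor_iff hx0.le).1 hNI'.2
    have := abs_factorizationCDF_sub_le (hcop N) (hs N) hq hNx hu hu1
    rwa [← hN N] at this
  rw [← mul_sub, ← Finset.sum_sub_distrib, abs_mul, abs_of_pos (by positivity)]
  calc 1 / x * |∑ N ∈ Finset.Icc 1 ⌊x⌋₊,
        (factorizationCDF (n + 2) N u - weightedCDF n (fun i => x ^ u i) N)|
      ≤ 1 / x * ∑ N ∈ Finset.Icc 1 ⌊x⌋₊, ∑ i, Ψ i (s N) := by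
        gcongr
        exact (Finset.abs_sum_le_sum_abs _ _).trans (Finset.sum_le_sum hpt)
    _ = ∑ i, 1 / x * ∑ N ∈ Finset.Icc 1 ⌊x⌋₊, Ψ i (s N) := by
        rw [Finset.sum_comm, Finset.mul_sum]
    _ ≤ ∑ _i : Fin (n + 1), Z * (C * (1 + Real.log x) ^ (-κ)) := by
        refine Finset.sum_le_sum fun i _ => ?_
        calc 1 / x * ∑ N ∈ Finset.Icc 1 ⌊x⌋₊, Ψ i (s N)
            ≤ 1 / x * (Z * ∑ m ∈ Finset.Icc 1 ⌊x⌋₊, Ψ i m * √(x / m)) := by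
              gcongr
              exact hZb s g c (Ψ i) x (fun N _ => hN N) (hΨ0 i) hx0.le
          _ = Z * (1 / x * ∑ m ∈ Finset.Icc 1 ⌊x⌋₊, Ψ i m * √(x / m)) := by ring
          _ ≤ _ := by
              exact mul_le_mul_of_nonneg_left (hCb x (u i) i.castSucc hx.le (hu i) (hu1 i)) hZ
    _ = _ := by
        rw [Finset.sum_const, Finset.card_univ, Fintype.card_fin, nsmul_eq_mul]
        push_cast; ring

end

theorem mainTheorem1 (k : ℕ) (hk : 2 ≤ k) :
    ∃ C : ℝ, ∀ x : ℝ, 2 ≤ x → ∀ u : Fin (k - 1) → ℝ, (∀ i, 0 ≤ u i) → ∑ i, u i ≤ 1 →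
      |(1 / x * ∑ n ∈ Finset.Icc 1 ⌊x⌋₊, factorizationCDF k n u)
          - dirichletCDF (fun _ : Fin k => 1 / (k : ℝ)) u|
        ≤ C * (1 / Real.log x ^ (1 / (k : ℝ))) := by
  obtain ⟨n, rfl⟩ := Nat.exists_eq_add_of_le' hk
  obtain ⟨A, hA, hAb⟩ := exists_weighted_mean_sub_dirichletCDF_le n
  obtain ⟨B, hB, hBb⟩ := exists_factorization_mean_sub_weighted_le n
  refine ⟨B + A, fun x hx u hu hu1 => ?_⟩
  have hx1 : 1 < x := by linarith
  have hL : 0 < Real.log x := Real.log_pos hx1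
  have hui : ∀ i, u i ≤ 1 := fun i =>
    (Finset.single_le_sum (fun j _ => hu j) (Finset.mem_univ i)).trans hu1
  refine (abs_sub_le _ _ _).trans ((add_le_add (hBb x hx1 u hu hui) (hAb x hx1 u hu hu1)).trans ?_)
  rw [← add_mul]
  gcongr
  rw [one_div (Real.log x ^ _), ← Real.rpow_neg hL.le]
  exact Real.rpow_le_rpow_of_nonpos hL (by linarith) (neg_nonpos.2 (by positivity))
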